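/- **Corollary (Fuzzy Mean RDD).** Let $(Y,D,X)$ be a real random vector on a probability space $(\Omega^x,\mathcal F^x,P^x)$, let $(Y_i,D_i,X_i)$, $i\ge1$, be independent copies of it, let $\underline x<0<\overline x$, and write $I=[\underline x,\overline x]$, $g(0^\pm)=\lim_{x\to0^\pm}g(x)$. Fix a version over $I$ of $\mu_1(x)=E[Y\mid X=x]$, $\mu_2(x)=E[D\mid X=x]$, $\sigma_{11}(x)=V(Y\mid X=x)$, $\sigma_{22}(x)=V(D\mid X=x)$, $\sigma_{12}(x)=\mathrm{Cov}(Y,D\mid X=x)$. Assume: * (S) $X$ has a density $f_X$ which is continuously differentiable on $I$, with $0<f_X(0)<\infty$. * (K) $K:[-1,1]\to[0,\infty)$ (extended by $0$) is bounded and continuous; $\{K(\cdot/h):h>0\}$ is of VC type, i.e. for some measurable envelope $F$ and constants $A,V\ge1$ the covering numbers satisfy $N(\epsilon\|F\|_{Q,2},\{K(\cdot/h)\},\|\cdot\|_{Q,2})\le(A/\epsilon)^V$ for all $0<\epsilon\le1$ and all probability measures $Q$; and $\Gamma^\pm=\int_{\mathbb R_\pm}K(u)r(u)r(u)'\,du$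 is positive definite, where $r(u)=(1,u,u^2)'$. * (M) $\xi_1,\xi_2,\dots$ are independent standard normal variables on a probability space $(\Omega^\xi,\mathcal F^\xi,P^\xi)$, independent of $(\Omega^x,\mathcal F^x,P^x)$ (one works on the product space). * (FMRD) (i) for some $\epsilon>0$, $E[|Y|^{2+\epsilon}\mid X=\cdot]$ and $E[|D|^{2+\epsilon}\mid X=\cdot]$ are bounded on $I\setminus\{0\}$ (for $D$ this is automatic if $D$ is a treatment indicator); $\mu_1^{(j)},\mu_2^{(j)}$ exist and are Lipschitz on $[\underline x,0)$ and on $(0,\overline x]$ for $j=0,1,2,3$; $\mu_2(0^+)\ne\mu_2(0^-)$; (ii) the bandwidths $h_n>0$ satisfy $h_n\to0$, $nh_n^2\to\infty$, $nh_n^7\to0$, and $h_{k,n}=c_kh_n$ with constants $c_1,c_2>0$; (iii) $\sigma_{11},\sigma_{22}$ are continuously differentiable on $I\setminus\{0\}$ with bounded derivatives, $0<\sigma_{11}(0^\pm)<\infty$, and $\sigma_{12}$ has finite limits $\sigma_{12}(0^+)$, $\sigma_{12}(0^-)$. * (Non-degeneracy) With $\tau_{FMRD}=\dfrac{\mu_1(0^+)-\mu_1(0^-)}{\mu_2(0^+)-\mu_2(0^-)}$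 and $s(x)=\sigma_{11}(x)-2\tau_{FMRD}\sigma_{12}(x)+\tau_{FMRD}^2\sigma_{22}(x)=V(Y-\tau_{FMRD}D\mid X=x)$: if $c_1=c_2$, then $s(0^+)>0$ or $s(0^-)>0$. Let $\delta_i^+=1\{X_i\ge0\}$, $\delta_i^-=1\{X_i\le0\}$, and let $\hat\alpha_{1\pm}$, $\hat\alpha_{2\pm}$ be measurable minimizers over $\alpha\in\mathbb R^3$ of $\sum_{i=1}^n\delta_i^\pm(Z_i-r(X_i/h_{k,n})'\alpha)^2K(X_i/h_{k,n})$, with $Z_i=Y_i$ for $k=1$ and $Z_i=D_i$ for $k=2$. Let $\hat\mu_k(0^\pm)$ be the first coordinate of $\hat\alpha_{k\pm}$, and put $$\hat\tau_{FMRD}=\frac{\hat\mu_1(0^+)-\hat\mu_1(0^-)}{\hat\mu_2(0^+)-\hat\mu_2(0^-)},\qquad \tilde\mu_k(x)=r(x/h_{k,n})'\hat\alpha_{k+}1\{x\ge0\}+r(x/h_{k,n})'\hat\alpha_{k-}1\{x\le0\}.$$ For an estimator $\hat f_X(0)$ of $f_X(0)$ let, with $e_0=(1,0,0)'$, $$\hat\nu^\pm_{\xi,n}(k)=\sum_{i=1}^n\xi_i\frac{e_0'(\Gamma^\pm)^{-1}[Z_i-\tilde\mu_k(X_i)]\,r(X_i/h_{k,n})K(X_i/h_{k,n})\delta_i^\pm}{\sqrt{nh_{k,n}}\,\hat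 f_X(0)},\qquad \hat{\mathbb X}'_n(k)=\frac{\hat\nu^+_{\xi,n}(k)-\hat\nu^-_{\xi,n}(k)}{\sqrt{c_k}}.$$ Then there exists $\sigma_{FMRD}>0$ such that (i) $\sqrt{nh_n}\,[\hat\tau_{FMRD}-\tau_{FMRD}]\leadsto N(0,\sigma^2_{FMRD})$; (ii) for every consistent estimator $\hat f_X(0)$ of $f_X(0)$, the ratio $$T_n=\frac{(\hat\mu_2(0^+)-\hat\mu_2(0^-))\,\hat{\mathbb X}'_n(1)-(\hat\mu_1(0^+)-\hat\mu_1(0^-))\,\hat{\mathbb X}'_n(2)}{(\hat\mu_2(0^+)-\hat\mu_2(0^-))^2}$$ converges weakly, conditionally on the data and in probability, to the same law: $\sup_{g}\big|E_{\xi\mid x}\,g(T_n)-\int g\,dN(0,\sigma^2_{FMRD})\big|\to0$ in $P^x$-probability, where $g$ ranges over the functions $\mathbb R\to\mathbb R$ with Lipschitz constant and supremum norm at most $1$. Moreover, if $\int K=1$, then the kernel density estimator $\frac1{nb_n}\sum_{i=1}^nK(X_i/b_n)$ with $b_n>0$, $b_n\to0$, $nb_n\to\infty$ is such a consistent estimator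 of $f_X(0)$. -/

import Mathlib

open MeasureTheory ProbabilityTheory Filter Topology Set
open scoped NNReal ENNReal Matrix

noncomputable section

namespace FuzzyRDD

/-! ### One-sided limits, conditional means, convergence modes -/

/-- The right limit `f(0⁺)`. -/
def limR (f : ℝ → ℝ) : ℝ := limUnder (𝓝[>] (0 : ℝ)) f

/-- The left limit `f(0⁻)`. -/
def limL (f : ℝ → ℝ) : ℝ := limUnder (𝓝[<] (0 : ℝ)) f

/-- `m` is, on the Borel set `I`, a version of the regression function `x ↦ E[Z | X = x]`:
`Z` is integrable on `{X ∈ I}` and `m (X) = E[Z | X]` almost surely on `{X ∈ I}`.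
(On `{X ∈ I}` one has `E[Z | X] = E[Z 1{X ∈ I} | X]`, and the latter makes sense under
local integrability.) -/
def IsCondMeanOn {Ω : Type*} [MeasurableSpace Ω] (P : Measure Ω) (X Z : Ω → ℝ) (I : Set ℝ)
    (m : ℝ → ℝ) : Prop :=
  IntegrableOn Z (X ⁻¹' I) P ∧
    ∀ᵐ ω ∂P, X ω ∈ I →
      (P[(X ⁻¹' I).indicator Z | MeasurableSpace.comap X inferInstance]) ω = m (X ω)

/-- Functions with Lipschitz constant and supremum norm bounded by `1`. -/
def BL1 : Set (ℝ → ℝ) := {g | LipschitzWith 1 g ∧ ∀ x, |g x| ≤ 1}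

/-- Conditional weak convergence in probability of `T n`, defined on the product of the data space
`(Ω, P)` and the multiplier space `(Ω', P')`, to the law `ν`:
`sup_{g ∈ BL₁} |E_{ξ|x} g(T n) - ∫ g dν| → 0` in `P`-probability.  Under the product measure,
`E_{ξ|x}` is integration over `Ω'` with the data held fixed. -/
def CondWeakConvInProb {Ω Ω' : Type*} [MeasurableSpace Ω] [MeasurableSpace Ω']
    (P : Measure Ω) (P' : Measure Ω') (T : ℕ → Ω → Ω' → ℝ) (ν : Measure ℝ) : Prop :=
  TendstoInMeasure P
    (fun n ω => ⨆ g : BL1, |∫ ω', (g : ℝ → ℝ) (T n ω ω') ∂P' - ∫ x, (g : ℝ → ℝ) x ∂ν|)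
    atTop (fun _ => (0 : ℝ))

/-- A class `F` of functions on the line is of VC type: for some measurable envelope `Fe` and some
finite constants `A, V ≥ 1`, for every probability measure `Q` and every `0 < ε ≤ 1` it can be
covered by at most `(A / ε) ^ V` closed `L²(Q)`-balls of radius `ε ‖Fe‖_{Q,2}`. -/
def IsVCType (F : Set (ℝ → ℝ)) : Prop :=
  (∀ f ∈ F, Measurable f) ∧
  ∃ Fe : ℝ → ℝ, Measurable Fe ∧ (∀ f ∈ F, ∀ x, |f x| ≤ Fe x) ∧
    ∃ A V : ℝ, 1 ≤ A ∧ 1 ≤ V ∧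
      ∀ Q : Measure ℝ, IsProbabilityMeasure Q → ∀ ε : ℝ, 0 < ε → ε ≤ 1 →
        ∃ t : Finset (ℝ → ℝ), (t : Set (ℝ → ℝ)) ⊆ F ∧ (t.card : ℝ) ≤ (A / ε) ^ V ∧
          ∀ f ∈ F, ∃ g ∈ t, eLpNorm (f - g) 2 Q ≤ ENNReal.ofReal ε * eLpNorm Fe 2 Q

/-! ### Local polynomial estimation

A side of the cutoff is a set `S`, either `Ici 0` (the `+` side) or `Iic 0` (the `-` side), and
the indicators `δ⁺ᵢ = 1{Xᵢ ≥ 0}`, `δ⁻ᵢ = 1{Xᵢ ≤ 0}` are `S.indicator 1 (Xᵢ)`. -/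

/-- `r_p(x) = (1, x, …, x^p)'`. -/
def polyVec (p : ℕ) (x : ℝ) : Fin (p + 1) → ℝ := fun j => x ^ (j : ℕ)

/-- `Γ^±_p = ∫_{ℝ_±} K(u) r_p(u) r_p(u)' du`. -/
def gammaMat (p : ℕ) (K : ℝ → ℝ) (S : Set ℝ) : Matrix (Fin (p + 1)) (Fin (p + 1)) ℝ :=
  Matrix.of fun i j => ∫ u in S, K u * (polyVec p u i * polyVec p u j)

/-- The one-sided local weighted least squares criterion for the response `z` on `x`. -/
def localLoss (p : ℕ) (K : ℝ → ℝ) (S : Set ℝ) (n : ℕ) (h : ℝ) (z x : ℕ → ℝ)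
    (a : Fin (p + 1) → ℝ) : ℝ :=
  ∑ i ∈ Finset.range n,
    S.indicator 1 (x i) * (z i - polyVec p (x i / h) ⬝ᵥ a) ^ 2 * K (x i / h)

/-- `α n` is, for each sample size `n`, a (measurable) minimizer of the local criterion with
bandwidth `h n` computed from the first `n` observations. -/
def IsLocalPolyFit {Ω : Type*} [MeasurableSpace Ω] (p : ℕ) (K : ℝ → ℝ) (S : Set ℝ) (h : ℕ → ℝ)
    (Zs Xs : ℕ → Ω → ℝ) (α : ℕ → Ω → Fin (p + 1) → ℝ) : Prop :=
  ∀ n, Measurable (α n) ∧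
    ∀ ω, IsMinOn (localLoss p K S n (h n) (fun i => Zs i ω) (fun i => Xs i ω)) univ (α n ω)

/-- `μ̃_p(x) = r_p(x/h)' α̂₊ 1{x ≥ 0} + r_p(x/h)' α̂₋ 1{x ≤ 0}`. -/
def muTilde (p : ℕ) (h : ℝ) (αp αm : Fin (p + 1) → ℝ) (x : ℝ) : ℝ :=
  (polyVec p (x / h) ⬝ᵥ αp) * (Ici (0 : ℝ)).indicator 1 x
    + (polyVec p (x / h) ⬝ᵥ αm) * (Iic (0 : ℝ)).indicator 1 x

/-- The estimated multiplier process
`ν̂^±_{ξ,n} = ∑ᵢ ξᵢ e₀'(Γ^±_p)⁻¹ r_p(Xᵢ/h) [Zᵢ - μ̃_p(Xᵢ)] K(Xᵢ/h) δ^±ᵢ / (√(n h) f̂_X(0))`. -/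
def emp (p : ℕ) (K : ℝ → ℝ) (S : Set ℝ) (n : ℕ) (h fhat : ℝ) (αp αm : Fin (p + 1) → ℝ)
    (z x ξ : ℕ → ℝ) : ℝ :=
  ∑ i ∈ Finset.range n,
    ξ i * (((gammaMat p K S)⁻¹ *ᵥ polyVec p (x i / h)) 0 * (z i - muTilde p h αp αm (x i))
      * K (x i / h) * S.indicator 1 (x i)) / (Real.sqrt (n * h) * fhat)

/-- `X̂'_n(0,k) = (ν̂⁺_{ξ,n}(0,k) - ν̂⁻_{ξ,n}(0,k)) / √c_k`, with bandwidth `c_k h`. -/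
def empDiff (p : ℕ) (K : ℝ → ℝ) (n : ℕ) (c h fhat : ℝ) (αp αm : Fin (p + 1) → ℝ)
    (z x ξ : ℕ → ℝ) : ℝ :=
  (emp p K (Ici 0) n (c * h) fhat αp αm z x ξ - emp p K (Iic 0) n (c * h) fhat αp αm z x ξ)
    / Real.sqrt c

/-- The estimand
`τ_FMRD = (E[Y|X=0⁺] - E[Y|X=0⁻]) / (E[D|X=0⁺] - E[D|X=0⁻])`. -/
def tauFMRD (μ₁ μ₂ : ℝ → ℝ) : ℝ := (limR μ₁ - limL μ₁) / (limR μ₂ - limL μ₂)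

/-- The estimator `τ̂_FMRD` formed from the four fits; coordinate `0` of a fit is the estimate of
`μ_k(0^±)`. -/
def tauHat (p : ℕ) (α₁p α₁m α₂p α₂m : Fin (p + 1) → ℝ) : ℝ :=
  (α₁p 0 - α₁m 0) / (α₂p 0 - α₂m 0)

/-- The plug-in bootstrap ratio
`([μ̂₂⁺ - μ̂₂⁻] X̂'(0,1) - [μ̂₁⁺ - μ̂₁⁻] X̂'(0,2)) / [μ̂₂⁺ - μ̂₂⁻]²`. -/
def bootRatio (p : ℕ) (α₁p α₁m α₂p α₂m : Fin (p + 1) → ℝ) (X₁ X₂ : ℝ) : ℝ :=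
  ((α₂p 0 - α₂m 0) * X₁ - (α₁p 0 - α₁m 0) * X₂) / (α₂p 0 - α₂m 0) ^ 2

/-- The kernel density estimator of `f_X(0)` with bandwidth `b`. -/
def kde (K : ℝ → ℝ) (n : ℕ) (b : ℝ) (x : ℕ → ℝ) : ℝ :=
  (∑ i ∈ Finset.range n, K (x i / b)) / (n * b)

/-! ### Assumptions -/

/-- Random sampling of `(Y, D, X)`, and regularity of the density `f` of `X` on
`[xl, xu] ∋ 0`. -/
structure AssumptionS {Ω : Type*} [MeasurableSpace Ω] (P : Measure Ω) (Y D X : Ω → ℝ)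
    (Ys Ds Xs : ℕ → Ω → ℝ) (f : ℝ → ℝ) (xl xu : ℝ) : Prop where
  measurable_Y : Measurable Y
  measurable_D : Measurable D
  measurable_X : Measurable X
  measurable_Ys : ∀ i, Measurable (Ys i)
  measurable_Ds : ∀ i, Measurable (Ds i)
  measurable_Xs : ∀ i, Measurable (Xs i)
  indep : iIndepFun (fun i ω => (Ys i ω, Ds i ω, Xs i ω)) P
  copies : ∀ i, IdentDistrib (fun ω => (Ys i ω, Ds i ω, Xs i ω)) (fun ω => (Y ω, D ω, X ω)) P P
  xl_neg : xl < 0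
  xu_pos : 0 < xu
  measurable_f : Measurable f
  f_nonneg : ∀ x, 0 ≤ f x
  density : P.map X = volume.withDensity (fun x => ENNReal.ofReal (f x))
  f_contDiff : ContDiffOn ℝ 1 f (Icc xl xu)
  f_zero_pos : 0 < f 0

/-- The kernel, extended by zero outside `[-1, 1]`. -/
structure AssumptionK (p : ℕ) (K : ℝ → ℝ) : Prop where
  nonneg : ∀ u, 0 ≤ K u
  support : ∀ u, u ∉ Icc (-1 : ℝ) 1 → K u = 0
  bounded : ∃ M, ∀ u, K u ≤ M
  cont : ContinuousOn K (Icc (-1) 1)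
  vcType : IsVCType {g | ∃ h : ℝ, 0 < h ∧ g = fun x => K (x / h)}
  posDef_right : (gammaMat p K (Ici 0)).PosDef
  posDef_left : (gammaMat p K (Iic 0)).PosDef

/-- The multipliers are independent standard normal variables on their own probability space. -/
structure AssumptionM {Ω' : Type*} [MeasurableSpace Ω'] (P' : Measure Ω') (ξ : ℕ → Ω' → ℝ) :
    Prop where
  indep : iIndepFun ξ P'
  gaussian : ∀ i, HasLaw (ξ i) (gaussianReal 0 1) P'

/-- `μ` has Lipschitz derivatives of orders `0, 1, 2, 3` on `S`. -/
def LipschitzDerivs (μ : ℝ → ℝ) (S : Set ℝ) : Prop :=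
  ContDiffOn ℝ 3 μ S ∧
    ∀ j : ℕ, j ≤ 3 → ∃ L : ℝ≥0, LipschitzOnWith L (iteratedDerivWithin j μ S) S

/-- `v` is continuously differentiable on `S` with bounded derivative. -/
def C1BddDeriv (v : ℝ → ℝ) (S : Set ℝ) : Prop :=
  ContDiffOn ℝ 1 v S ∧ ∃ B : ℝ, ∀ x ∈ S, |derivWithin v S x| ≤ B

/-- The fuzzy mean design.  `μ₁, μ₂` are the regression functions of `Y, D` on `X` and `σ₁₁, σ₂₂`
their conditional variances, over `[xl, xu]`; `h` is the baseline bandwidth and `c₁ h, c₂ h` are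
the bandwidths of the numerator and the denominator. -/
structure AssumptionFMRD {Ω : Type*} [MeasurableSpace Ω] (P : Measure Ω) (Y D X : Ω → ℝ)
    (xl xu : ℝ) (μ₁ μ₂ σ₁₁ σ₂₂ : ℝ → ℝ) (h : ℕ → ℝ) (c₁ c₂ : ℝ) : Prop where
  condMean_Y : IsCondMeanOn P X Y (Icc xl xu) μ₁
  condMean_D : IsCondMeanOn P X D (Icc xl xu) μ₂
  condVar_Y : IsCondMeanOn P X (fun ω => (Y ω - μ₁ (X ω)) ^ 2) (Icc xl xu) σ₁₁
  condVar_D : IsCondMeanOn P X (fun ω => (D ω - μ₂ (X ω)) ^ 2) (Icc xl xu) σ₂₂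
  moments : ∃ ε : ℝ, 0 < ε ∧ ∃ qY qD : ℝ → ℝ,
    IsCondMeanOn P X (fun ω => |Y ω| ^ (2 + ε)) (Icc xl xu) qY ∧
    IsCondMeanOn P X (fun ω => |D ω| ^ (2 + ε)) (Icc xl xu) qD ∧
    ∃ M : ℝ, ∀ x ∈ Icc xl xu \ {0}, qY x ≤ M ∧ qD x ≤ M
  smooth_μ₁_left : LipschitzDerivs μ₁ (Ico xl 0)
  smooth_μ₁_right : LipschitzDerivs μ₁ (Ioc 0 xu)
  smooth_μ₂_left : LipschitzDerivs μ₂ (Ico xl 0)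
  smooth_μ₂_right : LipschitzDerivs μ₂ (Ioc 0 xu)
  firstStage : limR μ₂ ≠ limL μ₂
  h_pos : ∀ n, 0 < h n
  h_tendsto : Tendsto h atTop (𝓝 0)
  nh2_tendsto : Tendsto (fun n : ℕ => (n : ℝ) * h n ^ 2) atTop atTop
  nh7_tendsto : Tendsto (fun n : ℕ => (n : ℝ) * h n ^ 7) atTop (𝓝 0)
  c₁_pos : 0 < c₁
  c₂_pos : 0 < c₂
  smooth_σ₁₁ : C1BddDeriv σ₁₁ (Icc xl xu \ {0})
  smooth_σ₂₂ : C1BddDeriv σ₂₂ (Icc xl xu \ {0})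
  σ₁₁_right_pos : 0 < limR σ₁₁
  σ₁₁_left_pos : 0 < limL σ₁₁

/-- The conditional covariance `σ₁₂` of `Y` and `D` given `X` over `[xl, xu]` has finite one-sided
limits at the cutoff. -/
structure CondCovLimits {Ω : Type*} [MeasurableSpace Ω] (P : Measure Ω) (Y D X : Ω → ℝ)
    (xl xu : ℝ) (μ₁ μ₂ σ₁₂ : ℝ → ℝ) : Prop where
  condCov : IsCondMeanOn P X (fun ω => (Y ω - μ₁ (X ω)) * (D ω - μ₂ (X ω))) (Icc xl xu) σ₁₂
  right : ∃ l : ℝ, Tendsto σ₁₂ (𝓝[>] 0) (𝓝 l)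
  left : ∃ l : ℝ, Tendsto σ₁₂ (𝓝[<] 0) (𝓝 l)

/-- `V(Y - τ D | X = x) = σ₁₁(x) - 2 τ σ₁₂(x) + τ² σ₂₂(x)`. -/
def resVar (τ : ℝ) (σ₁₁ σ₁₂ σ₂₂ : ℝ → ℝ) (x : ℝ) : ℝ :=
  σ₁₁ x - 2 * τ * σ₁₂ x + τ ^ 2 * σ₂₂ x

end FuzzyRDD

end

open MeasureTheory ProbabilityTheory Filter Topology Set
open scoped NNReal ENNReal Matrix

noncomputable section

namespace FuzzyRDD

/-! Let `Ĵ₁, Ĵ₂` be the estimated jumps and `J₁ = τ J₂` the true ones. Then `τ̂ - τ = (Ĵ₁ - τ Ĵ₂) /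
Ĵ₂`, so to first order the error is that of a jump estimate for `Y - τ D`, divided by `J₂ ≠ 0`.

Linearisation. With bandwidth `b`, the normal equations of a one-sided fit read `M Δ = T + r`, where
`Δ` is the coefficient error times `√(nb)`, `T` a kernel sum of regression residuals and `r` a
kernel sum of Taylor remainders. A law of large numbers gives `M → f(0) Γ`; `T` is bounded in
probability by a second moment; the quadratic fit leaves a cubic remainder, so `r` has order `√(nb)
b³ → 0`. Hence `Δ` is asymptotically `f(0)⁻¹ Γ⁻¹ T` (`solve_inProb`,
`FitDesign.asymptotically_linear`). The bandwidths `c₁ h` and `c₂ h` are brought to the common scale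
`h` by dilating the equivalent kernel (`FitDesign.jump_linear`). The ratio then becomes a sum of
independent centred scores with weights `κ = 1 / (f(0) J₂)` and `-τ κ`, and a Lindeberg theorem,
checked through moments of order `2 + ε`, gives (i).

Bootstrap. With the data fixed, the ratio `T_n` is a linear combination `∑ Aᵢ ξᵢ` of independent
standard normals, so its conditional law is exactly `N(0, ∑ Aᵢ²)`. Its bounded Lipschitz distance to
`N(0, σ²)` is at most a constant times `|√(∑ Aᵢ²) - σ|` (`condWeakConvInProb_gaussian`), so (ii)
only needs `∑ Aᵢ² → σ²` in probability. Up to errors negligible in `ℓ²`, which come from estimated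
coefficients and fitted residuals, `∑ Aᵢ²` is the sum of squared scores, and this obeys a law of
large numbers with the variance of (i) as limit.

Positivity. The variance is a positive multiple of the sum over the two sides of the traces of the
limiting residual covariance, transformed by `τ`, against the Gram matrix of the two dilated
kernels. If `c₁ = c₂` each trace factors through `s(0⁺)` or `s(0⁻)`. If `c₁ ≠ c₂` the dilates are
not proportional, the Gram matrix is positive definite, and `σ₁₁(0⁺) > 0` suffices
(`sq_integral_dilation_lt`, `quad_form_pos`). -/

/-! ### Convergence in probability as a filter -/

/-- The filter on `ℕ × Ω` along which convergence is convergence in probability: a set is large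
if its sections have probability tending to one. -/
def inProb {Ω : Type*} [MeasurableSpace Ω] (P : Measure Ω) : Filter (ℕ × Ω) where
  sets := {S | Tendsto (fun n => P {ω | (n, ω) ∉ S}) atTop (𝓝 0)}
  univ_sets := by simp
  sets_of_superset {S T} hS hST :=
    tendsto_of_tendsto_of_tendsto_of_le_of_le tendsto_const_nhds hS (fun _ => zero_le)
      fun n => measure_mono fun ω hω h => hω (hST h)
  inter_sets {S T} hS hT := by
    have hadd := Tendsto.add hS hT
    rw [add_zero] at hadd
    refine tendsto_of_tendsto_of_tendsto_of_le_of_le tendsto_const_nhds hadd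
      (fun _ => zero_le) fun n => ?_
    refine le_trans (measure_mono fun ω hω => ?_) (measure_union_le _ _)
    simp only [mem_ofPred_eq, mem_inter_iff, not_and_or] at hω
    exact hω

variable {Ω : Type*} [MeasurableSpace Ω] {P : Measure Ω}

lemma eventually_inProb {p : ℕ × Ω → Prop} :
    (∀ᶠ x in inProb P, p x) ↔ Tendsto (fun n => P {ω | ¬ p (n, ω)}) atTop (𝓝 0) := Iff.rfl

/-- With this bridge, Slutsky and continuous mapping arguments become ordinary `Tendsto` calculus
along `inProb P`. -/
lemma tendstoInMeasure_iff_inProb {Z : ℕ → Ω → ℝ} {c : ℝ} :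
    TendstoInMeasure P Z atTop (fun _ => c) ↔
      Tendsto (fun x : ℕ × Ω => Z x.1 x.2) (inProb P) (𝓝 c) := by
  rw [tendstoInMeasure_iff_dist, Metric.tendsto_nhds]
  simp only [eventually_inProb, not_lt]

lemma eventually_inProb_of_ae {p : ℕ × Ω → Prop}
    (h : ∀ᶠ n in atTop, ∀ᵐ ω ∂P, p (n, ω)) : ∀ᶠ x in inProb P, p x := by
  rw [eventually_inProb]
  refine tendsto_const_nhds.congr' ?_
  filter_upwards [h] with n hn
  exact (ae_iff.1 hn).symm

lemma tendsto_fst_inProb : Tendsto Prod.fst (inProb P) atTop := by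
  rw [tendsto_atTop]
  intro b
  refine eventually_inProb_of_ae ?_
  filter_upwards [eventually_ge_atTop b] with n hn
  exact ae_of_all _ fun _ => hn

/-- Boundedness in probability. -/
def BddInProb (P : Measure Ω) (Z : ℕ × Ω → ℝ) : Prop :=
  ∀ ε : ℝ, 0 < ε → ∃ M : ℝ, ∀ᶠ n in atTop, P {ω | M < |Z (n, ω)|} ≤ ENNReal.ofReal ε

lemma BddInProb.mono {Z W : ℕ × Ω → ℝ} (hW : BddInProb P W) (C : ℝ)
    (h : ∀ᶠ x in inProb P, |Z x| ≤ C * |W x|) : BddInProb P Z := by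
  intro ε hε
  obtain ⟨M, hM⟩ := hW (ε / 2) (by positivity)
  refine ⟨|C| * |M|, ?_⟩
  have h0 := (ENNReal.tendsto_nhds_zero.1 (eventually_inProb.1 h)) (ENNReal.ofReal (ε / 2))
    (by positivity)
  filter_upwards [hM, h0] with n hn h0n
  calc P {ω | |C| * |M| < |Z (n, ω)|}
      ≤ P ({ω | M < |W (n, ω)|} ∪ {ω | ¬ |Z (n, ω)| ≤ C * |W (n, ω)|}) := by
        refine measure_mono fun ω hω => ?_
        by_contra hcon
        simp only [mem_union, mem_ofPred_eq, not_or, not_lt, not_not] at hcon hω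
        have h1 : C * |W (n, ω)| ≤ |C| * |M| :=
          mul_le_mul (le_abs_self C) (hcon.1.trans (le_abs_self M)) (abs_nonneg _) (abs_nonneg _)
        linarith [hcon.2]
    _ ≤ _ := measure_union_le _ _
    _ ≤ ENNReal.ofReal (ε / 2) + ENNReal.ofReal (ε / 2) := add_le_add hn h0n
    _ = ENNReal.ofReal ε := by
        rw [← ENNReal.ofReal_add (by positivity) (by positivity)]; congr 1; ring

lemma BddInProb.add {Z W : ℕ × Ω → ℝ} (hZ : BddInProb P Z) (hW : BddInProb P W) :
    BddInProb P (fun x => |Z x| + |W x|) := by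
  intro ε hε
  obtain ⟨M, hM⟩ := hZ (ε / 2) (by positivity)
  obtain ⟨N, hN⟩ := hW (ε / 2) (by positivity)
  refine ⟨M + N, ?_⟩
  filter_upwards [hM, hN] with n hn h0n
  calc P {ω | M + N < |(|Z (n, ω)| + |W (n, ω)|)|}
      ≤ P ({ω | M < |Z (n, ω)|} ∪ {ω | N < |W (n, ω)|}) := by
        refine measure_mono fun ω hω => ?_
        by_contra hcon
        simp only [mem_union, mem_ofPred_eq, not_or, not_lt] at hcon hω
        rw [abs_of_nonneg (by positivity)] at hω
        linarith [hcon.2, hcon.1]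
    _ ≤ _ := measure_union_le _ _
    _ ≤ ENNReal.ofReal (ε / 2) + ENNReal.ofReal (ε / 2) := add_le_add hn h0n
    _ = ENNReal.ofReal ε := by
        rw [← ENNReal.ofReal_add (by positivity) (by positivity)]; congr 1; ring

lemma BddInProb.sum {ι : Type*} (s : Finset ι) {Z : ι → ℕ × Ω → ℝ}
    (h : ∀ i ∈ s, BddInProb P (Z i)) : BddInProb P (fun x => ∑ i ∈ s, |Z i x|) := by
  classical
  induction s using Finset.induction_on with
  | empty => exact fun ε _ => ⟨0, by simp⟩
  | insert i s hi ih =>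
    refine ((h i (by simp)).add (ih fun j hj => h j (by simp [hj]))).mono 1
      (Eventually.of_forall fun x => ?_)
    rw [Finset.sum_insert hi, one_mul]
    refine le_of_eq ?_
    have : 0 ≤ ∑ j ∈ s, |Z j x| := Finset.sum_nonneg fun _ _ => abs_nonneg _
    rw [abs_of_nonneg this]

/-- The rule `o_P(1) · O_P(1) = o_P(1)`: outside two events of small probability `|Z| ≤ M` and `|E|
< η / (|M| + 1)`, which keeps the product below `η`. -/
lemma BddInProb.mul_tendsto_zero {Z E : ℕ × Ω → ℝ} (hZ : BddInProb P Z)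
    (hE : Tendsto E (inProb P) (𝓝 0)) : Tendsto (fun x => E x * Z x) (inProb P) (𝓝 0) := by
  rw [Metric.tendsto_nhds]
  intro η hη
  rw [eventually_inProb, ENNReal.tendsto_nhds_zero]
  intro ε hε
  obtain ⟨ε', hε', hle⟩ : ∃ ε' : ℝ, 0 < ε' ∧ ENNReal.ofReal (ε' + ε') ≤ ε := by
    rcases eq_or_ne ε ⊤ with rfl | hne
    · exact ⟨1, one_pos, le_top⟩
    · refine ⟨ε.toReal / 2, by have := ENNReal.toReal_pos hε.ne' hne; positivity, ?_⟩
      rw [add_halves, ENNReal.ofReal_toReal hne]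
  obtain ⟨M, hM⟩ := hZ ε' hε'
  have h0 := (ENNReal.tendsto_nhds_zero.1 (eventually_inProb.1
    ((Metric.tendsto_nhds.1 hE) (η / (|M| + 1)) (by positivity)))) (ENNReal.ofReal ε')
    (by positivity)
  filter_upwards [hM, h0] with n hn h0n
  refine le_trans ?_ hle
  rw [ENNReal.ofReal_add hε'.le hε'.le]
  refine le_trans (measure_mono (t := {ω | M < |Z (n, ω)|} ∪
    {ω | ¬ dist (E (n, ω)) 0 < η / (|M| + 1)}) fun ω hω => ?_)
    ((measure_union_le _ _).trans (add_le_add hn h0n))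
  by_contra hcon
  simp only [mem_union, mem_ofPred_eq, not_or, not_lt, dist_zero_right, Real.norm_eq_abs,
    abs_mul] at hcon hω
  have h2 : |E (n, ω)| * |Z (n, ω)| ≤ |E (n, ω)| * |M| :=
    mul_le_mul_of_nonneg_left (hcon.1.trans (le_abs_self M)) (abs_nonneg _)
  have h3 : |E (n, ω)| * (|M| + 1) < η := (lt_div_iff₀ (by positivity)).1 (not_le.1 hcon.2)
  nlinarith [abs_nonneg (E (n, ω)), abs_nonneg M]

lemma BddInProb.of_tendsto {Z : ℕ × Ω → ℝ} {c : ℝ} (h : Tendsto Z (inProb P) (𝓝 c)) :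
    BddInProb P Z := by
  intro ε hε
  refine ⟨|c| + 1, ?_⟩
  have h0 := (ENNReal.tendsto_nhds_zero.1 (eventually_inProb.1
    ((Metric.tendsto_nhds.1 h) 1 one_pos))) (ENNReal.ofReal ε) (by positivity)
  filter_upwards [h0] with n hn
  refine (measure_mono fun ω hω => ?_).trans hn
  simp only [mem_ofPred_eq, not_lt, Real.dist_eq] at hω ⊢
  linarith [abs_sub_abs_le_abs_sub (Z (n, ω)) c]

/-- Markov's inequality; the bound `η * ε'` on the first moment leaves probability `ε'` for a
deviation of size `η`. -/
lemma tendsto_inProb_of_integral_abs [IsFiniteMeasure P] {Z : ℕ × Ω → ℝ} {L : ℝ}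
    (hint : ∀ᶠ n in atTop, Integrable (fun ω => Z (n, ω) - L) P)
    (hb : ∀ δ : ℝ, 0 < δ → ∀ᶠ n in atTop, ∫ ω, |Z (n, ω) - L| ∂P ≤ δ) :
    Tendsto Z (inProb P) (𝓝 L) := by
  rw [Metric.tendsto_nhds]
  intro η hη
  rw [eventually_inProb, ENNReal.tendsto_nhds_zero]
  intro ε hε
  obtain ⟨ε', hε', hle⟩ : ∃ ε' : ℝ, 0 < ε' ∧ ENNReal.ofReal ε' ≤ ε := by
    rcases eq_or_ne ε ⊤ with rfl | hne
    · exact ⟨1, one_pos, le_top⟩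
    · exact ⟨ε.toReal, ENNReal.toReal_pos hε.ne' hne, by rw [ENNReal.ofReal_toReal hne]⟩
  filter_upwards [hint, hb (η * ε') (by positivity)] with n hn h1
  refine le_trans ?_ hle
  have h2 := mul_meas_ge_le_integral_of_nonneg (ae_of_all P fun ω => abs_nonneg (Z (n, ω) - L))
    hn.abs η
  have h3 : P.real {ω | η ≤ |Z (n, ω) - L|} ≤ ε' :=
    le_of_mul_le_mul_left (h2.trans h1) hη
  simp only [not_lt, Real.dist_eq]
  rw [← ENNReal.ofReal_toReal (measure_ne_top P {ω | η ≤ |Z (n, ω) - L|})]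
  exact ENNReal.ofReal_le_ofReal h3

lemma BddInProb.of_integral_sq [IsFiniteMeasure P] {Z : ℕ × Ω → ℝ} {C : ℝ}
    (hint : ∀ᶠ n in atTop, MemLp (fun ω => Z (n, ω)) 2 P)
    (hb : ∀ᶠ n in atTop, ∫ ω, Z (n, ω) ^ 2 ∂P ≤ C) : BddInProb P Z := by
  intro ε hε
  -- Chebyshev threshold: a second moment at most `C` exceeds level `(|C| + 1) / ε` with probability
  -- at most `ε`; the `+ 1` keeps the level positive.
  refine ⟨Real.sqrt ((|C| + 1) / ε), ?_⟩
  filter_upwards [hint, hb] with n hn h1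
  have hM : 0 < (|C| + 1) / ε := by positivity
  have h2 := mul_meas_ge_le_integral_of_nonneg (ae_of_all P fun ω => sq_nonneg (Z (n, ω)))
    hn.integrable_sq ((|C| + 1) / ε)
  have h3 : P.real {ω | (|C| + 1) / ε ≤ Z (n, ω) ^ 2} ≤ ε := by
    have : (|C| + 1) / ε * P.real {ω | (|C| + 1) / ε ≤ Z (n, ω) ^ 2} ≤ (|C| + 1) / ε * ε := by
      rw [div_mul_cancel₀ _ hε.ne']
      linarith [le_abs_self C]
    exact le_of_mul_le_mul_left this hM
  calc P {ω | √((|C| + 1) / ε) < |Z (n, ω)|} ≤ P {ω | (|C| + 1) / ε ≤ Z (n, ω) ^ 2} := by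
        refine measure_mono fun ω hω => ?_
        simp only [mem_ofPred_eq] at hω ⊢
        rw [← sq_abs (Z (n, ω))]
        exact ((Real.sqrt_lt' ((Real.sqrt_nonneg _).trans_lt hω)).1 hω).le
    _ = ENNReal.ofReal (P.real {ω | (|C| + 1) / ε ≤ Z (n, ω) ^ 2}) :=
        (ENNReal.ofReal_toReal (measure_ne_top P _)).symm
    _ ≤ ENNReal.ofReal ε := ENNReal.ofReal_le_ofReal h3

/-! ### Triangular arrays with i.i.d. rows -/

/-- `V 0, V 1, …` are independent with common law `Q`. -/
structure IsIIDSample {α : Type*} [MeasurableSpace α] (P : Measure Ω) (V : ℕ → Ω → α)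
    (Q : Measure α) : Prop where
  measurable : ∀ i, Measurable (V i)
  indep : iIndepFun V P
  law : ∀ i, P.map (V i) = Q

namespace IsIIDSample

variable {α : Type*} [MeasurableSpace α] {V : ℕ → Ω → α} {Q : Measure α}

lemma map {β : Type*} [MeasurableSpace β] (hV : IsIIDSample P V Q) {g : α → β}
    (hg : Measurable g) : IsIIDSample P (fun i ω => g (V i ω)) (Q.map g) where
  measurable i := hg.comp (hV.measurable i)
  indep := hV.indep.comp (fun _ => g) fun _ => hg
  law i := by rw [← hV.law i, Measure.map_map hg (hV.measurable i)]; rfl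

lemma isProbabilityMeasure [IsProbabilityMeasure P] (hV : IsIIDSample P V Q) :
    IsProbabilityMeasure Q := by
  rw [← hV.law 0]
  exact Measure.isProbabilityMeasure_map (hV.measurable 0).aemeasurable

lemma integral_comp (hV : IsIIDSample P V Q) (i : ℕ) {ψ : α → ℝ} (hψ : Measurable ψ) :
    ∫ ω, ψ (V i ω) ∂P = ∫ v, ψ v ∂Q := by
  rw [← hV.law i, integral_map (hV.measurable i).aemeasurable hψ.aestronglyMeasurable]

lemma integrable_comp (hV : IsIIDSample P V Q) (i : ℕ) {ψ : α → ℝ} (hψ : Integrable ψ Q) :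
    Integrable (fun ω => ψ (V i ω)) P := by
  rw [← hV.law i] at hψ
  exact hψ.comp_measurable (hV.measurable i)

lemma memLp_comp (hV : IsIIDSample P V Q) (i : ℕ) {ψ : α → ℝ} {q : ℝ≥0∞} (hψ : MemLp ψ q Q) :
    MemLp (fun ω => ψ (V i ω)) q P := by
  rw [← hV.law i] at hψ
  exact hψ.comp_of_map (hV.measurable i).aemeasurable

lemma ae_comp (hV : IsIIDSample P V Q) {p : α → Prop} (hp : ∀ᵐ v ∂Q, p v) :
    ∀ᵐ ω ∂P, ∀ i, p (V i ω) := by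
  rw [ae_all_iff]
  intro i
  rw [← hV.law i] at hp
  exact ae_of_ae_map (hV.measurable i).aemeasurable hp

lemma integral_sum_comp (hV : IsIIDSample P V Q) {ψ : α → ℝ} (hψ : Measurable ψ)
    (hint : Integrable ψ Q) (n : ℕ) :
    ∫ ω, ∑ i ∈ Finset.range n, ψ (V i ω) ∂P = n * ∫ v, ψ v ∂Q := by
  rw [integral_finsetSum _ fun i _ => hV.integrable_comp i hint]
  simp [hV.integral_comp _ hψ]

lemma integral_sq_sum_sub_le [IsProbabilityMeasure P] (hV : IsIIDSample P V Q) {ψ : α → ℝ}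
    (hψ : Measurable ψ) (hL : MemLp ψ 2 Q) (n : ℕ) :
    ∫ ω, (∑ i ∈ Finset.range n, ψ (V i ω) - n * ∫ v, ψ v ∂Q) ^ 2 ∂P ≤ n * ∫ v, ψ v ^ 2 ∂Q := by
  have := hV.isProbabilityMeasure
  have hmem : ∀ i, MemLp (fun ω => ψ (V i ω)) 2 P := fun i => hV.memLp_comp i hL
  have h1 : Var[fun ω => ∑ i ∈ Finset.range n, ψ (V i ω); P]
      = ∑ i ∈ Finset.range n, Var[fun ω => ψ (V i ω); P] := by
    have := IndepFun.variance_sum (μ := P) (X := fun i ω => ψ (V i ω)) (s := Finset.range n)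
      (fun i _ => hmem i) (fun i _ j _ hij =>
        (hV.indep.indepFun hij).comp hψ hψ)
    rw [← this]
    congr 1
    ext ω
    simp
  have h2 := variance_eq_integral (μ := P) (X := fun ω => ∑ i ∈ Finset.range n, ψ (V i ω))
    (Finset.aemeasurable_fun_sum _ fun i _ => (hψ.comp (hV.measurable i)).aemeasurable)
  rw [hV.integral_sum_comp hψ (hL.integrable one_le_two)] at h2
  rw [← h2, h1]
  calc ∑ i ∈ Finset.range n, Var[fun ω => ψ (V i ω); P]
      ≤ ∑ i ∈ Finset.range n, ∫ v, ψ v ^ 2 ∂Q := by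
        refine Finset.sum_le_sum fun i _ => ?_
        refine (variance_le_expectation_sq (hmem i).aestronglyMeasurable).trans_eq ?_
        exact hV.integral_comp i (ψ := fun v => ψ v ^ 2) (hψ.pow_const 2)
    _ = _ := by simp

lemma bddInProb_sum [IsProbabilityMeasure P] (hV : IsIIDSample P V Q) {ψ : ℕ → α → ℝ}
    (hψ : ∀ n, Measurable (ψ n)) (hL : ∀ᶠ n in atTop, MemLp (ψ n) 2 Q)
    (h0 : ∀ᶠ n in atTop, ∫ v, ψ n v ∂Q = 0) {C : ℝ}
    (hC : ∀ᶠ n : ℕ in atTop, n * ∫ v, ψ n v ^ 2 ∂Q ≤ C) :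
    BddInProb P (fun x => ∑ i ∈ Finset.range x.1, ψ x.1 (V i x.2)) := by
  refine BddInProb.of_integral_sq (C := C) ?_ ?_
  · filter_upwards [hL] with n hn
    exact memLp_finsetSum _ fun i _ => hV.memLp_comp i hn
  · filter_upwards [hL, h0, hC] with n hn h0n hCn
    have := hV.integral_sq_sum_sub_le (hψ n) hn n
    simp only [h0n, mul_zero, sub_zero] at this
    exact this.trans hCn

/-- Weak law of large numbers for triangular arrays with i.i.d. rows. -/
lemma tendsto_sum [IsProbabilityMeasure P] (hV : IsIIDSample P V Q) {ψ : ℕ → α → ℝ}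
    (hψ : ∀ n, Measurable (ψ n)) (hint : ∀ᶠ n in atTop, Integrable (ψ n) Q) {L C : ℝ}
    (hL : Tendsto (fun n : ℕ => n * ∫ v, ψ n v ∂Q) atTop (𝓝 L))
    (hC : ∀ᶠ n : ℕ in atTop, n * ∫ v, |ψ n v| ∂Q ≤ C)
    (hlind : ∀ η : ℝ, 0 < η →
      Tendsto (fun n : ℕ => n * ∫ v in {v | η < |ψ n v|}, |ψ n v| ∂Q) atTop (𝓝 0)) :
    Tendsto (fun x : ℕ × Ω => ∑ i ∈ Finset.range x.1, ψ x.1 (V i x.2)) (inProb P) (𝓝 L) := by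
  have := hV.isProbabilityMeasure
  refine tendsto_inProb_of_integral_abs ?_ ?_
  · filter_upwards [hint] with n hn
    exact (integrable_finsetSum _ fun i _ => hV.integrable_comp i hn).sub (integrable_const _)
  intro δ hδ
  -- The truncated sum will have variance at most `η * C`, so this choice makes its `L¹` deviation
  -- at most `δ / 4`.
  obtain ⟨η, hη, hηC⟩ : ∃ η : ℝ, 0 < η ∧ Real.sqrt (η * C) ≤ δ / 4 := by
    refine ⟨(δ / 4) ^ 2 / (|C| + 1), by positivity, ?_⟩
    rw [Real.sqrt_le_left (by positivity)]
    rw [div_mul_eq_mul_div, div_le_iff₀ (by positivity)]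
    nlinarith [le_abs_self C, sq_nonneg (δ / 4)]
  have hmL := Metric.tendsto_nhds.1 hL (δ / 4) (by positivity)
  have hml := Metric.tendsto_nhds.1 (hlind η hη) (δ / 4) (by positivity)
  filter_upwards [hint, hC, hmL, hml] with n hn hCn hLn hln
  rw [Real.dist_eq] at hLn hln
  rw [sub_zero] at hln
  have hS : MeasurableSet {v | η < |ψ n v|} := measurableSet_lt measurable_const (hψ n).abs
  -- Truncation at `η`: the large part is controlled in `L¹` by the Lindeberg hypothesis, the small
  -- part in `L²` through `small² ≤ η |ψ|`, so that no second moment of `ψ` is required.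
  set big : α → ℝ := {v | η < |ψ n v|}.indicator (ψ n) with hbig
  set small : α → ℝ := fun v => ψ n v - big v with hsmall
  have hbm : Measurable big := (hψ n).indicator hS
  have hsm : Measurable small := (hψ n).sub hbm
  have hbi : Integrable big Q := hn.indicator hS
  have hsmall_le : ∀ v, |small v| ≤ min η |ψ n v| := by
    intro v
    simp only [hsmall, hbig, indicator, mem_ofPred_eq]
    split_ifs with h
    · simp [hη.le]
    · simpa using h
  have hsL : MemLp small 2 Q :=
    MemLp.of_bound hsm.aestronglyMeasurable η (ae_of_all _ fun v => (hsmall_le v).trans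
      (min_le_left _ _))
  have hsi : Integrable small Q := hsL.integrable one_le_two
  have hbabs : ∫ v, |big v| ∂Q = ∫ v in {v | η < |ψ n v|}, |ψ n v| ∂Q := by
    rw [← integral_indicator hS]
    congr 1
    ext v
    simp only [hbig, indicator]
    split_ifs <;> simp
  have hsq : ∫ v, small v ^ 2 ∂Q ≤ η * ∫ v, |ψ n v| ∂Q := by
    rw [← integral_const_mul]
    refine integral_mono hsL.integrable_sq (hn.abs.const_mul η) fun v => ?_
    have h1 := hsmall_le v
    rw [le_min_iff] at h1
    simp only
    rw [← sq_abs, sq]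
    exact mul_le_mul h1.1 h1.2 (abs_nonneg _) hη.le
  have hpt : ∀ ω, |∑ i ∈ Finset.range n, ψ n (V i ω) - L| ≤
      ∑ i ∈ Finset.range n, |big (V i ω)| +
        |∑ i ∈ Finset.range n, small (V i ω) - n * ∫ v, small v ∂Q| +
        |n * ∫ v, small v ∂Q - L| := by
    intro ω
    have h1 : ∑ i ∈ Finset.range n, ψ n (V i ω) - L =
        ∑ i ∈ Finset.range n, big (V i ω) +
        (∑ i ∈ Finset.range n, small (V i ω) - n * ∫ v, small v ∂Q) +
        (n * ∫ v, small v ∂Q - L) := by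
      simp only [hsmall, Finset.sum_sub_distrib]
      ring
    rw [h1]
    refine (abs_add_le _ _).trans (add_le_add_left ((abs_add_le _ _).trans
      (add_le_add_left (Finset.abs_sum_le_sum_abs _ _) _)) _)
  have hi1 : Integrable (fun ω => ∑ i ∈ Finset.range n, |big (V i ω)|) P :=
    integrable_finsetSum _ fun i _ => (hV.integrable_comp i hbi).abs
  have hm2 : MemLp (fun ω => ∑ i ∈ Finset.range n, small (V i ω) - n * ∫ v, small v ∂Q) 2 P :=
    (memLp_finsetSum _ fun i _ => hV.memLp_comp i hsL).sub (memLp_const _)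
  have hi2 := (hm2.integrable one_le_two).abs
  have hb1 : ∫ ω, ∑ i ∈ Finset.range n, |big (V i ω)| ∂P ≤ δ / 4 := by
    rw [hV.integral_sum_comp hbm.abs hbi.abs, hbabs]
    exact (le_abs_self _).trans hln.le
  have hb2 : ∫ ω, |∑ i ∈ Finset.range n, small (V i ω) - n * ∫ v, small v ∂Q| ∂P ≤ δ / 4 := by
    refine le_trans (Real.le_sqrt_of_sq_le ?_) hηC
    -- Nonnegativity of the variance of the absolute value is the inequality `(E|W|)² ≤ E W²`.
    have h1 := variance_nonneg
      (fun ω => |∑ i ∈ Finset.range n, small (V i ω) - n * ∫ v, small v ∂Q|) P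
    have hm2' : MemLp
        (fun ω => |∑ i ∈ Finset.range n, small (V i ω) - n * ∫ v, small v ∂Q|) 2 P := hm2.abs
    rw [variance_eq_sub hm2'] at h1
    have h2 := hV.integral_sq_sum_sub_le hsm hsL n
    simp only [Pi.pow_apply, sq_abs] at h1
    have h3 : (n : ℝ) * ∫ v, small v ^ 2 ∂Q ≤ η * C := by
      calc (n : ℝ) * ∫ v, small v ^ 2 ∂Q ≤ n * (η * ∫ v, |ψ n v| ∂Q) := by gcongr
        _ = η * (n * ∫ v, |ψ n v| ∂Q) := by ring
        _ ≤ η * C := by gcongr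
    linarith
  have hb3 : |n * ∫ v, small v ∂Q - L| ≤ δ / 4 + δ / 4 := by
    have h1 : n * ∫ v, small v ∂Q - L = (n * ∫ v, ψ n v ∂Q - L) - n * ∫ v, big v ∂Q := by
      rw [integral_sub hn hbi]; ring
    have h2 : |n * ∫ v, big v ∂Q| ≤ δ / 4 := by
      rw [abs_mul, Nat.abs_cast]
      calc (n : ℝ) * |∫ v, big v ∂Q| ≤ n * ∫ v, |big v| ∂Q := by
            gcongr; exact abs_integral_le_integral_abs
        _ ≤ δ / 4 := by rw [hbabs]; exact (le_abs_self _).trans hln.le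
    rw [h1]
    exact (abs_sub _ _).trans (add_le_add hLn.le h2)
  calc ∫ ω, |∑ i ∈ Finset.range n, ψ n (V i ω) - L| ∂P
      ≤ ∫ ω, (∑ i ∈ Finset.range n, |big (V i ω)| +
        |∑ i ∈ Finset.range n, small (V i ω) - n * ∫ v, small v ∂Q| +
        |n * ∫ v, small v ∂Q - L|) ∂P := by
        refine integral_mono_of_nonneg (ae_of_all _ fun _ => abs_nonneg _)
          ((hi1.add hi2).add (integrable_const _)) (ae_of_all _ hpt)
    _ = ∫ ω, ∑ i ∈ Finset.range n, |big (V i ω)| ∂P +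
        ∫ ω, |∑ i ∈ Finset.range n, small (V i ω) - n * ∫ v, small v ∂Q| ∂P +
        |n * ∫ v, small v ∂Q - L| := by
        rw [← integral_add hi1 hi2]
        refine (integral_add (hi1.add hi2) (integrable_const _)).trans ?_
        simp
    _ ≤ δ / 4 + δ / 4 + (δ / 4 + δ / 4) := add_le_add (add_le_add hb1 hb2) hb3
    _ = δ := by ring

end IsIIDSample

/-! ### Characteristic functions and the Lindeberg central limit theorem. -/

variable {Ω : Type*} [MeasurableSpace Ω] {P : Measure Ω}

/-- Lindeberg's argument uses this cubic bound on small summands and the quadratic bound below on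
large ones, where only the truncated second moment is small. -/
lemma norm_exp_sub_quadratic_le_cube {x : ℝ} (hx : |x| ≤ 1) :
    ‖Complex.exp (x * Complex.I) - 1 - x * Complex.I + x ^ 2 / 2‖ ≤ |x| ^ 3 := by
  have h1 : ‖(x : ℂ) * Complex.I‖ = |x| := by simp
  have h := Complex.exp_bound (x := x * Complex.I) (by rw [h1]; exact hx) (n := 3) (by norm_num)
  have h2 : Complex.exp (x * Complex.I) -
      ∑ m ∈ Finset.range 3, ((x : ℂ) * Complex.I) ^ m / (m.factorial : ℂ) =
      Complex.exp (x * Complex.I) - 1 - x * Complex.I + x ^ 2 / 2 := by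
    simp only [Finset.sum_range_succ, Finset.sum_range_zero, mul_pow, Complex.I_sq]
    simp [Nat.factorial]
    ring
  rw [h2, h1] at h
  refine h.trans (mul_le_of_le_one_right (by positivity) ?_)
  norm_num [Nat.factorial]

lemma norm_exp_sub_quadratic_le_sq (x : ℝ) :
    ‖Complex.exp (x * Complex.I) - 1 - x * Complex.I + x ^ 2 / 2‖ ≤ 4 * x ^ 2 := by
  rcases le_total |x| 1 with hx | hx
  · refine (norm_exp_sub_quadratic_le_cube hx).trans ?_
    have : |x| ^ 3 = |x| * x ^ 2 := by rw [pow_succ', sq_abs]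
    rw [this]
    nlinarith [sq_nonneg x]
  · have h1 : ‖Complex.exp (x * Complex.I) - 1 - x * Complex.I + x ^ 2 / 2‖ ≤
        1 + 1 + |x| + x ^ 2 / 2 := by
      refine (norm_add_le _ _).trans (add_le_add ((norm_sub_le _ _).trans
        (add_le_add ((norm_sub_le _ _).trans (add_le_add ?_ ?_)) ?_)) ?_)
      · rw [Complex.norm_exp_ofReal_mul_I]
      · simp
      · simp
      · simp
    refine h1.trans ?_
    rw [← sq_abs x]
    nlinarith

namespace IsIIDSample

variable {α : Type*} [MeasurableSpace α] {V : ℕ → Ω → α} {Q : Measure α}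

lemma charFun_map_sum (hV : IsIIDSample P V Q) {ψ : α → ℝ} (hψ : Measurable ψ) (n : ℕ) (t : ℝ) :
    charFun (P.map fun ω => ∑ i ∈ Finset.range n, ψ (V i ω)) t = (charFun (Q.map ψ) t) ^ n := by
  have h := hV.map hψ
  rw [(h.indep.restrict _).charFun_map_fun_finsetSum_eq_prod
    fun i _ => (h.measurable i).aemeasurable]
  simp only [h.law]
  simp

/-- Lindeberg's central limit theorem for triangular arrays with i.i.d. rows. -/
lemma tendstoInDistribution_sum [IsProbabilityMeasure P] (hV : IsIIDSample P V Q)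
    {ψ : ℕ → α → ℝ} (hψ : ∀ n, Measurable (ψ n)) (hL : ∀ᶠ n in atTop, MemLp (ψ n) 2 Q)
    (h0 : ∀ᶠ n in atTop, ∫ v, ψ n v ∂Q = 0) {s : ℝ≥0}
    (hs : Tendsto (fun n : ℕ => n * ∫ v, ψ n v ^ 2 ∂Q) atTop (𝓝 s))
    (hlind : ∀ η : ℝ, 0 < η →
      Tendsto (fun n : ℕ => n * ∫ v in {v | η < |ψ n v|}, ψ n v ^ 2 ∂Q) atTop (𝓝 0)) :
    TendstoInDistribution (fun (n : ℕ) ω => ∑ i ∈ Finset.range n, ψ n (V i ω)) atTop (id : ℝ → ℝ)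
      (fun _ => P) (gaussianReal 0 s) where
  forall_aemeasurable n :=
    Finset.aemeasurable_fun_sum _ fun i _ => ((hψ n).comp (hV.measurable i)).aemeasurable
  tendsto := by
    have := hV.isProbabilityMeasure
    refine ProbabilityMeasure.tendsto_iff_tendsto_charFun.2 fun t => ?_
    simp only [ProbabilityMeasure.coe_mk, Measure.map_id]
    simp_rw [hV.charFun_map_sum (hψ _)]
    rw [charFun_gaussianReal]
    -- Since `(1 + z_n / n)^n → exp z` when `z_n → z`, the limit of the `n`-th power of the
    -- characteristic function reduces to this one.
    have key : Tendsto (fun n : ℕ => (n : ℂ) * (charFun (Q.map (ψ n)) t - 1)) atTop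
        (𝓝 (-(s * t ^ 2 / 2 : ℝ))) := by
      have h1 : Tendsto (fun n : ℕ => -(((n * ∫ v, ψ n v ^ 2 ∂Q) * t ^ 2 / 2 : ℝ) : ℂ)) atTop
          (𝓝 (-(s * t ^ 2 / 2 : ℝ))) :=
        ((Complex.continuous_ofReal.tendsto _).comp ((hs.mul_const _).div_const _)).neg
      refine (tendsto_iff_of_dist ?_).2 h1
      rw [Metric.tendsto_nhds]
      intro ε hε
      -- The first condition makes the cubic bound applicable where `|ψ| ≤ δ`; the second makes its
      -- total contribution small, `s + 1` eventually dominating `n ∫ ψ²`.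
      obtain ⟨δ, hδ, hδ1, hδ2⟩ : ∃ δ : ℝ, 0 < δ ∧ |t| * δ ≤ 1 ∧ |t| ^ 3 * δ * (s + 1) ≤ ε / 4 := by
        have hd : 0 < min 1 (ε / 4) / ((|t| + 1) ^ 3 * (s + 1)) := by positivity
        refine ⟨_, hd, ?_, ?_⟩
        · rw [mul_div_assoc', div_le_one (by positivity)]
          have h2 : |t| * min 1 (ε / 4) ≤ |t| * 1 := by gcongr; exact min_le_left _ _
          have h3 : |t| + 1 ≤ (|t| + 1) ^ 3 := le_self_pow₀ (by linarith [abs_nonneg t])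
            (by norm_num)
          have h4 : (0 : ℝ) ≤ s := s.2
          have h5 : 0 ≤ (|t| + 1) ^ 3 * s := by positivity
          nlinarith
        · rw [mul_div_assoc', div_mul_eq_mul_div, div_le_iff₀ (by positivity)]
          have h3 : |t| ^ 3 ≤ (|t| + 1) ^ 3 := by gcongr; linarith
          calc |t| ^ 3 * min 1 (ε / 4) * (s + 1) ≤ (|t| + 1) ^ 3 * (ε / 4) * (s + 1) := by
                gcongr; exact min_le_right _ _
            _ = _ := by ring
      have hl := Metric.tendsto_nhds.1 ((hlind δ hδ).const_mul (4 * t ^ 2)) (ε / 4) (by positivity)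
      have hs1 := Metric.tendsto_nhds.1 hs 1 one_pos
      filter_upwards [hL, h0, hl, hs1] with n hn h0n hln hsn
      simp only [mul_zero, dist_zero_right, Real.norm_eq_abs] at hln
      rw [Real.dist_eq] at hsn
      have hS : MeasurableSet {v | δ < |ψ n v|} := measurableSet_lt measurable_const (hψ n).abs
      have hi1 : Integrable (ψ n) Q := hn.integrable one_le_two
      have hi2 : Integrable (fun v => ψ n v ^ 2) Q := hn.integrable_sq
      have hie : Integrable (fun v => Complex.exp ((ψ n v * t : ℝ) * Complex.I)) Q := by
        refine Integrable.of_bound (C := 1) ?_ (ae_of_all _ fun v => ?_)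
        · have := hψ n
          exact Measurable.aestronglyMeasurable (by fun_prop)
        · rw [Complex.norm_exp_ofReal_mul_I]
      have hid : (n : ℂ) * (charFun (Q.map (ψ n)) t - 1) -
          -(((n * ∫ v, ψ n v ^ 2 ∂Q) * t ^ 2 / 2 : ℝ) : ℂ) =
          n * ∫ v, (Complex.exp ((ψ n v * t : ℝ) * Complex.I) - 1
            - (ψ n v * t : ℝ) * Complex.I + ((ψ n v * t : ℝ) : ℂ) ^ 2 / 2) ∂Q := by
        have e1 : charFun (Q.map (ψ n)) t
            = ∫ v, Complex.exp ((ψ n v * t : ℝ) * Complex.I) ∂Q := by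
          rw [charFun_apply_real, integral_map (hψ n).aemeasurable
            (Measurable.aestronglyMeasurable (by fun_prop))]
          congr 1
          ext v
          congr 1
          push_cast
          ring
        have e2 : ∫ v, (((ψ n v * t : ℝ) : ℂ) * Complex.I) ∂Q = 0 := by
          rw [integral_mul_const, integral_complex_ofReal, integral_mul_const, h0n]
          simp
        have e3 : ∫ v, (((ψ n v * t : ℝ) : ℂ) ^ 2 / (2 : ℂ)) ∂Q
            = (((∫ v, ψ n v ^ 2 ∂Q) * t ^ 2 / 2 : ℝ) : ℂ) := by
          rw [← integral_mul_const, ← integral_div, ← integral_complex_ofReal]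
          congr 1
          ext v
          push_cast
          ring
        have i2 : Integrable (fun v => ((ψ n v * t : ℝ) : ℂ) * Complex.I) Q :=
          ((hi1.mul_const t).ofReal).mul_const _
        have i3 : Integrable (fun v => ((ψ n v * t : ℝ) : ℂ) ^ 2 / 2) Q := by
          have := ((hi2.mul_const (t ^ 2)).div_const 2).ofReal (𝕜 := ℂ)
          refine this.congr (ae_of_all _ fun v => ?_)
          simp
          ring
        have e4 : ∫ v, (Complex.exp ((ψ n v * t : ℝ) * Complex.I) - 1
            - (ψ n v * t : ℝ) * Complex.I + ((ψ n v * t : ℝ) : ℂ) ^ 2 / 2) ∂Q =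
            ∫ v, Complex.exp ((ψ n v * t : ℝ) * Complex.I) ∂Q - ∫ v, (1 : ℂ) ∂Q
            - ∫ v, (((ψ n v * t : ℝ) : ℂ) * Complex.I) ∂Q
            + ∫ v, (((ψ n v * t : ℝ) : ℂ) ^ 2 / (2 : ℂ)) ∂Q := by
          have i1 : Integrable
              (fun v => Complex.exp ((ψ n v * t : ℝ) * Complex.I) - (1 : ℂ)) Q :=
            hie.sub (integrable_const _)
          rw [← integral_sub hie (integrable_const _), ← integral_sub i1 i2]
          exact integral_add (i1.sub i2) i3
        rw [e4, e1, e2, e3]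
        simp only [integral_const, probReal_univ]
        push_cast
        simp
        ring
      rw [Real.dist_0_eq_abs, abs_of_nonneg dist_nonneg, dist_eq_norm, hid, norm_mul,
        Complex.norm_natCast]
      have hbound : ‖∫ v, (Complex.exp ((ψ n v * t : ℝ) * Complex.I) - 1
            - (ψ n v * t : ℝ) * Complex.I + ((ψ n v * t : ℝ) : ℂ) ^ 2 / 2) ∂Q‖ ≤
          |t| ^ 3 * δ * ∫ v, ψ n v ^ 2 ∂Q
            + 4 * t ^ 2 * ∫ v in {v | δ < |ψ n v|}, ψ n v ^ 2 ∂Q := by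
        rw [← integral_indicator hS, ← integral_const_mul, ← integral_const_mul,
          ← integral_add (hi2.const_mul _) ((hi2.indicator hS).const_mul _)]
        refine norm_integral_le_of_norm_le
          ((hi2.const_mul _).add ((hi2.indicator hS).const_mul _)) (ae_of_all _ fun v => ?_)
        by_cases hv : δ < |ψ n v|
        · simp only [Set.indicator, Set.mem_ofPred_eq, hv, if_true]
          refine (norm_exp_sub_quadratic_le_sq _).trans ?_
          have : 0 ≤ |t| ^ 3 * δ * ψ n v ^ 2 := by positivity
          nlinarith
        · simp only [Set.indicator, Set.mem_ofPred_eq, hv, if_false, mul_zero, add_zero]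
          rw [not_lt] at hv
          have hb : |ψ n v * t| ≤ |t| * δ := by
            rw [abs_mul, mul_comm]; gcongr
          refine (norm_exp_sub_quadratic_le_cube (hb.trans hδ1)).trans ?_
          calc |ψ n v * t| ^ 3 = |t| ^ 3 * |ψ n v| * |ψ n v| ^ 2 := by rw [abs_mul]; ring
            _ ≤ |t| ^ 3 * δ * |ψ n v| ^ 2 := by gcongr
            _ = _ := by rw [sq_abs]
      calc (n : ℝ) * ‖_‖ ≤ n * (|t| ^ 3 * δ * ∫ v, ψ n v ^ 2 ∂Q
            + 4 * t ^ 2 * ∫ v in {v | δ < |ψ n v|}, ψ n v ^ 2 ∂Q) := by gcongr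
        _ = |t| ^ 3 * δ * (n * ∫ v, ψ n v ^ 2 ∂Q)
            + 4 * t ^ 2 * (n * ∫ v in {v | δ < |ψ n v|}, ψ n v ^ 2 ∂Q) := by ring
        _ ≤ |t| ^ 3 * δ * (s + 1) + ε / 4 := by
            gcongr
            · linarith [(abs_lt.1 hsn).2]
            · exact (le_abs_self _).trans hln.le
        _ < ε := by linarith
    have := Complex.tendsto_one_add_pow_exp_of_tendsto key
    refine (this.congr fun n => by simp).trans_eq ?_
    congr 2
    push_cast
    ring

end IsIIDSample

/-! ### Gaussian multipliers -/

/-- The characteristic functions of independent scaled normals multiply. Applied with weights frozen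
at the data, this gives the conditional law exactly, without a conditional limit theorem. -/
lemma map_sum_mul_gaussian {Ω' : Type*} [MeasurableSpace Ω'] {P' : Measure Ω'}
    [IsProbabilityMeasure P'] {ξ : ℕ → Ω' → ℝ} (hM : AssumptionM P' ξ) (a : ℕ → ℝ) (n : ℕ) :
    P'.map (fun ω => ∑ i ∈ Finset.range n, a i * ξ i ω) =
      gaussianReal 0 (∑ i ∈ Finset.range n, a i ^ 2).toNNReal := by
  have hm : ∀ i, AEMeasurable (fun ω => a i * ξ i ω) P' :=
    fun i => (hM.gaussian i).aemeasurable.const_mul _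
  have hind : iIndepFun (fun i ω => a i * ξ i ω) P' :=
    hM.indep.comp (fun i x => a i * x) fun i => measurable_const_mul _
  have : IsProbabilityMeasure (P'.map fun ω => ∑ i ∈ Finset.range n, a i * ξ i ω) :=
    Measure.isProbabilityMeasure_map (Finset.aemeasurable_fun_sum _ fun i _ => hm i)
  refine Measure.ext_of_charFun ?_
  ext t
  rw [(hind.restrict _).charFun_map_fun_finsetSum_eq_prod fun i _ => hm i]
  have h1 : ∀ i, charFun (P'.map fun ω => a i * ξ i ω) t
      = Complex.exp (-((a i ^ 2 : ℝ) * t ^ 2 / 2)) := by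
    intro i
    rw [charFun_map_mul_comp (hM.gaussian i).aemeasurable, (hM.gaussian i).map_eq,
      charFun_gaussianReal]
    congr 1
    push_cast
    simp
    ring
  rw [Finset.prod_apply]
  simp_rw [h1]
  rw [← Complex.exp_sum, charFun_gaussianReal]
  congr 1
  rw [Real.coe_toNNReal _ (Finset.sum_nonneg fun i _ => sq_nonneg _)]
  push_cast
  rw [Finset.sum_neg_distrib, ← Finset.sum_div, ← Finset.sum_mul]
  simp

/-- Both laws are images of one standard normal under scaling, and `g` is 1-Lipschitz along this
coupling. The bound does not depend on `g`, so it survives the supremum over `BL1`. -/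
lemma abs_integral_gaussianReal_sub_le {g : ℝ → ℝ} (hg : g ∈ BL1) (s σ : ℝ≥0) :
    |∫ x, g x ∂gaussianReal 0 (s ^ 2) - ∫ x, g x ∂gaussianReal 0 (σ ^ 2)| ≤
      |(s : ℝ) - σ| * ∫ x, |x| ∂gaussianReal 0 1 := by
  have hmap : ∀ r : ℝ≥0, ∫ x, g x ∂gaussianReal 0 (r ^ 2)
      = ∫ x, g (r * x) ∂gaussianReal 0 1 := by
    intro r
    have h := gaussianReal_map_const_mul (μ := 0) (v := 1) (r : ℝ)
    have h2 : gaussianReal 0 (r ^ 2) = (gaussianReal 0 1).map (fun x => (r : ℝ) * x) := by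
      rw [h]
      congr 1
      · simp
      · ext; simp
    rw [h2, integral_map (by fun_prop) hg.1.continuous.measurable.aestronglyMeasurable]
  have hint : ∀ r : ℝ≥0, Integrable (fun x => g (r * x)) (gaussianReal 0 1) := fun r =>
    Integrable.of_bound (C := 1)
      (hg.1.continuous.comp (continuous_const.mul continuous_id)).measurable.aestronglyMeasurable
      (ae_of_all _ fun x => hg.2 _)
  have hid : Integrable (fun x : ℝ => |x|) (gaussianReal 0 1) :=
    ((memLp_id_gaussianReal 1).integrable (by simp)).abs
  rw [hmap, hmap, ← integral_sub (hint _) (hint _), ← integral_const_mul]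
  refine (abs_integral_le_integral_abs).trans (integral_mono ((hint _).sub (hint _)).abs
    (hid.const_mul _) fun x => ?_)
  have := hg.1.dist_le_mul (s * x) (σ * x)
  simp only [Real.dist_eq, NNReal.coe_one, one_mul] at this
  refine this.trans_eq ?_
  rw [← sub_mul, abs_mul]

/-- A Gaussian multiplier sum whose conditional variance converges in probability converges weakly
conditionally on the data. -/
lemma condWeakConvInProb_gaussian {Ω' : Type*} [MeasurableSpace Ω'] {P' : Measure Ω'}
    [IsProbabilityMeasure P'] {ξ : ℕ → Ω' → ℝ} (hM : AssumptionM P' ξ) {T : ℕ → Ω → Ω' → ℝ}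
    {A : ℕ → Ω → ℕ → ℝ} (hT : ∀ n ω ω', T n ω ω' = ∑ i ∈ Finset.range n, A n ω i * ξ i ω')
    {σ : ℝ≥0} (hA : Tendsto (fun x : ℕ × Ω => ∑ i ∈ Finset.range x.1, A x.1 x.2 i ^ 2)
      (inProb P) (𝓝 ((σ : ℝ) ^ 2))) :
    CondWeakConvInProb P P' T (gaussianReal 0 (σ ^ 2)) := by
  rw [CondWeakConvInProb, tendstoInMeasure_iff_inProb]
  have hzero : (0 : ℝ → ℝ) ∈ BL1 := ⟨LipschitzWith.const 0 |>.weaken zero_le, by simp⟩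
  have : Nonempty BL1 := ⟨⟨0, hzero⟩⟩
  have hlim : Tendsto (fun x : ℕ × Ω =>
      |Real.sqrt (∑ i ∈ Finset.range x.1, A x.1 x.2 i ^ 2) - σ| * ∫ x, |x| ∂gaussianReal 0 1)
      (inProb P) (𝓝 0) := by
    have h1 := (Real.continuous_sqrt.tendsto _).comp hA
    rw [Real.sqrt_sq σ.coe_nonneg] at h1
    have h2 := ((h1.sub_const (σ : ℝ)).abs).mul_const (∫ x, |x| ∂gaussianReal 0 1)
    simpa using h2
  refine squeeze_zero (fun x => Real.iSup_nonneg fun g => abs_nonneg _) (fun x => ?_) hlim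
  refine ciSup_le fun g => ?_
  obtain ⟨g, hg⟩ := g
  set V := ∑ i ∈ Finset.range x.1, A x.1 x.2 i ^ 2 with hVdef
  have hV : 0 ≤ V := Finset.sum_nonneg fun i _ => sq_nonneg _
  have h1 : ∫ ω', g (T x.1 x.2 ω') ∂P'
      = ∫ y, g y ∂gaussianReal 0 ((Real.sqrt V).toNNReal ^ 2) := by
    have h2 : (Real.sqrt V).toNNReal ^ 2 = V.toNNReal := by
      ext
      rw [NNReal.coe_pow, Real.coe_toNNReal _ (Real.sqrt_nonneg _), Real.sq_sqrt hV,
        Real.coe_toNNReal _ hV]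
    rw [h2, hVdef, ← map_sum_mul_gaussian hM, integral_map
      (Finset.aemeasurable_fun_sum _ fun i _ => (hM.gaussian i).aemeasurable.const_mul _)
      hg.1.continuous.measurable.aestronglyMeasurable]
    simp_rw [hT]
  have h3 := abs_integral_gaussianReal_sub_le hg (Real.sqrt V).toNNReal σ
  rw [Real.coe_toNNReal _ (Real.sqrt_nonneg _)] at h3
  simp only [h1]
  exact h3

variable {Ω : Type*} [MeasurableSpace Ω] {P : Measure Ω}

/-! ### Localisation at the cutoff -/

/-- Bounded measurable functions of bounded support. -/
structure IsLocal (g : ℝ → ℝ) : Prop where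
  measurable : Measurable g
  bdd : ∃ B, ∀ u, |g u| ≤ B
  supp : ∃ c, ∀ u, c < |u| → g u = 0

namespace IsLocal

lemma exists_pos_bdd {g : ℝ → ℝ} (hg : IsLocal g) : ∃ B, 0 < B ∧ ∀ u, |g u| ≤ B := by
  obtain ⟨B, hB⟩ := hg.bdd
  exact ⟨max B 1, by positivity, fun u => (hB u).trans (le_max_left _ _)⟩

lemma exists_pos_supp {g : ℝ → ℝ} (hg : IsLocal g) : ∃ c, 0 < c ∧ ∀ u, c < |u| → g u = 0 := by
  obtain ⟨c, hc⟩ := hg.supp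
  exact ⟨max c 1, by positivity, fun u hu => hc u ((le_max_left _ _).trans_lt hu)⟩

lemma mul {g k : ℝ → ℝ} (hg : IsLocal g) (hk : IsLocal k) : IsLocal fun u => g u * k u where
  measurable := hg.measurable.mul hk.measurable
  bdd := by
    obtain ⟨B, hB0, hB⟩ := hg.exists_pos_bdd
    obtain ⟨C, hC0, hC⟩ := hk.exists_pos_bdd
    exact ⟨B * C, fun u => by
      rw [abs_mul]; exact mul_le_mul (hB u) (hC u) (abs_nonneg _) hB0.le⟩
  supp := by
    obtain ⟨c, hc⟩ := hg.supp
    exact ⟨c, fun u hu => by rw [hc u hu, zero_mul]⟩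

lemma add {g k : ℝ → ℝ} (hg : IsLocal g) (hk : IsLocal k) : IsLocal fun u => g u + k u where
  measurable := hg.measurable.add hk.measurable
  bdd := by
    obtain ⟨B, hB⟩ := hg.bdd
    obtain ⟨C, hC⟩ := hk.bdd
    exact ⟨B + C, fun u => (abs_add_le _ _).trans (add_le_add (hB u) (hC u))⟩
  supp := by
    obtain ⟨c, hc⟩ := hg.supp
    obtain ⟨d, hd⟩ := hk.supp
    exact ⟨max c d, fun u hu => by
      rw [hc u ((le_max_left _ _).trans_lt hu), hd u ((le_max_right _ _).trans_lt hu), add_zero]⟩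

lemma const_mul {g : ℝ → ℝ} (hg : IsLocal g) (a : ℝ) : IsLocal fun u => a * g u where
  measurable := hg.measurable.const_mul a
  bdd := by
    obtain ⟨B, hB⟩ := hg.bdd
    exact ⟨|a| * B, fun u => by rw [abs_mul]; gcongr; exact hB u⟩
  supp := by
    obtain ⟨c, hc⟩ := hg.supp
    exact ⟨c, fun u hu => by rw [hc u hu, mul_zero]⟩

lemma sub {g k : ℝ → ℝ} (hg : IsLocal g) (hk : IsLocal k) : IsLocal fun u => g u - k u := by
  simpa [sub_eq_add_neg] using hg.add (hk.const_mul (-1))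

lemma sq {g : ℝ → ℝ} (hg : IsLocal g) : IsLocal fun u => g u ^ 2 := by
  simpa [pow_two] using hg.mul hg

lemma abs {g : ℝ → ℝ} (hg : IsLocal g) : IsLocal fun u => |g u| where
  measurable := hg.measurable.abs
  bdd := by
    obtain ⟨B, hB⟩ := hg.bdd
    exact ⟨B, fun u => by rw [abs_abs]; exact hB u⟩
  supp := by
    obtain ⟨c, hc⟩ := hg.supp
    exact ⟨c, fun u hu => by rw [hc u hu, abs_zero]⟩

lemma indicator {g : ℝ → ℝ} (hg : IsLocal g) {S : Set ℝ} (hS : MeasurableSet S) :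
    IsLocal (S.indicator g) where
  measurable := hg.measurable.indicator hS
  bdd := by
    obtain ⟨B, hB0, hB⟩ := hg.exists_pos_bdd
    refine ⟨B, fun u => ?_⟩
    by_cases hu : u ∈ S
    · rw [indicator_of_mem hu]; exact hB u
    · rw [indicator_of_notMem hu, abs_zero]; exact hB0.le
  supp := by
    obtain ⟨c, hc⟩ := hg.supp
    refine ⟨c, fun u hu => ?_⟩
    by_cases h : u ∈ S
    · rw [indicator_of_mem h, hc u hu]
    · rw [indicator_of_notMem h]

lemma comp_div {g : ℝ → ℝ} (hg : IsLocal g) {a : ℝ} (ha : 0 < a) :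
    IsLocal fun u => g (u / a) where
  measurable := hg.measurable.comp (measurable_id.div_const a)
  bdd := by
    obtain ⟨B, hB⟩ := hg.bdd
    exact ⟨B, fun u => hB _⟩
  supp := by
    obtain ⟨c, hc⟩ := hg.supp
    refine ⟨c * a, fun u hu => hc _ ?_⟩
    rwa [abs_div, abs_of_pos ha, lt_div_iff₀ ha]

lemma pow_mul {g : ℝ → ℝ} (hg : IsLocal g) (j : ℕ) : IsLocal fun u => u ^ j * g u where
  measurable := (measurable_id.pow_const j).mul hg.measurable
  bdd := by
    obtain ⟨B, hB0, hB⟩ := hg.exists_pos_bdd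
    obtain ⟨c, hc0, hc⟩ := hg.exists_pos_supp
    refine ⟨c ^ j * B, fun u => ?_⟩
    by_cases hu : c < |u|
    · rw [hc u hu, mul_zero, abs_zero]; positivity
    · rw [not_lt] at hu
      rw [abs_mul, abs_pow]
      exact mul_le_mul (by gcongr) (hB u) (abs_nonneg _) (by positivity)
  supp := by
    obtain ⟨c, hc⟩ := hg.supp
    exact ⟨c, fun u hu => by rw [hc u hu, mul_zero]⟩

lemma integrable {g : ℝ → ℝ} (hg : IsLocal g) : Integrable g := by
  obtain ⟨B, hB⟩ := hg.bdd
  obtain ⟨c, hc⟩ := hg.supp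
  have h1 : IntegrableOn g (Icc (-c) c) :=
    Measure.integrableOn_of_bounded (M := B) (by simp) hg.measurable.aestronglyMeasurable
      (ae_of_all _ fun u => hB u)
  refine (integrableOn_iff_integrable_of_support_subset fun u hu => ?_).1 h1
  by_contra hcon
  refine hu (hc u ?_)
  rw [mem_Icc, ← abs_le, not_le] at hcon
  exact hcon

end IsLocal

/-- `X` has density `f`, which is continuous at the cutoff. -/
structure HasLocalDensity (P : Measure Ω) (X : Ω → ℝ) (f : ℝ → ℝ) : Prop where
  measurable : Measurable X
  measurable_density : Measurable f
  nonneg : ∀ x, 0 ≤ f x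
  law : P.map X = volume.withDensity (fun x => ENNReal.ofReal (f x))
  continuousAt : ContinuousAt f 0

namespace HasLocalDensity

variable {X : Ω → ℝ} {f : ℝ → ℝ}

lemma ae_ne_zero (hX : HasLocalDensity P X f) : ∀ᵐ ω ∂P, X ω ≠ 0 := by
  have h1 : P.map X {0} = 0 := by
    rw [hX.law]
    exact withDensity_absolutelyContinuous _ _ (by simp)
  rw [Measure.map_apply hX.measurable (measurableSet_singleton 0)] at h1
  rw [ae_iff]
  simp only [not_not]
  exact h1

lemma integral_comp (hX : HasLocalDensity P X f) {φ : ℝ → ℝ} (hφ : Measurable φ) :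
    ∫ ω, φ (X ω) ∂P = ∫ x, f x * φ x := by
  rw [← integral_map hX.measurable.aemeasurable hφ.aestronglyMeasurable, hX.law,
    integral_withDensity_eq_integral_toReal_smul (by have := hX.measurable_density; fun_prop)
      (ae_of_all _ fun x => by simp)]
  simp [ENNReal.toReal_ofReal (hX.nonneg _)]

lemma integrable_comp [IsFiniteMeasure P] (hX : HasLocalDensity P X f) {g : ℝ → ℝ}
    (hg : IsLocal g) (a : ℝ) : Integrable (fun ω => g (X ω / a)) P := by
  obtain ⟨B, hB⟩ := hg.bdd
  exact Integrable.of_bound (C := B)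
    (hg.measurable.comp (hX.measurable.div_const a)).aestronglyMeasurable
    (ae_of_all _ fun ω => hB _)

/-- The substitution `x = h u` gives `∫ f(h u) g(u) du`. On the bounded support of `g` the points `h
u` shrink to the cutoff, where continuity of `f` supplies both the limit and the dominating constant
`|f 0| + 1`. -/
lemma tendsto_integral_local (hX : HasLocalDensity P X f) {h : ℕ → ℝ} (h_pos : ∀ n, 0 < h n)
    (h_lim : Tendsto h atTop (𝓝 0)) {g : ℝ → ℝ} (hg : IsLocal g) :
    Tendsto (fun n => (h n)⁻¹ * ∫ ω, g (X ω / h n) ∂P) atTop (𝓝 (f 0 * ∫ u, g u)) := by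
  have h1 : ∀ n, (h n)⁻¹ * ∫ ω, g (X ω / h n) ∂P = ∫ u, f (h n * u) * g u := by
    intro n
    rw [hX.integral_comp (φ := fun x => g (x / h n)) (hg.measurable.comp (measurable_id.div_const _))]
    have := Measure.integral_comp_mul_left (fun x => f x * g (x / h n)) (h n)
    rw [abs_of_pos (inv_pos.2 (h_pos n)), smul_eq_mul] at this
    rw [← this]
    congr 1
    ext u
    rw [mul_div_cancel_left₀ _ (h_pos n).ne']
  simp_rw [h1]
  rw [← integral_const_mul]
  obtain ⟨c, hc0, hc⟩ := hg.exists_pos_supp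
  refine tendsto_integral_filter_of_dominated_convergence (fun u => (|f 0| + 1) * |g u|) ?_ ?_
    (hg.abs.integrable.const_mul _) ?_
  · refine Eventually.of_forall fun n => ?_
    exact ((hX.measurable_density.comp (measurable_const_mul _)).mul
      hg.measurable).aestronglyMeasurable
  · obtain ⟨δ, hδ, hfδ⟩ := Metric.continuousAt_iff.1 hX.continuousAt 1 one_pos
    have h2 := Metric.tendsto_nhds.1 h_lim (δ / (c + 1)) (by positivity)
    filter_upwards [h2] with n hn
    refine ae_of_all _ fun u => ?_
    rw [norm_mul, Real.norm_eq_abs, Real.norm_eq_abs]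
    by_cases hu : c < |u|
    · rw [hc u hu]; simp
    · rw [not_lt] at hu
      refine mul_le_mul_of_nonneg_right ?_ (abs_nonneg _)
      have h3 : dist (h n * u) 0 < δ := by
        rw [dist_zero_right, Real.norm_eq_abs, abs_mul]
        rw [dist_zero_right, Real.norm_eq_abs, lt_div_iff₀ (by positivity)] at hn
        nlinarith [abs_nonneg (h n), abs_pos.2 (h_pos n).ne']
      have h4 := (hfδ h3).le
      rw [Real.dist_eq] at h4
      linarith [abs_sub_abs_le_abs_sub (f (h n * u)) (f 0)]
  · refine ae_of_all _ fun u => ?_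
    refine Tendsto.mul_const _ ?_
    have h2 : Tendsto (fun n => h n * u) atTop (𝓝 0) := by simpa using h_lim.mul_const u
    exact hX.continuousAt.tendsto.comp h2

end HasLocalDensity

/-! ### Conditional means integrated against localised functions of `X`. -/

namespace IsCondMeanOn

variable {X Z : Ω → ℝ} {I : Set ℝ} {m : ℝ → ℝ}

lemma congr (hm : IsCondMeanOn P X Z I m) (hX : Measurable X) (hI : MeasurableSet I)
    {Z' : Ω → ℝ} (h : ∀ᵐ ω ∂P, X ω ∈ I → Z ω = Z' ω) : IsCondMeanOn P X Z' I m := by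
  have h1 : (X ⁻¹' I).indicator Z =ᵐ[P] (X ⁻¹' I).indicator Z' := by
    filter_upwards [h] with ω hω
    by_cases hi : X ω ∈ I
    · rw [indicator_of_mem (show ω ∈ X ⁻¹' I from hi), indicator_of_mem (show ω ∈ X ⁻¹' I from hi),
        hω hi]
    · rw [indicator_of_notMem (show ω ∉ X ⁻¹' I from hi),
        indicator_of_notMem (show ω ∉ X ⁻¹' I from hi)]
  refine ⟨?_, ?_⟩
  · rw [← integrable_indicator_iff (hX hI)]
    exact ((integrable_indicator_iff (hX hI)).2 hm.1).congr h1
  · filter_upwards [hm.2, condExp_congr_ae (m := MeasurableSpace.comap X inferInstance) h1]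
      with ω h2 h3 hω
    rw [← h3, h2 hω]

/-- The pull-out property of conditional expectation, applied to `Z` cut off outside `{X ∈ I}`,
which `φ` does not see. No measurability of `m` is needed: `m (X)` agrees almost surely on that
event with a conditional expectation. -/
lemma integral_mul [IsFiniteMeasure P] (hm : IsCondMeanOn P X Z I m) (hX : Measurable X)
    (hI : MeasurableSet I) {φ : ℝ → ℝ} (hφ : Measurable φ) {B : ℝ} (hB : ∀ x, |φ x| ≤ B)
    (hφI : ∀ x, x ∉ I → φ x = 0) :
    Integrable (fun ω => φ (X ω) * Z ω) P ∧ Integrable (fun ω => φ (X ω) * m (X ω)) P ∧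
      ∫ ω, φ (X ω) * Z ω ∂P = ∫ ω, φ (X ω) * m (X ω) ∂P := by
  set W := (X ⁻¹' I).indicator Z with hW
  have hWi : Integrable W P := (integrable_indicator_iff (hX hI)).2 hm.1
  have hle : MeasurableSpace.comap X inferInstance ≤ (inferInstance : MeasurableSpace Ω) :=
    hX.comap_le
  have hφX : StronglyMeasurable[MeasurableSpace.comap X inferInstance] (fun ω => φ (X ω)) :=
    (hφ.comp (comap_measurable X)).stronglyMeasurable
  have hφX' : AEStronglyMeasurable (fun ω => φ (X ω)) P := (hφ.comp hX).aestronglyMeasurable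
  have h1 : (fun ω => φ (X ω) * Z ω) = fun ω => φ (X ω) * W ω := by
    ext ω
    by_cases hi : X ω ∈ I
    · rw [hW, indicator_of_mem (show ω ∈ X ⁻¹' I from hi)]
    · rw [hφI _ hi, zero_mul, zero_mul]
  have hi1 : Integrable (fun ω => φ (X ω) * W ω) P :=
    hWi.bdd_mul hφX' (ae_of_all _ fun ω => hB _)
  have hce := condExp_mul_of_stronglyMeasurable_left hφX hi1 hWi
  have h2 : (fun ω => φ (X ω) * (P[W | MeasurableSpace.comap X inferInstance]) ω) =ᵐ[P]
      fun ω => φ (X ω) * m (X ω) := by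
    filter_upwards [hm.2] with ω hω
    by_cases hi : X ω ∈ I
    · rw [hω hi]
    · rw [hφI _ hi, zero_mul, zero_mul]
  have hi2 : Integrable (fun ω => φ (X ω) * (P[W | MeasurableSpace.comap X inferInstance]) ω) P :=
    integrable_condExp.bdd_mul hφX' (ae_of_all _ fun ω => hB _)
  refine ⟨h1 ▸ hi1, hi2.congr h2, ?_⟩
  rw [h1, ← integral_congr_ae h2, ← integral_condExp hle]
  exact integral_congr_ae hce

end IsCondMeanOn

/-- The bandwidth eventually carries the support of a local function into an interval around the
cutoff. -/
lemma IsLocal.eventually_supp {g : ℝ → ℝ} (hg : IsLocal g) {h : ℕ → ℝ} (h_pos : ∀ n, 0 < h n)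
    (h_lim : Tendsto h atTop (𝓝 0)) {s : Set ℝ} (hs : s ∈ 𝓝 0) :
    ∀ᶠ n in atTop, ∀ x, x ∉ s → g (x / h n) = 0 := by
  obtain ⟨c, hc0, hc⟩ := hg.exists_pos_supp
  obtain ⟨δ, hδ, hδs⟩ := Metric.mem_nhds_iff.1 hs
  filter_upwards [Metric.tendsto_nhds.1 h_lim (δ / c) (by positivity)] with n hn x hx
  apply hc
  rw [dist_zero_right, Real.norm_eq_abs, abs_of_pos (h_pos n), lt_div_iff₀ hc0] at hn
  rw [abs_div, abs_of_pos (h_pos n), lt_div_iff₀ (h_pos n)]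
  by_contra hcon
  refine hx (hδs ?_)
  rw [Metric.mem_ball, dist_zero_right, Real.norm_eq_abs]
  linarith

section Moments

variable [IsProbabilityMeasure P] {X Z : Ω → ℝ} {f m : ℝ → ℝ} {xl xu : ℝ} {h : ℕ → ℝ}

/-- Conditioning replaces `Z` by `m (X)`, which is uniformly close to `l` on the shrinking support
of `g (· / h)` inside the cone `S`; what remains is the kernel integral of `g`. -/
lemma IsCondMeanOn.tendsto_integral_local (hm : IsCondMeanOn P X Z (Icc xl xu) m)
    (hX : HasLocalDensity P X f) (hxl : xl < 0) (hxu : 0 < xu) (h_pos : ∀ n, 0 < h n)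
    (h_lim : Tendsto h atTop (𝓝 0)) {g : ℝ → ℝ} (hg : IsLocal g) {S : Set ℝ}
    (hS : ∀ x a : ℝ, 0 < a → x / a ∈ S → x ∈ S) (hgS : ∀ u, u ∉ S → g u = 0) {l : ℝ}
    (hl : Tendsto m (𝓝[S] 0) (𝓝 l)) :
    Tendsto (fun n => (h n)⁻¹ * ∫ ω, g (X ω / h n) * Z ω ∂P) atTop (𝓝 (l * (f 0 * ∫ u, g u))) := by
  obtain ⟨B, hB0, hB⟩ := hg.exists_pos_bdd
  have hg1 := hX.tendsto_integral_local h_pos h_lim hg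
  have hg2 := hX.tendsto_integral_local h_pos h_lim hg.abs
  refine (tendsto_iff_of_dist ?_).2 (hg1.const_mul l)
  rw [Metric.tendsto_nhds]
  intro ε hε
  set G := f 0 * ∫ u, |g u| with hG
  have hG0 : 0 ≤ G := mul_nonneg (hX.nonneg 0) (integral_nonneg fun u => abs_nonneg _)
  -- The rescaled integral of `|g|` is eventually at most `G + 1`; the extra unit makes the final
  -- inequality strict.
  have hη : 0 < ε / (G + 2) := by positivity
  have hnb : {x | x ∈ S → dist (m x) l < ε / (G + 2)} ∈ 𝓝 (0 : ℝ) :=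
    eventually_nhdsWithin_iff.1 (Metric.tendsto_nhds.1 hl _ hη)
  filter_upwards [hg.eventually_supp h_pos h_lim hnb,
    hg.eventually_supp h_pos h_lim (Icc_mem_nhds hxl hxu),
    Metric.tendsto_nhds.1 hg2 1 one_pos] with n hn1 hn2 hn3
  have hgm : Measurable fun x => g (x / h n) := hg.measurable.comp (measurable_id.div_const _)
  obtain ⟨-, hi, he⟩ := hm.integral_mul hX.measurable measurableSet_Icc
    (φ := fun x => g (x / h n)) hgm (fun x => hB _) hn2
  have hgi := hX.integrable_comp hg (h n)
  rw [dist_zero_right, Real.norm_eq_abs, abs_of_nonneg dist_nonneg, Real.dist_eq, he]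
  have e1 : (h n)⁻¹ * ∫ ω, g (X ω / h n) * m (X ω) ∂P - l * ((h n)⁻¹ * ∫ ω, g (X ω / h n) ∂P)
      = (h n)⁻¹ * ∫ ω, g (X ω / h n) * (m (X ω) - l) ∂P := by
    have : ∀ ω, g (X ω / h n) * (m (X ω) - l) = g (X ω / h n) * m (X ω) - l * g (X ω / h n) :=
      fun ω => by ring
    simp_rw [this]
    rw [integral_sub hi (hgi.const_mul l), integral_const_mul]
    ring
  rw [e1, abs_mul, abs_of_pos (inv_pos.2 (h_pos n))]
  have e2 : |∫ ω, g (X ω / h n) * (m (X ω) - l) ∂P| ≤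
      ε / (G + 2) * ∫ ω, |g (X ω / h n)| ∂P := by
    rw [← integral_const_mul]
    refine abs_integral_le_integral_abs.trans (integral_mono_of_nonneg
      (ae_of_all _ fun _ => abs_nonneg _) (hgi.abs.const_mul _) (ae_of_all _ fun ω => ?_))
    simp only [abs_mul]
    by_cases h0 : g (X ω / h n) = 0
    · simp [h0]
    · have hxS : X ω ∈ S := hS _ _ (h_pos n) (by_contra fun hc => h0 (hgS _ hc))
      have h3 : X ω ∈ {x | x ∈ S → dist (m x) l < ε / (G + 2)} :=
        by_contra fun hc => h0 (hn1 _ hc)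
      have h4 := (h3 hxS).le
      rw [Real.dist_eq] at h4
      rw [mul_comm]
      gcongr
  rw [Real.dist_eq] at hn3
  calc (h n)⁻¹ * |∫ ω, g (X ω / h n) * (m (X ω) - l) ∂P|
      ≤ (h n)⁻¹ * (ε / (G + 2) * ∫ ω, |g (X ω / h n)| ∂P) := by
        have := h_pos n
        gcongr
    _ = ε / (G + 2) * ((h n)⁻¹ * ∫ ω, |g (X ω / h n)| ∂P) := by ring
    _ ≤ ε / (G + 2) * (G + 1) := by
        gcongr
        linarith [(abs_lt.1 hn3).2]
    _ < ε := by
        rw [div_mul_eq_mul_div, div_lt_iff₀ (by positivity)]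
        nlinarith

lemma IsCondMeanOn.exists_integral_local_le (hm : IsCondMeanOn P X Z (Icc xl xu) m)
    (hX : HasLocalDensity P X f) (hxl : xl < 0) (hxu : 0 < xu) (h_pos : ∀ n, 0 < h n)
    (h_lim : Tendsto h atTop (𝓝 0)) {M : ℝ} (hM : ∀ x ∈ Icc xl xu \ {0}, m x ≤ M)
    {g : ℝ → ℝ} (hg : IsLocal g) :
    ∃ C, ∀ᶠ n in atTop, Integrable (fun ω => |g (X ω / h n)| * Z ω) P ∧
      (h n)⁻¹ * ∫ ω, |g (X ω / h n)| * Z ω ∂P ≤ C := by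
  obtain ⟨B, hB0, hB⟩ := hg.abs.exists_pos_bdd
  have hg2 := hX.tendsto_integral_local h_pos h_lim hg.abs
  refine ⟨|M| * (f 0 * (∫ u, |g u|) + 1), ?_⟩
  filter_upwards [hg.abs.eventually_supp h_pos h_lim (Icc_mem_nhds hxl hxu),
    Metric.tendsto_nhds.1 hg2 1 one_pos] with n hn2 hn3
  have hgm : Measurable fun x => |g (x / h n)| :=
    hg.abs.measurable.comp (measurable_id.div_const _)
  obtain ⟨hiZ, hi, he⟩ := hm.integral_mul hX.measurable measurableSet_Icc
    (φ := fun x => |g (x / h n)|) hgm (fun x => hB _) hn2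
  refine ⟨hiZ, ?_⟩
  rw [he]
  have e1 : ∫ ω, |g (X ω / h n)| * m (X ω) ∂P ≤ |M| * ∫ ω, |g (X ω / h n)| ∂P := by
    rw [← integral_const_mul]
    refine integral_mono_ae hi ((hX.integrable_comp hg.abs (h n)).const_mul _) ?_
    -- The bound on `m` is only assumed away from the cutoff, which `X` almost surely avoids.
    filter_upwards [hX.ae_ne_zero] with ω hω
    by_cases h0 : |g (X ω / h n)| = 0
    · simp [h0]
    · have hxS : X ω ∈ Icc xl xu := by_contra fun hc => h0 (hn2 _ hc)
      have h3 := hM _ ⟨hxS, hω⟩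
      rw [mul_comm]
      exact mul_le_mul_of_nonneg_right (h3.trans (le_abs_self M)) (abs_nonneg _)
  rw [Real.dist_eq] at hn3
  have := h_pos n
  calc (h n)⁻¹ * ∫ ω, |g (X ω / h n)| * m (X ω) ∂P
      ≤ (h n)⁻¹ * (|M| * ∫ ω, |g (X ω / h n)| ∂P) := by gcongr
    _ = |M| * ((h n)⁻¹ * ∫ ω, |g (X ω / h n)| ∂P) := by ring
    _ ≤ |M| * (f 0 * (∫ u, |g u|) + 1) := by
        gcongr
        linarith [(abs_lt.1 hn3).2]

end Moments

/-! ### One-sided Taylor expansion -/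

/-- A Lipschitz extension to the whole line has a value at `a`, which serves as the limit along `S`
even when `a ∉ S`. -/
lemma LipschitzOnWith.exists_tendsto_nhdsWithin {v : ℝ → ℝ} {S : Set ℝ} {L : ℝ≥0}
    (hv : LipschitzOnWith L v S) (a : ℝ) :
    ∃ l, Tendsto v (𝓝[S] a) (𝓝 l) ∧ ∀ x ∈ S, |v x - l| ≤ L * |x - a| := by
  obtain ⟨g, hg, heq⟩ := hv.extend_real
  refine ⟨g a, ?_, fun x hx => ?_⟩
  · have h1 : Tendsto g (𝓝[S] a) (𝓝 (g a)) := hg.continuous.continuousAt.mono_left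
      nhdsWithin_le_nhds
    exact h1.congr' (eventually_nhdsWithin_of_forall fun x hx => (heq hx).symm)
  · rw [heq hx]
    simpa [Real.dist_eq] using hg.dist_le_mul x a

/-- One integration step of Taylor's theorem at an endpoint that need not lie in `S`: the mean value
inequality along the segment `t ↦ t x`, `0 < t ≤ 1`, followed by `t → 0`. It gains one power of
`|x|`. -/
lemma abs_le_of_hasDerivAt_of_tendsto_zero {S : Set ℝ}
    (hstar : ∀ x ∈ S, ∀ t ∈ Ioc (0 : ℝ) 1, t * x ∈ S) {φ φ' : ℝ → ℝ}
    (hd : ∀ x ∈ S, HasDerivAt φ (φ' x) x) {C : ℝ} (hC : 0 ≤ C) {k : ℕ}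
    (hb : ∀ x ∈ S, |φ' x| ≤ C * |x| ^ k) (h0 : Tendsto φ (𝓝[S] 0) (𝓝 0)) :
    ∀ x ∈ S, |φ x| ≤ C * |x| ^ (k + 1) := by
  intro x hx
  have hder : ∀ t ∈ Ioc (0 : ℝ) 1,
      HasDerivWithinAt (fun t => φ (t * x)) (φ' (t * x) * x) (Ioc 0 1) t := by
    intro t ht
    have h1 : HasDerivAt (fun t : ℝ => t * x) x t := by
      simpa using (hasDerivAt_id t).mul_const x
    exact ((hd _ (hstar x hx t ht)).comp t h1).hasDerivWithinAt
  have hbd : ∀ t ∈ Ioc (0 : ℝ) 1, ‖φ' (t * x) * x‖ ≤ C * |x| ^ (k + 1) := by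
    intro t ht
    rw [norm_mul, Real.norm_eq_abs, Real.norm_eq_abs]
    have h1 := hb _ (hstar x hx t ht)
    have h2 : |t * x| ≤ |x| := by
      rw [abs_mul, abs_of_pos ht.1]
      exact mul_le_of_le_one_left (abs_nonneg _) ht.2
    calc |φ' (t * x)| * |x| ≤ C * |x| ^ k * |x| := by
          gcongr
          exact h1.trans (by gcongr)
      _ = _ := by ring
  have hmv : ∀ t ∈ Ioc (0 : ℝ) 1, |φ x - φ (t * x)| ≤ C * |x| ^ (k + 1) := by
    intro t ht
    have h1 := (convex_Ioc (0 : ℝ) 1).norm_image_sub_le_of_norm_hasDerivWithin_le hder hbd ht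
      (right_mem_Ioc.2 one_pos)
    simp only [one_mul, Real.norm_eq_abs] at h1
    refine h1.trans (mul_le_of_le_one_right (by positivity) ?_)
    rw [abs_of_nonneg (by linarith [ht.2])]
    linarith [ht.1]
  have hlim : Tendsto (fun t : ℝ => φ (t * x)) (𝓝[Ioc 0 1] 0) (𝓝 0) := by
    refine h0.comp (tendsto_nhdsWithin_iff.2 ⟨?_, eventually_nhdsWithin_of_forall (hstar x hx)⟩)
    have : Tendsto (fun t : ℝ => t * x) (𝓝 0) (𝓝 0) := by
      have hc : Continuous fun t : ℝ => t * x := by fun_prop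
      simpa using hc.tendsto 0
    exact this.mono_left nhdsWithin_le_nhds
  have hne : (𝓝[Ioc (0 : ℝ) 1] 0).NeBot := by
    rw [nhdsWithin_Ioc_eq_nhdsGT one_pos]; infer_instance
  have h2 := (hlim.const_sub (φ x)).abs
  rw [sub_zero] at h2
  exact le_of_tendsto h2 (eventually_nhdsWithin_of_forall hmv)

/-- `m` has a quadratic expansion at the cutoff on the side `S`, with intercept `a`. -/
def HasExpansion (m : ℝ → ℝ) (S : Set ℝ) (a : ℝ) : Prop :=
  ∃ b d C : ℝ, ∀ x ∈ S, |m x - (a + b * x + d * x ^ 2)| ≤ C * |x| ^ 3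

/-- The Lipschitz bound for the second derivative is integrated twice towards the cutoff, first for
the derivative and then for `μ`; the coefficients are the one-sided limits of the derivatives. -/
lemma LipschitzDerivs.exists_expansion {μ : ℝ → ℝ} {T S : Set ℝ} (hμ : LipschitzDerivs μ T)
    (hT : UniqueDiffOn ℝ T) (hST : S ⊆ T) (hS : IsOpen S)
    (hstar : ∀ x ∈ S, ∀ t ∈ Ioc (0 : ℝ) 1, t * x ∈ S) :
    ∃ a, Tendsto μ (𝓝[S] 0) (𝓝 a) ∧ HasExpansion μ S a := by
  obtain ⟨hC, hL⟩ := hμ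
  set D : ℕ → ℝ → ℝ := fun j => iteratedDerivWithin j μ T with hD
  have hder : ∀ j : ℕ, j < 3 → ∀ x ∈ S, HasDerivAt (D j) (D (j + 1) x) x := by
    intro j hj x hx
    have hn : T ∈ 𝓝 x := mem_of_superset (hS.mem_nhds hx) hST
    have h1 : DifferentiableAt ℝ (D j) x :=
      ((hC.differentiableOn_iteratedDerivWithin (by exact_mod_cast hj) hT) x
        (hST hx)).differentiableAt hn
    have h2 : D (j + 1) x = deriv (D j) x := by
      rw [hD]
      simp only
      rw [iteratedDerivWithin_succ, derivWithin_of_mem_nhds hn]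
    rw [h2]
    exact h1.hasDerivAt
  obtain ⟨L₀, hL₀⟩ := hL 0 (by norm_num)
  obtain ⟨L₁, hL₁⟩ := hL 1 (by norm_num)
  obtain ⟨L₂, hL₂⟩ := hL 2 (by norm_num)
  obtain ⟨l₀, hl₀, -⟩ := LipschitzOnWith.exists_tendsto_nhdsWithin (hL₀.mono hST) 0
  obtain ⟨l₁, hl₁, -⟩ := LipschitzOnWith.exists_tendsto_nhdsWithin (hL₁.mono hST) 0
  obtain ⟨l₂, hl₂, hb₂⟩ := LipschitzOnWith.exists_tendsto_nhdsWithin (hL₂.mono hST) 0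
  have hid : Tendsto (fun x : ℝ => x) (𝓝[S] 0) (𝓝 0) := tendsto_id.mono_left nhdsWithin_le_nhds
  have s1 := abs_le_of_hasDerivAt_of_tendsto_zero hstar
    (φ := fun x => D 1 x - (l₁ + l₂ * x)) (φ' := fun x => D 2 x - l₂) (C := L₂) (k := 1)
    (fun x hx => by
      have := (hder 1 (by norm_num) x hx).sub (((hasDerivAt_id x).const_mul l₂).const_add l₁)
      refine this.congr_deriv ?_
      simp) L₂.2
    (fun x hx => by simpa using hb₂ x hx)
    ((hl₁.sub ((hid.const_mul l₂).const_add l₁)).trans_eq (by simp))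
  have s2 := abs_le_of_hasDerivAt_of_tendsto_zero hstar
    (φ := fun x => D 0 x - (l₀ + l₁ * x + l₂ / 2 * x ^ 2))
    (φ' := fun x => D 1 x - (l₁ + l₂ * x)) (C := L₂) (k := 2)
    (fun x hx => by
      have := (hder 0 (by norm_num) x hx).sub ((((hasDerivAt_id x).const_mul l₁).const_add l₀).add
        ((hasDerivAt_pow 2 x).const_mul (l₂ / 2)))
      refine this.congr_deriv ?_
      simp
      ring) L₂.2 s1
    ((hl₀.sub (((hid.const_mul l₁).const_add l₀).add ((hid.pow 2).const_mul (l₂ / 2)))).trans_eq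
      (by simp))
  simp only [hD, iteratedDerivWithin_zero] at s2 hl₀
  exact ⟨l₀, hl₀, l₁, l₂ / 2, L₂, s2⟩

lemma mul_mem_Ioo_zero {b : ℝ} : ∀ x ∈ Ioo 0 b, ∀ t ∈ Ioc (0 : ℝ) 1, t * x ∈ Ioo 0 b :=
  fun _ hx _ ht => ⟨mul_pos ht.1 hx.1,
    (mul_le_of_le_one_left hx.1.le ht.2).trans_lt hx.2⟩

lemma mul_mem_Ioo_zero_left {b : ℝ} : ∀ x ∈ Ioo b 0, ∀ t ∈ Ioc (0 : ℝ) 1, t * x ∈ Ioo b 0 :=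
  fun x hx t ht => ⟨by nlinarith [hx.1, hx.2, ht.1, ht.2], mul_neg_of_pos_of_neg ht.1 hx.2⟩

lemma LipschitzDerivs.expansion_right {μ : ℝ → ℝ} {b : ℝ} (hb : 0 < b)
    (hμ : LipschitzDerivs μ (Ioc 0 b)) :
    Tendsto μ (𝓝[>] 0) (𝓝 (limR μ)) ∧ HasExpansion μ (Ioo 0 b) (limR μ) := by
  obtain ⟨a, h1, h2⟩ := hμ.exists_expansion (uniqueDiffOn_Ioc 0 b) Ioo_subset_Ioc_self isOpen_Ioo
    mul_mem_Ioo_zero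
  rw [nhdsWithin_Ioo_eq_nhdsGT hb] at h1
  have : limR μ = a := h1.limUnder_eq
  rw [this]
  exact ⟨h1, h2⟩

lemma LipschitzDerivs.expansion_left {μ : ℝ → ℝ} {b : ℝ} (hb : b < 0)
    (hμ : LipschitzDerivs μ (Ico b 0)) :
    Tendsto μ (𝓝[<] 0) (𝓝 (limL μ)) ∧ HasExpansion μ (Ioo b 0) (limL μ) := by
  obtain ⟨a, h1, h2⟩ := hμ.exists_expansion (uniqueDiffOn_Ico b 0) Ioo_subset_Ico_self isOpen_Ioo
    mul_mem_Ioo_zero_left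
  rw [nhdsWithin_Ioo_eq_nhdsLT hb] at h1
  have : limL μ = a := h1.limUnder_eq
  rw [this]
  exact ⟨h1, h2⟩

/-- A bounded derivative on a convex side makes `v` Lipschitz there. Existence of the limit is what
gives `limR` and `limL`, defined by `limUnder`, their meaning. -/
lemma exists_tendsto_of_abs_derivWithin_le {v : ℝ → ℝ} {T S : Set ℝ} (hv : C1BddDeriv v T)
    (hST : S ⊆ T) (hS : IsOpen S) (hconv : Convex ℝ S) : ∃ l, Tendsto v (𝓝[S] 0) (𝓝 l) := by
  obtain ⟨hC, B, hB⟩ := hv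
  have hL : LipschitzOnWith (Real.toNNReal B) v S := by
    refine hconv.lipschitzOnWith_of_nnnorm_derivWithin_le
      ((hC.mono hST).differentiableOn (by norm_num)) fun x hx => ?_
    have h1 : derivWithin v S x = derivWithin v T x := by
      rw [derivWithin_of_mem_nhds (hS.mem_nhds hx),
        derivWithin_of_mem_nhds (mem_of_superset (hS.mem_nhds hx) hST)]
    rw [h1, ← NNReal.coe_le_coe, coe_nnnorm, Real.norm_eq_abs]
    exact (hB x (hST hx)).trans (Real.le_coe_toNNReal B)
  obtain ⟨l, hl, -⟩ := LipschitzOnWith.exists_tendsto_nhdsWithin hL 0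
  exact ⟨l, hl⟩

lemma C1BddDeriv.tendsto_limR {v : ℝ → ℝ} {a b : ℝ} (ha : a < 0) (hb : 0 < b)
    (hv : C1BddDeriv v (Icc a b \ {0})) : Tendsto v (𝓝[>] 0) (𝓝 (limR v)) := by
  obtain ⟨l, hl⟩ := exists_tendsto_of_abs_derivWithin_le hv (S := Ioo 0 b)
    (fun x hx => ⟨⟨by linarith [hx.1], hx.2.le⟩, hx.1.ne'⟩) isOpen_Ioo (convex_Ioo 0 b)
  rw [nhdsWithin_Ioo_eq_nhdsGT hb] at hl
  have : limR v = l := hl.limUnder_eq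
  rwa [this]

lemma C1BddDeriv.tendsto_limL {v : ℝ → ℝ} {a b : ℝ} (ha : a < 0) (hb : 0 < b)
    (hv : C1BddDeriv v (Icc a b \ {0})) : Tendsto v (𝓝[<] 0) (𝓝 (limL v)) := by
  obtain ⟨l, hl⟩ := exists_tendsto_of_abs_derivWithin_le hv (S := Ioo a 0)
    (fun x hx => ⟨⟨hx.1.le, by linarith [hx.2]⟩, hx.2.ne⟩) isOpen_Ioo (convex_Ioo a 0)
  rw [nhdsWithin_Ioo_eq_nhdsLT ha] at hl
  have : limL v = l := hl.limUnder_eq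
  rwa [this]

lemma LipschitzDerivs.measurable_indicator {μ : ℝ → ℝ} {T : Set ℝ} (hμ : LipschitzDerivs μ T)
    (hT : MeasurableSet T) : Measurable (T.indicator μ) := by
  classical
  rw [← piecewise_eq_indicator]
  exact hμ.1.continuousOn.measurable_piecewise continuousOn_const hT

lemma LipschitzDerivs.exists_abs_le {μ : ℝ → ℝ} {T : Set ℝ} (hμ : LipschitzDerivs μ T)
    {r : ℝ} (hr : ∀ x ∈ T, |x| ≤ r) : ∃ B, ∀ x ∈ T, |μ x| ≤ B := by
  obtain ⟨L, hL⟩ := hμ.2 0 (by norm_num)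
  rw [iteratedDerivWithin_zero] at hL
  obtain ⟨l, -, hl⟩ := LipschitzOnWith.exists_tendsto_nhdsWithin hL 0
  refine ⟨|l| + L * r, fun x hx => ?_⟩
  have h1 := hl x hx
  rw [sub_zero] at h1
  have h2 : (L : ℝ) * |x| ≤ L * r := mul_le_mul_of_nonneg_left (hr x hx) L.2
  linarith [abs_sub_abs_le_abs_sub (μ x) l]

variable {Ω : Type*} [MeasurableSpace Ω] {P : Measure Ω}

/-! ### Local sums -/

lemma memLp_two_of_integrable_rpow [IsFiniteMeasure P] {W : Ω → ℝ} (hW : AEStronglyMeasurable W P)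
    {ε : ℝ} (hε : 0 < ε) (hi : Integrable (fun ω => |W ω| ^ (2 + ε)) P) : MemLp W 2 P := by
  refine (memLp_two_iff_integrable_sq hW).2 ?_
  refine (hi.add (integrable_const (1 : ℝ))).mono' (hW.pow 2) (ae_of_all _ fun ω => ?_)
  have h0 : 0 ≤ |W ω| ^ (2 + ε) := Real.rpow_nonneg (abs_nonneg _) _
  rw [Real.norm_eq_abs, abs_of_nonneg (sq_nonneg _), Pi.add_apply, ← sq_abs]
  rcases le_total |W ω| 1 with h | h
  · have : |W ω| ^ 2 ≤ 1 := pow_le_one₀ (abs_nonneg _) h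
    linarith
  · have : |W ω| ^ (2 : ℝ) ≤ |W ω| ^ (2 + ε) := Real.rpow_le_rpow_of_exponent_le h (by linarith)
    rw [Real.rpow_two] at this
    linarith

namespace IsIIDSample

variable [IsProbabilityMeasure P] {α : Type*} [MeasurableSpace α] {V : ℕ → Ω → α} {U : Ω → α}
  {h : ℕ → ℝ}

/-- Law of large numbers for kernel sums with bounded summands. -/
lemma tendsto_sum_local {X : Ω → ℝ} {Xs : ℕ → Ω → ℝ} {f : ℝ → ℝ}
    (hV : IsIIDSample P Xs (P.map X)) (hX : HasLocalDensity P X f) (h_pos : ∀ n, 0 < h n)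
    (h_lim : Tendsto h atTop (𝓝 0)) (hnh : Tendsto (fun n : ℕ => n * h n) atTop atTop)
    {g : ℝ → ℝ} (hg : IsLocal g) :
    Tendsto (fun x : ℕ × Ω => ∑ i ∈ Finset.range x.1, (x.1 * h x.1)⁻¹ * g (Xs i x.2 / h x.1))
      (inProb P) (𝓝 (f 0 * ∫ u, g u)) := by
  obtain ⟨B, hB0, hB⟩ := hg.exists_pos_bdd
  have hm : ∀ n : ℕ, Measurable fun x : ℝ => (n * h n)⁻¹ * g (x / h n) := fun n =>
    (hg.measurable.comp (measurable_id.div_const _)).const_mul _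
  have hbd : ∀ (n : ℕ) (x : ℝ), |(n * h n)⁻¹ * g (x / h n)| ≤ (n * h n)⁻¹ * B := by
    intro n x
    have := h_pos n
    rw [abs_mul, abs_of_nonneg (by positivity : 0 ≤ (n * h n)⁻¹)]
    gcongr
    exact hB _
  have hscale : ∀ k : ℝ → ℝ, Measurable k → ∀ n : ℕ, n ≠ 0 →
      (n : ℝ) * ∫ x, (n * h n)⁻¹ * k (x / h n) ∂(P.map X) = (h n)⁻¹ * ∫ ω, k (X ω / h n) ∂P := by
    intro k hk n hn
    have hk' : Measurable fun x => k (x / h n) := hk.comp (measurable_id.div_const _)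
    rw [integral_const_mul, integral_map hX.measurable.aemeasurable hk'.aestronglyMeasurable]
    have := (h_pos n).ne'
    field_simp
  have hP := hV.isProbabilityMeasure
  refine hV.tendsto_sum (ψ := fun n x => (n * h n)⁻¹ * g (x / h n))
    (C := f 0 * (∫ u, |g u|) + 1) hm ?_ ?_ ?_ ?_
  · exact Eventually.of_forall fun n => Integrable.of_bound (hm n).aestronglyMeasurable _
      (ae_of_all _ fun x => hbd n x)
  · refine (hX.tendsto_integral_local h_pos h_lim hg).congr' ?_
    filter_upwards [eventually_ne_atTop 0] with n hn
    exact (hscale g hg.measurable n hn).symm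
  · filter_upwards [eventually_ne_atTop 0, Metric.tendsto_nhds.1
      (hX.tendsto_integral_local h_pos h_lim hg.abs) 1 one_pos] with n hn h1
    have h2 := hscale _ hg.abs.measurable n hn
    have h3 : ∀ x, |(n * h n)⁻¹ * g (x / h n)| = (n * h n)⁻¹ * |g (x / h n)| := fun x => by
      have := h_pos n
      rw [abs_mul, abs_of_nonneg (by positivity : 0 ≤ (n * h n)⁻¹)]
    simp_rw [h3]
    rw [h2]
    rw [Real.dist_eq] at h1
    linarith [(abs_lt.1 h1).2]
  · intro η hη
    have h1 : Tendsto (fun n : ℕ => (n * h n)⁻¹ * B) atTop (𝓝 0) := by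
      simpa using (tendsto_inv_atTop_zero.comp hnh).mul_const B
    refine tendsto_const_nhds.congr' ?_
    filter_upwards [Metric.tendsto_nhds.1 h1 η hη] with n hn
    rw [dist_zero_right, Real.norm_eq_abs] at hn
    -- The summands are at most `B / (n h) → 0`, so the Lindeberg set is eventually empty.
    have : {x : ℝ | η < |(n * h n)⁻¹ * g (x / h n)|} = ∅ := by
      ext x
      simp only [mem_ofPred_eq, mem_empty_iff_false, iff_false, not_lt]
      exact (hbd n x).trans ((le_abs_self _).trans hn.le)
    rw [this]
    simp

section Lyapunov

variable {R : ℕ → α → ℝ} {ε C v : ℝ}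

/-- Lyapunov implies Lindeberg: where `|R| > η √(n h)` one has `R² ≤ (η √(n h))^(-ε) |R|^(2 + ε)`.
The factor `1 / √(n h)` turns `n` times a second moment into `h⁻¹` times one, which is the natural
size of a localised integral. -/
lemma scaled_moments (hU : Measurable U) (h_pos : ∀ n, 0 < h n)
    (hnh : Tendsto (fun n : ℕ => n * h n) atTop atTop) (hR : ∀ n, Measurable (R n)) (hε : 0 < ε)
    (hmom : ∀ᶠ n in atTop, Integrable (fun ω => |R n (U ω)| ^ (2 + ε)) P ∧
      (h n)⁻¹ * ∫ ω, |R n (U ω)| ^ (2 + ε) ∂P ≤ C)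
    (hv : Tendsto (fun n => (h n)⁻¹ * ∫ ω, R n (U ω) ^ 2 ∂P) atTop (𝓝 v)) :
    (∀ᶠ n : ℕ in atTop, MemLp (fun a => (Real.sqrt (n * h n))⁻¹ * R n a) 2 (P.map U)) ∧
    Tendsto (fun n : ℕ => n * ∫ a, ((Real.sqrt (n * h n))⁻¹ * R n a) ^ 2 ∂(P.map U)) atTop (𝓝 v) ∧
    ∀ η : ℝ, 0 < η → Tendsto (fun n : ℕ =>
      n * ∫ a in {a | η < |(Real.sqrt (n * h n))⁻¹ * R n a|},
        ((Real.sqrt (n * h n))⁻¹ * R n a) ^ 2 ∂(P.map U)) atTop (𝓝 0) := by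
  have hmem : ∀ᶠ n in atTop, MemLp (fun ω => R n (U ω)) 2 P := by
    filter_upwards [hmom] with n hn
    exact memLp_two_of_integrable_rpow ((hR n).comp hU).aestronglyMeasurable hε hn.1
  have hsq : ∀ n : ℕ, ∀ a, ((Real.sqrt (n * h n))⁻¹ * R n a) ^ 2 = (n * h n)⁻¹ * R n a ^ 2 := by
    intro n a
    have := h_pos n
    rw [mul_pow, inv_pow, Real.sq_sqrt (by positivity)]
  refine ⟨?_, ?_, ?_⟩
  · filter_upwards [hmem] with n hn
    refine MemLp.const_mul ?_ _
    exact (memLp_map_measure_iff (hR n).aestronglyMeasurable hU.aemeasurable).2 hn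
  · refine hv.congr' ?_
    filter_upwards [eventually_ne_atTop 0] with n hn
    simp_rw [hsq]
    rw [integral_const_mul, integral_map hU.aemeasurable
      ((hR n).pow_const 2).aestronglyMeasurable]
    have := (h_pos n).ne'
    field_simp
  · intro η hη
    have hlim : Tendsto (fun n : ℕ => (η * Real.sqrt (n * h n)) ^ (-ε) * C) atTop (𝓝 0) := by
      have h1 : Tendsto (fun n : ℕ => η * Real.sqrt (n * h n)) atTop atTop :=
        (Real.tendsto_sqrt_atTop.comp hnh).const_mul_atTop hη
      simpa using ((tendsto_rpow_neg_atTop hε).comp h1).mul_const C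
    refine squeeze_zero' (Eventually.of_forall fun n => ?_) ?_ hlim
    · exact mul_nonneg (Nat.cast_nonneg n) (integral_nonneg fun a => sq_nonneg _)
    · filter_upwards [hmom, eventually_ne_atTop 0] with n hn hn0
      have hnpos : (0 : ℝ) < n := by exact_mod_cast Nat.pos_of_ne_zero hn0
      have hh := h_pos n
      have hs : 0 < Real.sqrt (n * h n) := Real.sqrt_pos.2 (by positivity)
      set S := {a | η < |(Real.sqrt (n * h n))⁻¹ * R n a|} with hSdef
      have hS : MeasurableSet S := measurableSet_lt measurable_const ((hR n).const_mul _).abs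
      have hpt : ∀ ω, (U ⁻¹' S).indicator (fun ω => R n (U ω) ^ 2) ω ≤
          (η * Real.sqrt (n * h n)) ^ (-ε) * |R n (U ω)| ^ (2 + ε) := by
        intro ω
        have h0 : 0 ≤ |R n (U ω)| ^ (2 + ε) := Real.rpow_nonneg (abs_nonneg _) _
        have h1 : 0 < η * Real.sqrt (n * h n) := by positivity
        by_cases hω : ω ∈ U ⁻¹' S
        · rw [indicator_of_mem hω]
          have h2 : η < |(Real.sqrt (n * h n))⁻¹ * R n (U ω)| := hω
          rw [abs_mul, abs_inv, abs_of_pos hs, inv_mul_eq_div, lt_div_iff₀ hs] at h2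
          have h3 : 0 < |R n (U ω)| := h1.trans h2
          rw [Real.rpow_add h3, Real.rpow_two, sq_abs, Real.rpow_neg h1.le, inv_mul_eq_div,
            le_div_iff₀ (Real.rpow_pos_of_pos h1 _)]
          gcongr
        · rw [indicator_of_notMem hω]
          exact mul_nonneg (Real.rpow_nonneg h1.le _) h0
      simp_rw [hsq]
      rw [integral_const_mul, setIntegral_map hS ((hR n).pow_const 2).aestronglyMeasurable
        hU.aemeasurable, ← integral_indicator (hU hS)]
      have hle := integral_mono_of_nonneg (μ := P)
        (ae_of_all _ fun ω => indicator_nonneg (fun ω _ => sq_nonneg (R n (U ω))) ω)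
        (hn.1.const_mul ((η * Real.sqrt (n * h n)) ^ (-ε))) (ae_of_all _ hpt)
      rw [integral_const_mul] at hle
      calc (n : ℝ) * ((n * h n)⁻¹ * ∫ ω, (U ⁻¹' S).indicator (fun ω => R n (U ω) ^ 2) ω ∂P)
          = (h n)⁻¹ * ∫ ω, (U ⁻¹' S).indicator (fun ω => R n (U ω) ^ 2) ω ∂P := by
            field_simp
        _ ≤ (h n)⁻¹ * ((η * Real.sqrt (n * h n)) ^ (-ε) * ∫ ω, |R n (U ω)| ^ (2 + ε) ∂P) := by
            gcongr
        _ = (η * Real.sqrt (n * h n)) ^ (-ε) * ((h n)⁻¹ * ∫ ω, |R n (U ω)| ^ (2 + ε) ∂P) := by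
            ring
        _ ≤ _ := by
            gcongr
            exact hn.2

/-- The weak law applied to squares: its truncation condition at level `η` is the Lindeberg
condition at level `√η`. -/
lemma tendsto_sum_sq_scaled (hV : IsIIDSample P V (P.map U)) (hU : Measurable U)
    (h_pos : ∀ n, 0 < h n)
    (hnh : Tendsto (fun n : ℕ => n * h n) atTop atTop) (hR : ∀ n, Measurable (R n)) (hε : 0 < ε)
    (hmom : ∀ᶠ n in atTop, Integrable (fun ω => |R n (U ω)| ^ (2 + ε)) P ∧
      (h n)⁻¹ * ∫ ω, |R n (U ω)| ^ (2 + ε) ∂P ≤ C)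
    (hv : Tendsto (fun n => (h n)⁻¹ * ∫ ω, R n (U ω) ^ 2 ∂P) atTop (𝓝 v)) :
    Tendsto (fun x : ℕ × Ω => ∑ i ∈ Finset.range x.1,
      ((Real.sqrt (x.1 * h x.1))⁻¹ * R x.1 (V i x.2)) ^ 2) (inProb P) (𝓝 v) := by
  obtain ⟨h1, h2, h3⟩ := scaled_moments hU h_pos hnh hR hε hmom hv
  refine hV.tendsto_sum (ψ := fun n a => ((Real.sqrt (n * h n))⁻¹ * R n a) ^ 2) (C := v + 1)
    (fun n => ((hR n).const_mul _).pow_const 2) ?_ h2 ?_ ?_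
  · filter_upwards [h1] with n hn using hn.integrable_sq
  · filter_upwards [Metric.tendsto_nhds.1 h2 1 one_pos] with n hn
    simp_rw [abs_sq]
    rw [Real.dist_eq] at hn
    linarith [(abs_lt.1 hn).2]
  · intro η hη
    refine (h3 (Real.sqrt η) (Real.sqrt_pos.2 hη)).congr fun n => ?_
    have : {a | Real.sqrt η < |(Real.sqrt (n * h n))⁻¹ * R n a|} =
        {a | η < |((Real.sqrt (n * h n))⁻¹ * R n a) ^ 2|} := by
      ext a
      simp only [mem_ofPred_eq]
      rw [← Real.sqrt_sq_eq_abs, Real.sqrt_lt_sqrt_iff hη.le, abs_sq]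
    rw [this]
    simp_rw [abs_sq]

lemma tendstoInDistribution_sum_scaled (hV : IsIIDSample P V (P.map U)) (hU : Measurable U)
    (h_pos : ∀ n, 0 < h n)
    (hnh : Tendsto (fun n : ℕ => n * h n) atTop atTop) (hR : ∀ n, Measurable (R n)) (hε : 0 < ε)
    (hmom : ∀ᶠ n in atTop, Integrable (fun ω => |R n (U ω)| ^ (2 + ε)) P ∧
      (h n)⁻¹ * ∫ ω, |R n (U ω)| ^ (2 + ε) ∂P ≤ C) {s : ℝ≥0}
    (hv : Tendsto (fun n => (h n)⁻¹ * ∫ ω, R n (U ω) ^ 2 ∂P) atTop (𝓝 s))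
    (h0 : ∀ᶠ n in atTop, ∫ ω, R n (U ω) ∂P = 0) :
    TendstoInDistribution (fun (n : ℕ) ω => ∑ i ∈ Finset.range n,
      (Real.sqrt (n * h n))⁻¹ * R n (V i ω)) atTop (id : ℝ → ℝ)
      (fun _ => P) (gaussianReal 0 s) := by
  obtain ⟨h1, h2, h3⟩ := scaled_moments hU h_pos hnh hR hε hmom hv
  refine hV.tendstoInDistribution_sum (ψ := fun n a => (Real.sqrt (n * h n))⁻¹ * R n a)
    (fun n => (hR n).const_mul _) h1 ?_ h2 h3
  filter_upwards [h0] with n hn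
  rw [integral_const_mul, integral_map hU.aemeasurable (hR n).aestronglyMeasurable, hn, mul_zero]

lemma bddInProb_sum_scaled (hV : IsIIDSample P V (P.map U)) (hU : Measurable U)
    (h_pos : ∀ n, 0 < h n) (hR : ∀ n, Measurable (R n))
    (hmom : ∀ᶠ n in atTop, MemLp (fun ω => R n (U ω)) 2 P ∧
      (h n)⁻¹ * ∫ ω, R n (U ω) ^ 2 ∂P ≤ C)
    (h0 : ∀ᶠ n in atTop, ∫ ω, R n (U ω) ∂P = 0) :
    BddInProb P (fun x : ℕ × Ω => ∑ i ∈ Finset.range x.1,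
      (Real.sqrt (x.1 * h x.1))⁻¹ * R x.1 (V i x.2)) := by
  refine hV.bddInProb_sum (ψ := fun n a => (Real.sqrt (n * h n))⁻¹ * R n a) (C := C)
    (fun n => (hR n).const_mul _) ?_ ?_ ?_
  · filter_upwards [hmom] with n hn
    exact ((memLp_map_measure_iff (hR n).aestronglyMeasurable hU.aemeasurable).2 hn.1).const_mul _
  · filter_upwards [h0] with n hn
    rw [integral_const_mul, integral_map hU.aemeasurable (hR n).aestronglyMeasurable, hn, mul_zero]
  · filter_upwards [hmom, eventually_ne_atTop 0] with n hn hn0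
    refine le_trans (le_of_eq ?_) hn.2
    have hh := h_pos n
    simp_rw [mul_pow, inv_pow, Real.sq_sqrt (by positivity : (0 : ℝ) ≤ n * h n)]
    rw [integral_const_mul, integral_map hU.aemeasurable
      ((hR n).pow_const 2).aestronglyMeasurable]
    have := hh.ne'
    field_simp

end Lyapunov

end IsIIDSample

variable {Ω : Type*} [MeasurableSpace Ω] {P : Measure Ω}

/-! ### Responses with bounded local moments -/

/-- `m` is a bounded measurable version of the regression function of `Z` on `X` over
`[xl, xu]`, and the conditional moment of `Z` of order `2 + ε` is bounded there. -/
structure Response (P : Measure Ω) (X Z : Ω → ℝ) (xl xu ε : ℝ) (m : ℝ → ℝ) : Prop where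
  measurable_response : Measurable Z
  measurable_mean : Measurable m
  bdd_mean : ∃ B, ∀ x, |m x| ≤ B
  condMean : IsCondMeanOn P X Z (Icc xl xu) m
  exponent_pos : 0 < ε
  moment : ∃ q : ℝ → ℝ, ∃ M, IsCondMeanOn P X (fun ω => |Z ω| ^ (2 + ε)) (Icc xl xu) q ∧
    ∀ x ∈ Icc xl xu \ {0}, q x ≤ M

lemma abs_add_rpow_le (a b : ℝ) {r : ℝ} (hr : 0 ≤ r) :
    |a + b| ^ r ≤ 2 ^ r * (|a| ^ r + |b| ^ r) := by
  have h1 : |a + b| ≤ 2 * max |a| |b| :=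
    (abs_add_le a b).trans (by linarith [le_max_left |a| |b|, le_max_right |a| |b|])
  have h2 : |a + b| ^ r ≤ (2 * max |a| |b|) ^ r := Real.rpow_le_rpow (abs_nonneg _) h1 hr
  rw [Real.mul_rpow zero_le_two (le_max_of_le_left (abs_nonneg a))] at h2
  refine h2.trans (mul_le_mul_of_nonneg_left ?_ (Real.rpow_nonneg zero_le_two _))
  have ha : 0 ≤ |a| ^ r := Real.rpow_nonneg (abs_nonneg _) _
  have hb : 0 ≤ |b| ^ r := Real.rpow_nonneg (abs_nonneg _) _
  rcases max_cases |a| |b| with h | h <;> rw [h.1] <;> linarith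

namespace Response

variable [IsProbabilityMeasure P] {X Z : Ω → ℝ} {f m : ℝ → ℝ} {xl xu ε : ℝ} {h : ℕ → ℝ}

lemma integral_resid_eq_zero (hZ : Response P X Z xl xu ε m) (hX : HasLocalDensity P X f)
    (hxl : xl < 0) (hxu : 0 < xu) (h_pos : ∀ n, 0 < h n) (h_lim : Tendsto h atTop (𝓝 0))
    {g : ℝ → ℝ} (hg : IsLocal g) :
    ∀ᶠ n in atTop, Integrable (fun ω => g (X ω / h n) * (Z ω - m (X ω))) P ∧
      ∫ ω, g (X ω / h n) * (Z ω - m (X ω)) ∂P = 0 := by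
  obtain ⟨B, hB0, hB⟩ := hg.exists_pos_bdd
  filter_upwards [hg.eventually_supp h_pos h_lim (Icc_mem_nhds hxl hxu)] with n hn
  obtain ⟨i1, i2, he⟩ := hZ.condMean.integral_mul hX.measurable measurableSet_Icc
    (φ := fun x => g (x / h n)) (hg.measurable.comp (measurable_id.div_const _)) (fun x => hB _) hn
  simp_rw [mul_sub]
  exact ⟨i1.sub i2, by rw [integral_sub i1 i2, he, sub_self]⟩

lemma moment_resid_le (hZ : Response P X Z xl xu ε m) (hX : HasLocalDensity P X f)
    (hxl : xl < 0) (hxu : 0 < xu) (h_pos : ∀ n, 0 < h n) (h_lim : Tendsto h atTop (𝓝 0))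
    {g : ℝ → ℝ} (hg : IsLocal g) :
    ∃ C, ∀ᶠ n in atTop, Integrable (fun ω => |g (X ω / h n)| * |Z ω - m (X ω)| ^ (2 + ε)) P ∧
      (h n)⁻¹ * ∫ ω, |g (X ω / h n)| * |Z ω - m (X ω)| ^ (2 + ε) ∂P ≤ C := by
  have hε := hZ.exponent_pos
  obtain ⟨q, M, hq, hM⟩ := hZ.moment
  obtain ⟨B, hB⟩ := hZ.bdd_mean
  obtain ⟨C, hC⟩ := hq.exists_integral_local_le hX hxl hxu h_pos h_lim hM hg
  refine ⟨2 ^ (2 + ε) * (C + |B| ^ (2 + ε) * (f 0 * (∫ u, |g u|) + 1)), ?_⟩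
  filter_upwards [hC, Metric.tendsto_nhds.1 (hX.tendsto_integral_local h_pos h_lim hg.abs) 1
    one_pos] with n hn hn1
  rw [Real.dist_eq] at hn1
  have hgi := hX.integrable_comp hg.abs (h n)
  have hpt : ∀ ω, |g (X ω / h n)| * |Z ω - m (X ω)| ^ (2 + ε) ≤
      2 ^ (2 + ε) * (|g (X ω / h n)| * |Z ω| ^ (2 + ε) + |B| ^ (2 + ε) * |g (X ω / h n)|) := by
    intro ω
    have h1 := abs_add_rpow_le (Z ω) (-m (X ω)) (r := 2 + ε) (by positivity)
    rw [abs_neg, ← sub_eq_add_neg] at h1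
    have h2 : |m (X ω)| ^ (2 + ε) ≤ |B| ^ (2 + ε) :=
      Real.rpow_le_rpow (abs_nonneg _) ((hB _).trans (le_abs_self B)) (by positivity)
    have h3 : (0 : ℝ) ≤ 2 ^ (2 + ε) := Real.rpow_nonneg zero_le_two _
    calc |g (X ω / h n)| * |Z ω - m (X ω)| ^ (2 + ε)
        ≤ |g (X ω / h n)| * (2 ^ (2 + ε) * (|Z ω| ^ (2 + ε) + |B| ^ (2 + ε))) := by
          gcongr
          exact h1.trans (by gcongr)
      _ = _ := by ring
  have hdom := (hn.1.add (hgi.const_mul (|B| ^ (2 + ε)))).const_mul ((2 : ℝ) ^ (2 + ε))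
  have hint : Integrable (fun ω => |g (X ω / h n)| * |Z ω - m (X ω)| ^ (2 + ε)) P := by
    refine hdom.mono' ?_ (ae_of_all _ fun ω => ?_)
    · have h1 := hg.measurable
      have h2 := hX.measurable
      have h3 := hZ.measurable_response
      have h4 := hZ.measurable_mean
      exact Measurable.aestronglyMeasurable (by fun_prop)
    · rw [Real.norm_eq_abs, abs_of_nonneg
        (mul_nonneg (abs_nonneg _) (Real.rpow_nonneg (abs_nonneg _) _))]
      exact hpt ω
  refine ⟨hint, ?_⟩
  have hle := integral_mono hint hdom hpt
  simp only [Pi.add_apply] at hle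
  rw [integral_const_mul, integral_add hn.1 (hgi.const_mul _), integral_const_mul] at hle
  have := h_pos n
  have hB2 : 0 ≤ |B| ^ (2 + ε) := Real.rpow_nonneg (abs_nonneg _) _
  have h3 : (0 : ℝ) ≤ 2 ^ (2 + ε) := Real.rpow_nonneg zero_le_two _
  calc (h n)⁻¹ * ∫ ω, |g (X ω / h n)| * |Z ω - m (X ω)| ^ (2 + ε) ∂P
      ≤ (h n)⁻¹ * _ := mul_le_mul_of_nonneg_left hle (by positivity)
    _ = 2 ^ (2 + ε) * ((h n)⁻¹ * (∫ ω, |g (X ω / h n)| * |Z ω| ^ (2 + ε) ∂P)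
        + |B| ^ (2 + ε) * ((h n)⁻¹ * ∫ ω, |g (X ω / h n)| ∂P)) := by ring
    _ ≤ _ := by
        gcongr
        · exact hn.2
        · linarith [(abs_lt.1 hn1).2]

lemma moment_local_resid_le (hZ : Response P X Z xl xu ε m) (hX : HasLocalDensity P X f)
    (hxl : xl < 0) (hxu : 0 < xu) (h_pos : ∀ n, 0 < h n) (h_lim : Tendsto h atTop (𝓝 0))
    {g : ℝ → ℝ} (hg : IsLocal g) :
    ∃ C, ∀ᶠ n in atTop, Integrable (fun ω => |g (X ω / h n) * (Z ω - m (X ω))| ^ (2 + ε)) P ∧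
      (h n)⁻¹ * ∫ ω, |g (X ω / h n) * (Z ω - m (X ω))| ^ (2 + ε) ∂P ≤ C := by
  have hε := hZ.exponent_pos
  have hgl : IsLocal fun u => |g u| ^ (2 + ε) := by
    refine ⟨hg.measurable.abs.pow_const _, ?_, ?_⟩
    · obtain ⟨B, hB⟩ := hg.bdd
      refine ⟨B ^ (2 + ε), fun u => ?_⟩
      rw [abs_of_nonneg (Real.rpow_nonneg (abs_nonneg _) _)]
      exact Real.rpow_le_rpow (abs_nonneg _) (hB u) (by positivity)
    · obtain ⟨c, hc⟩ := hg.supp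
      exact ⟨c, fun u hu => by
        rw [hc u hu, abs_zero, Real.zero_rpow (by positivity)]⟩
  obtain ⟨C, hC⟩ := hZ.moment_resid_le hX hxl hxu h_pos h_lim hgl
  refine ⟨C, ?_⟩
  filter_upwards [hC] with n hn
  have : ∀ ω, |g (X ω / h n) * (Z ω - m (X ω))| ^ (2 + ε) =
      |(|g (X ω / h n)| ^ (2 + ε))| * |Z ω - m (X ω)| ^ (2 + ε) := by
    intro ω
    rw [abs_mul, Real.mul_rpow (abs_nonneg _) (abs_nonneg _),
      abs_of_nonneg (Real.rpow_nonneg (abs_nonneg (g (X ω / h n))) _)]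
  simp_rw [this]
  exact hn

/-- From `y² ≤ 1 + |y|^(2 + ε)`, so boundedness of the score terms requires only the moment
condition and no limit of the conditional variance. -/
lemma sq_local_resid_le (hZ : Response P X Z xl xu ε m) (hX : HasLocalDensity P X f)
    (hxl : xl < 0) (hxu : 0 < xu) (h_pos : ∀ n, 0 < h n) (h_lim : Tendsto h atTop (𝓝 0))
    {g : ℝ → ℝ} (hg : IsLocal g) :
    ∃ C, ∀ᶠ n in atTop, MemLp (fun ω => g (X ω / h n) * (Z ω - m (X ω))) 2 P ∧
      (h n)⁻¹ * ∫ ω, (g (X ω / h n) * (Z ω - m (X ω))) ^ 2 ∂P ≤ C := by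
  have hε := hZ.exponent_pos
  obtain ⟨C, hC⟩ := hZ.moment_resid_le hX hxl hxu h_pos h_lim hg.sq
  obtain ⟨C', hC'⟩ := hZ.moment_local_resid_le hX hxl hxu h_pos h_lim hg
  refine ⟨f 0 * (∫ u, g u ^ 2) + 1 + C, ?_⟩
  filter_upwards [hC, hC', Metric.tendsto_nhds.1 (hX.tendsto_integral_local h_pos h_lim hg.sq) 1
    one_pos] with n hn hn' hn1
  rw [Real.dist_eq] at hn1
  have hmeas : Measurable fun ω => g (X ω / h n) * (Z ω - m (X ω)) := by
    have h1 := hg.measurable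
    have h2 := hX.measurable
    have h3 := hZ.measurable_response
    have h4 := hZ.measurable_mean
    fun_prop
  have hmem := memLp_two_of_integrable_rpow hmeas.aestronglyMeasurable hε hn'.1
  refine ⟨hmem, ?_⟩
  have hgi := hX.integrable_comp hg.sq (h n)
  have hpt : ∀ ω, (g (X ω / h n) * (Z ω - m (X ω))) ^ 2 ≤
      g (X ω / h n) ^ 2 + |g (X ω / h n) ^ 2| * |Z ω - m (X ω)| ^ (2 + ε) := by
    intro ω
    have h0 : 0 ≤ |Z ω - m (X ω)| ^ (2 + ε) := Real.rpow_nonneg (abs_nonneg _) _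
    have h1 : (Z ω - m (X ω)) ^ 2 ≤ 1 + |Z ω - m (X ω)| ^ (2 + ε) := by
      rw [← sq_abs]
      rcases le_total |Z ω - m (X ω)| 1 with h | h
      · have : |Z ω - m (X ω)| ^ 2 ≤ 1 := pow_le_one₀ (abs_nonneg _) h
        linarith
      · have : |Z ω - m (X ω)| ^ (2 : ℝ) ≤ |Z ω - m (X ω)| ^ (2 + ε) :=
          Real.rpow_le_rpow_of_exponent_le h (by linarith)
        rw [Real.rpow_two] at this
        linarith
    rw [mul_pow, abs_sq]
    nlinarith [sq_nonneg (g (X ω / h n))]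
  have hle := integral_mono hmem.integrable_sq (hgi.add hn.1) hpt
  simp only [Pi.add_apply] at hle
  rw [integral_add hgi hn.1] at hle
  have := h_pos n
  calc (h n)⁻¹ * ∫ ω, (g (X ω / h n) * (Z ω - m (X ω))) ^ 2 ∂P
      ≤ (h n)⁻¹ * _ := mul_le_mul_of_nonneg_left hle (by positivity)
    _ = (h n)⁻¹ * (∫ ω, g (X ω / h n) ^ 2 ∂P) +
        (h n)⁻¹ * ∫ ω, |g (X ω / h n) ^ 2| * |Z ω - m (X ω)| ^ (2 + ε) ∂P := by ring
    _ ≤ _ := by linarith [(abs_lt.1 hn1).2, hn.2]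

end Response

/-! ### Linear systems with random coefficients -/

/-- Write `Δ = G⁻¹ T + G⁻¹ r - E Δ` with `E = G⁻¹ M - 1 → 0`. Once the entries of `E` sum to at most
`1 / 2` in absolute value, the last term is absorbed and `Δ` is bounded; then `E Δ → 0`. The random
matrix `M` is never inverted. -/
lemma solve_inProb {d : ℕ} {G : Matrix (Fin d) (Fin d) ℝ} (hG : IsUnit G.det)
    {M : ℕ × Ω → Matrix (Fin d) (Fin d) ℝ}
    (hM : ∀ j k, Tendsto (fun x => M x j k) (inProb P) (𝓝 (G j k)))
    {Δ T r : ℕ × Ω → Fin d → ℝ} (heq : ∀ᶠ x in inProb P, M x *ᵥ Δ x = T x + r x)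
    (hT : ∀ j, BddInProb P fun x => T x j)
    (hr : ∀ j, Tendsto (fun x => r x j) (inProb P) (𝓝 0)) :
    (∀ j, BddInProb P fun x => Δ x j) ∧
      ∀ j, Tendsto (fun x => Δ x j - (G⁻¹ *ᵥ T x) j) (inProb P) (𝓝 0) := by
  set E : ℕ × Ω → Matrix (Fin d) (Fin d) ℝ := fun x => G⁻¹ * M x - 1 with hE
  have hE0 : ∀ j k, Tendsto (fun x => E x j k) (inProb P) (𝓝 0) := by
    intro j k
    have h1 : Tendsto (fun x => (G⁻¹ * M x) j k) (inProb P) (𝓝 ((G⁻¹ * G) j k)) := by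
      simp only [Matrix.mul_apply]
      exact tendsto_finsetSum _ fun l _ => (hM l k).const_mul _
    rw [Matrix.nonsing_inv_mul _ hG] at h1
    have h2 := h1.sub_const ((1 : Matrix (Fin d) (Fin d) ℝ) j k)
    rw [sub_self] at h2
    exact h2
  have hid : ∀ᶠ x in inProb P, ∀ j,
      Δ x j = (G⁻¹ *ᵥ T x) j + (G⁻¹ *ᵥ r x) j - ∑ k, E x j k * Δ x k := by
    filter_upwards [heq] with x hx j
    have h1 : E x *ᵥ Δ x = G⁻¹ *ᵥ T x + G⁻¹ *ᵥ r x - Δ x := by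
      rw [hE]
      simp only
      rw [Matrix.sub_mulVec, Matrix.one_mulVec, ← Matrix.mulVec_mulVec, hx, Matrix.mulVec_add]
    have h2 := congrFun h1 j
    simp only [Pi.sub_apply, Pi.add_apply] at h2
    have h3 : (E x *ᵥ Δ x) j = ∑ k, E x j k * Δ x k := rfl
    rw [← h3]
    linarith
  have hrG : ∀ j, Tendsto (fun x => (G⁻¹ *ᵥ r x) j) (inProb P) (𝓝 0) := by
    intro j
    have : Tendsto (fun x => ∑ k, G⁻¹ j k * r x k) (inProb P) (𝓝 (∑ k, G⁻¹ j k * 0)) :=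
      tendsto_finsetSum _ fun k _ => (hr k).const_mul _
    simp only [mul_zero, Finset.sum_const_zero] at this
    exact this
  have hTG : ∀ j, BddInProb P fun x => (G⁻¹ *ᵥ T x) j := by
    intro j
    refine (BddInProb.sum Finset.univ fun k _ => hT k).mono (∑ k, |G⁻¹ j k|)
      (Eventually.of_forall fun x => ?_)
    rw [abs_of_nonneg (Finset.sum_nonneg fun k _ => abs_nonneg (T x k))]
    calc |(G⁻¹ *ᵥ T x) j| = |∑ k, G⁻¹ j k * T x k| := rfl
      _ ≤ ∑ k, |G⁻¹ j k * T x k| := Finset.abs_sum_le_sum_abs _ _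
      _ ≤ ∑ k, |G⁻¹ j k| * ∑ l, |T x l| := by
          refine Finset.sum_le_sum fun k _ => ?_
          rw [abs_mul]
          gcongr
          exact Finset.single_le_sum (fun l _ => abs_nonneg (T x l)) (Finset.mem_univ k)
      _ = _ := by rw [Finset.sum_mul]
  set η : ℕ × Ω → ℝ := fun x => ∑ j, ∑ k, |E x j k| with hη
  have hη0 : Tendsto η (inProb P) (𝓝 0) := by
    have : Tendsto η (inProb P) (𝓝 (∑ j : Fin d, ∑ k : Fin d, |(0 : ℝ)|)) :=
      tendsto_finsetSum _ fun j _ => tendsto_finsetSum _ fun k _ => (hE0 j k).abs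
    simpa using this
  set Y : ℕ × Ω → ℝ := fun x => ∑ j, |(|(G⁻¹ *ᵥ T x) j| + |(G⁻¹ *ᵥ r x) j|)| with hY
  have hYb : BddInProb P Y := BddInProb.sum Finset.univ fun j _ =>
    (hTG j).add (BddInProb.of_tendsto (hrG j))
  have hD : ∀ᶠ x in inProb P, ∑ j, |Δ x j| ≤ 2 * Y x := by
    filter_upwards [hid, Metric.tendsto_nhds.1 hη0 (1 / 2) (by norm_num)] with x hx hx1
    rw [dist_zero_right, Real.norm_eq_abs] at hx1
    have hη1 := (le_abs_self _).trans hx1.le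
    have h1 : ∑ j, |Δ x j| ≤ Y x + η x * ∑ j, |Δ x j| := by
      calc ∑ j, |Δ x j| ≤ ∑ j, (|(|(G⁻¹ *ᵥ T x) j| + |(G⁻¹ *ᵥ r x) j|)|
            + ∑ k, |E x j k| * ∑ l, |Δ x l|) := by
            refine Finset.sum_le_sum fun j _ => ?_
            rw [hx j]
            refine (abs_sub _ _).trans (add_le_add ?_ ?_)
            · exact (abs_add_le _ _).trans (le_abs_self _)
            · refine (Finset.abs_sum_le_sum_abs _ _).trans (Finset.sum_le_sum fun k _ => ?_)
              rw [abs_mul]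
              gcongr
              exact Finset.single_le_sum (f := fun l => |Δ x l|) (fun l _ => abs_nonneg _)
                (Finset.mem_univ k)
        _ = _ := by
            simp only [Finset.sum_add_distrib, hη, hY, Finset.sum_mul]
    have h2 : 0 ≤ ∑ j, |Δ x j| := Finset.sum_nonneg fun _ _ => abs_nonneg _
    nlinarith
  have hΔ : ∀ j, BddInProb P fun x => Δ x j := by
    intro j
    refine hYb.mono 2 ?_
    filter_upwards [hD] with x hx
    have h1 : |Δ x j| ≤ ∑ l, |Δ x l| :=
      Finset.single_le_sum (f := fun l => |Δ x l|) (fun l _ => abs_nonneg _) (Finset.mem_univ j)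
    exact h1.trans (hx.trans (by gcongr; exact le_abs_self _))
  refine ⟨hΔ, fun j => ?_⟩
  have h1 : Tendsto (fun x => (G⁻¹ *ᵥ r x) j - ∑ k, E x j k * Δ x k) (inProb P) (𝓝 0) := by
    have h2 : Tendsto (fun x => ∑ k, E x j k * Δ x k) (inProb P) (𝓝 (∑ k : Fin d, (0 : ℝ))) :=
      tendsto_finsetSum _ fun k _ => (hΔ k).mul_tendsto_zero (hE0 j k)
    simpa using (hrG j).sub h2
  refine h1.congr' ?_
  filter_upwards [hid] with x hx
  have := hx j
  linarith

/-- Along `a + t v` the loss changes by `-2 t B + t² A`, which stays nonnegative for all `t` only if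
`B = 0`. -/
lemma localLoss_normal_equation {p : ℕ} {K : ℝ → ℝ} {S : Set ℝ} {n : ℕ} {h : ℝ} {z x : ℕ → ℝ}
    {a : Fin (p + 1) → ℝ} (ha : IsMinOn (localLoss p K S n h z x) univ a) (v : Fin (p + 1) → ℝ) :
    ∑ i ∈ Finset.range n, S.indicator 1 (x i) * K (x i / h) *
      (z i - polyVec p (x i / h) ⬝ᵥ a) * (polyVec p (x i / h) ⬝ᵥ v) = 0 := by
  set B := ∑ i ∈ Finset.range n, S.indicator 1 (x i) * K (x i / h) *
      (z i - polyVec p (x i / h) ⬝ᵥ a) * (polyVec p (x i / h) ⬝ᵥ v) with hB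
  set A := ∑ i ∈ Finset.range n, S.indicator 1 (x i) * K (x i / h) *
      (polyVec p (x i / h) ⬝ᵥ v) ^ 2 with hA
  have key : ∀ t : ℝ, 0 ≤ -2 * t * B + t ^ 2 * A := by
    intro t
    have h1 := ha (mem_univ (a + t • v))
    simp only [mem_ofPred_eq] at h1
    have h2 : localLoss p K S n h z x (a + t • v) =
        localLoss p K S n h z x a + (-2 * t * B + t ^ 2 * A) := by
      simp only [localLoss, hB, hA, Finset.mul_sum, ← Finset.sum_add_distrib]
      refine Finset.sum_congr rfl fun i _ => ?_
      rw [dotProduct_add, dotProduct_smul, smul_eq_mul]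
      ring
    linarith
  by_contra hne
  have hB2 : 0 < B ^ 2 := by positivity
  have hA1 : 0 < |A| + 1 := by positivity
  -- A step of this length makes the change negative unless `B = 0`; the `+ 1` covers `A = 0`.
  have h3 := key (B / (|A| + 1))
  have h4 : -2 * (B / (|A| + 1)) * B + (B / (|A| + 1)) ^ 2 * A
      = B ^ 2 / (|A| + 1) ^ 2 * (A - 2 * (|A| + 1)) := by
    field_simp
    ring
  rw [h4] at h3
  have h5 : A - 2 * (|A| + 1) < 0 := by linarith [le_abs_self A, abs_nonneg A]
  have h6 : 0 < B ^ 2 / (|A| + 1) ^ 2 := by positivity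
  nlinarith

variable {Ω : Type*} [MeasurableSpace Ω] {P : Measure Ω}

/-! ### Asymptotic linearity of one-sided local polynomial fits -/

/-- Measurable cones of the line. -/
structure IsCone (S : Set ℝ) : Prop where
  measurableSet : MeasurableSet S
  div_mem_iff : ∀ x a : ℝ, 0 < a → (x / a ∈ S ↔ x ∈ S)

lemma isCone_Ici : IsCone (Ici (0 : ℝ)) :=
  ⟨measurableSet_Ici, fun x a ha => by simp [le_div_iff₀ ha]⟩

lemma isCone_Iic : IsCone (Iic (0 : ℝ)) :=
  ⟨measurableSet_Iic, fun x a ha => by simp [div_le_iff₀ ha]⟩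

/-- The one-sided kernel. -/
def sideKernel (K : ℝ → ℝ) (S : Set ℝ) (u : ℝ) : ℝ := S.indicator 1 u * K u

/-- The boundary-adapted equivalent kernel `e₀'Γ⁻¹ r_p(u) K(u)` on the side `S`. -/
def sideWeight (p : ℕ) (K : ℝ → ℝ) (S : Set ℝ) (u : ℝ) : ℝ :=
  ((gammaMat p K S)⁻¹ *ᵥ polyVec p u) 0 * sideKernel K S u

lemma IsCone.indicator_div {S : Set ℝ} (hS : IsCone S) {a : ℝ} (ha : 0 < a) (x : ℝ) :
    S.indicator (1 : ℝ → ℝ) (x / a) = S.indicator 1 x := by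
  by_cases hx : x ∈ S
  · rw [indicator_of_mem hx, indicator_of_mem ((hS.div_mem_iff x a ha).2 hx)]; rfl
  · rw [indicator_of_notMem hx, indicator_of_notMem (mt (hS.div_mem_iff x a ha).1 hx)]

lemma IsLocal.sideKernel {K : ℝ → ℝ} (hK : IsLocal K) {S : Set ℝ} (hS : MeasurableSet S) :
    IsLocal (sideKernel K S) := by
  have : FuzzyRDD.sideKernel K S = S.indicator K := by
    ext u
    by_cases hu : u ∈ S <;> simp [FuzzyRDD.sideKernel, hu]
  rw [this]
  exact hK.indicator hS

lemma IsLocal.sum {ι : Type*} (s : Finset ι) {g : ι → ℝ → ℝ} (hg : ∀ i ∈ s, IsLocal (g i)) :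
    IsLocal fun u => ∑ i ∈ s, g i u := by
  classical
  induction s using Finset.induction_on with
  | empty => exact ⟨by simp, ⟨0, by simp⟩, ⟨0, by simp⟩⟩
  | insert i s hi ih =>
    simp only [Finset.sum_insert hi]
    exact (hg i (by simp)).add (ih fun j hj => hg j (by simp [hj]))

lemma sideWeight_eq_sum (p : ℕ) (K : ℝ → ℝ) (S : Set ℝ) (u : ℝ) :
    sideWeight p K S u =
      ∑ j : Fin (p + 1), (gammaMat p K S)⁻¹ 0 j * (u ^ (j : ℕ) * sideKernel K S u) := by
  rw [sideWeight, Matrix.mulVec, dotProduct, Finset.sum_mul]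
  exact Finset.sum_congr rfl fun j _ => by rw [polyVec]; ring

lemma IsLocal.sideWeight {K : ℝ → ℝ} (hK : IsLocal K) (p : ℕ) {S : Set ℝ} (hS : MeasurableSet S) :
    IsLocal (sideWeight p K S) := by
  have : FuzzyRDD.sideWeight p K S = fun u => ∑ j : Fin (p + 1), (gammaMat p K S)⁻¹ 0 j *
      (u ^ (j : ℕ) * FuzzyRDD.sideKernel K S u) := by
    ext u
    exact sideWeight_eq_sum p K S u
  rw [this]
  exact IsLocal.sum _ fun j _ => ((hK.sideKernel hS).pow_mul _).const_mul _

lemma gammaMat_apply (p : ℕ) (K : ℝ → ℝ) {S : Set ℝ} (hS : MeasurableSet S)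
    (j k : Fin (p + 1)) :
    gammaMat p K S j k = ∫ u, u ^ ((j : ℕ) + k) * sideKernel K S u := by
  rw [gammaMat, Matrix.of_apply, ← integral_indicator hS]
  congr 1
  ext u
  by_cases hu : u ∈ S
  · simp [sideKernel, polyVec, hu, pow_add]; ring
  · simp [sideKernel, hu]

/-- The Taylor polynomial has coefficients `c j * b ^ j` in the rescaled variable, hence these are
the centring values of the fitted coefficients. -/
lemma polyVec_div_dotProduct (p : ℕ) (x : ℝ) {b : ℝ} (hb : b ≠ 0) (c : Fin (p + 1) → ℝ) :
    polyVec p (x / b) ⬝ᵥ (fun j => c j * b ^ (j : ℕ)) = polyVec p x ⬝ᵥ c := by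
  simp only [dotProduct, polyVec]
  refine Finset.sum_congr rfl fun j _ => ?_
  rw [div_pow]
  field_simp

/-- The design in which a one-sided fit of order `p` is asymptotically linear. -/
structure FitDesign (P : Measure Ω) (X Z : Ω → ℝ) (Xs Zs : ℕ → Ω → ℝ) (f m K : ℝ → ℝ)
    (xl xu ε : ℝ) (b : ℕ → ℝ) (p : ℕ) : Prop where
  density : HasLocalDensity P X f
  density_pos : 0 < f 0
  response : Response P X Z xl xu ε m
  sample : IsIIDSample P (fun i ω => (Zs i ω, Xs i ω)) (P.map fun ω => (Z ω, X ω))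
  xl_neg : xl < 0
  xu_pos : 0 < xu
  kernel : IsLocal K
  b_pos : ∀ n, 0 < b n
  b_lim : Tendsto b atTop (𝓝 0)
  nb_lim : Tendsto (fun n : ℕ => n * b n) atTop atTop
  bias_lim : Tendsto (fun n : ℕ => Real.sqrt (n * b n) * b n ^ (p + 1)) atTop (𝓝 0)

/-- `m` agrees near the cutoff, on the side `S`, with the polynomial with coefficients `c` up to
an error of order `p + 1`. -/
def HasPolyExpansion (m : ℝ → ℝ) (S : Set ℝ) (p : ℕ) (c : Fin (p + 1) → ℝ) : Prop :=
  ∃ s ∈ 𝓝 (0 : ℝ), ∃ C, ∀ x ∈ s, x ∈ S → x ≠ 0 → |m x - polyVec p x ⬝ᵥ c| ≤ C * |x| ^ (p + 1)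

namespace FitDesign

variable {X Z : Ω → ℝ} {Xs Zs : ℕ → Ω → ℝ} {f m K : ℝ → ℝ}
  {xl xu ε : ℝ} {b : ℕ → ℝ} {p : ℕ}

lemma sample_X (D : FitDesign P X Z Xs Zs f m K xl xu ε b p) : IsIIDSample P Xs (P.map X) := by
  have h := D.sample.map measurable_snd
  rwa [Measure.map_map measurable_snd
    (D.response.measurable_response.prodMk D.density.measurable)] at h

lemma ae_ne_zero (D : FitDesign P X Z Xs Zs f m K xl xu ε b p) :
    ∀ᵐ ω ∂P, ∀ i, Xs i ω ≠ 0 := by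
  refine D.sample_X.ae_comp (p := fun x => x ≠ 0) ?_
  exact (ae_map_iff D.density.measurable.aemeasurable
    (p := fun x => x ≠ 0) (measurableSet_singleton 0).compl).2 D.density.ae_ne_zero

lemma sqrt_nb_inv_tendsto (D : FitDesign P X Z Xs Zs f m K xl xu ε b p) :
    Tendsto (fun n : ℕ => (Real.sqrt (n * b n))⁻¹) atTop (𝓝 0) :=
  tendsto_inv_atTop_zero.comp (Real.tendsto_sqrt_atTop.comp D.nb_lim)

/-- A one-sided fit is asymptotically linear. -/
lemma asymptotically_linear [IsProbabilityMeasure P]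
    (D : FitDesign P X Z Xs Zs f m K xl xu ε b p) {S : Set ℝ}
    (hS : IsCone S) (hΓ : IsUnit (gammaMat p K S).det) {c : Fin (p + 1) → ℝ}
    (hc : HasPolyExpansion m S p c) {α : ℕ → Ω → Fin (p + 1) → ℝ}
    (hα : IsLocalPolyFit p K S b Zs Xs α) :
    (∀ j, Tendsto (fun x : ℕ × Ω => α x.1 x.2 j - c j * b x.1 ^ (j : ℕ)) (inProb P) (𝓝 0)) ∧
    BddInProb P (fun x : ℕ × Ω => Real.sqrt (x.1 * b x.1) * (α x.1 x.2 0 - c 0)) ∧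
    Tendsto (fun x : ℕ × Ω => Real.sqrt (x.1 * b x.1) * (α x.1 x.2 0 - c 0) -
      ∑ i ∈ Finset.range x.1, (Real.sqrt (x.1 * b x.1))⁻¹ * ((f 0)⁻¹ *
        (sideWeight p K S (Xs i x.2 / b x.1) * (Zs i x.2 - m (Xs i x.2))))) (inProb P) (𝓝 0) := by
  have hk := D.kernel.sideKernel hS.measurableSet
  set k := sideKernel K S with hkdef
  set M : ℕ × Ω → Matrix (Fin (p + 1)) (Fin (p + 1)) ℝ := fun x => Matrix.of fun j l =>
    ∑ i ∈ Finset.range x.1, (x.1 * b x.1)⁻¹ *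
      ((Xs i x.2 / b x.1) ^ ((j : ℕ) + l) * k (Xs i x.2 / b x.1)) with hMdef
  set Δ : ℕ × Ω → Fin (p + 1) → ℝ := fun x j =>
    Real.sqrt (x.1 * b x.1) * (α x.1 x.2 j - c j * b x.1 ^ (j : ℕ)) with hΔdef
  set T : ℕ × Ω → Fin (p + 1) → ℝ := fun x j => ∑ i ∈ Finset.range x.1,
    (Real.sqrt (x.1 * b x.1))⁻¹ * ((Xs i x.2 / b x.1) ^ (j : ℕ) * k (Xs i x.2 / b x.1) *
      (Zs i x.2 - m (Xs i x.2))) with hTdef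
  set r : ℕ × Ω → Fin (p + 1) → ℝ := fun x j => ∑ i ∈ Finset.range x.1,
    (Real.sqrt (x.1 * b x.1))⁻¹ * ((Xs i x.2 / b x.1) ^ (j : ℕ) * k (Xs i x.2 / b x.1) *
      (m (Xs i x.2) - polyVec p (Xs i x.2) ⬝ᵥ c)) with hrdef
  have hM : ∀ j l, Tendsto (fun x => M x j l) (inProb P) (𝓝 ((f 0 • gammaMat p K S) j l)) := by
    intro j l
    rw [Matrix.smul_apply, smul_eq_mul, gammaMat_apply p K hS.measurableSet]
    have h1 := D.sample_X.tendsto_sum_local D.density D.b_pos D.b_lim D.nb_lim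
      (hk.pow_mul ((j : ℕ) + l))
    simpa only [hMdef, Matrix.of_apply] using h1
  -- Row `j` is the normal equation in the direction of the `j`-th basis vector, with the response
  -- split into residual, Taylor remainder and Taylor polynomial.
  have heq : ∀ x, M x *ᵥ Δ x = T x + r x := by
    rintro ⟨n, ω⟩
    ext j
    have hb := D.b_pos n
    have hne := localLoss_normal_equation ((hα n).2 ω) (Pi.single j 1)
    have h1 : ∑ i ∈ Finset.range n, k (Xs i ω / b n) * (Xs i ω / b n) ^ (j : ℕ) *
        (polyVec p (Xs i ω / b n) ⬝ᵥ (fun l => α n ω l - c l * b n ^ (l : ℕ))) =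
        ∑ i ∈ Finset.range n, k (Xs i ω / b n) * (Xs i ω / b n) ^ (j : ℕ) *
          (Zs i ω - m (Xs i ω) + (m (Xs i ω) - polyVec p (Xs i ω) ⬝ᵥ c)) := by
      rw [← sub_eq_zero, ← Finset.sum_sub_distrib, ← neg_eq_zero, ← Finset.sum_neg_distrib]
      rw [← hne]
      refine Finset.sum_congr rfl fun i _ => ?_
      have h2 : (fun l => α n ω l - c l * b n ^ (l : ℕ)) = α n ω - fun l : Fin (p + 1) =>
        c l * b n ^ (l : ℕ) := rfl
      rw [h2, dotProduct_sub, polyVec_div_dotProduct p _ hb.ne', dotProduct_single, hkdef,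
        sideKernel, hS.indicator_div hb]
      simp only [polyVec]
      ring
    have h3 : (M (n, ω) *ᵥ Δ (n, ω)) j = (Real.sqrt (n * b n))⁻¹ *
        ∑ i ∈ Finset.range n, k (Xs i ω / b n) * (Xs i ω / b n) ^ (j : ℕ) *
        (polyVec p (Xs i ω / b n) ⬝ᵥ (fun l => α n ω l - c l * b n ^ (l : ℕ))) := by
      -- Valid for `n = 0` too, both sides being zero.
      have hs : (Real.sqrt (n * b n))⁻¹ = (n * b n)⁻¹ * Real.sqrt (n * b n) := by
        rw [inv_mul_eq_div, Real.sqrt_div_self', one_div]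
      rw [hs]
      simp only [Matrix.mulVec, dotProduct, hMdef, hΔdef, Matrix.of_apply, polyVec, Finset.sum_mul,
        Finset.mul_sum]
      rw [Finset.sum_comm]
      refine Finset.sum_congr rfl fun i _ => Finset.sum_congr rfl fun l _ => ?_
      rw [pow_add]
      ring
    rw [h3, h1, Finset.mul_sum, Pi.add_apply, hTdef, hrdef]
    simp only
    rw [← Finset.sum_add_distrib]
    exact Finset.sum_congr rfl fun i _ => by ring
  have hT : ∀ j, BddInProb P fun x => T x j := by
    intro j
    have hg := hk.pow_mul (j : ℕ)
    obtain ⟨C, hC⟩ := D.response.sq_local_resid_le D.density D.xl_neg D.xu_pos D.b_pos D.b_lim hg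
    have h0 := D.response.integral_resid_eq_zero D.density D.xl_neg D.xu_pos D.b_pos D.b_lim hg
    have hR : ∀ n, Measurable fun a : ℝ × ℝ =>
        (a.2 / b n) ^ (j : ℕ) * k (a.2 / b n) * (a.1 - m a.2) := by
      intro n
      have h1 := hk.measurable
      have h2 := D.response.measurable_mean
      fun_prop
    have h1 := D.sample.bddInProb_sum_scaled
      (D.response.measurable_response.prodMk D.density.measurable) D.b_pos hR hC
      (h0.mono fun n hn => hn.2)
    simpa only [hTdef] using h1
  -- The bias: writing `|x| = |x / b| b` extracts `b ^ (p + 1)` from the remainder. What is left is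
  -- `√(n b) b ^ (p + 1) → 0` times a convergent kernel average.
  have hr : ∀ j, Tendsto (fun x => r x j) (inProb P) (𝓝 0) := by
    intro j
    obtain ⟨s, hs, C, hC⟩ := hc
    have hg := (hk.pow_mul ((j : ℕ) + (p + 1))).abs
    have h1 := D.sample_X.tendsto_sum_local D.density D.b_pos D.b_lim D.nb_lim hg
    have h2 := ((D.bias_lim.comp (tendsto_fst_inProb (P := P))).mul_const C).mul h1
    rw [zero_mul, zero_mul] at h2
    refine squeeze_zero_norm' ?_ h2
    refine eventually_inProb_of_ae ?_
    filter_upwards [hk.eventually_supp D.b_pos D.b_lim hs] with n hn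
    filter_upwards [D.ae_ne_zero] with ω hω
    have hb := D.b_pos n
    simp only [hrdef, Function.comp, Finset.mul_sum]
    refine (norm_sum_le _ _).trans (Finset.sum_le_sum fun i _ => ?_)
    have hsq : (Real.sqrt (n * b n))⁻¹ = (n * b n)⁻¹ * Real.sqrt (n * b n) := by
      rw [inv_mul_eq_div, Real.sqrt_div_self', one_div]
    by_cases h0 : k (Xs i ω / b n) = 0
    · simp [h0]
    · have hxs : Xs i ω ∈ s := by_contra fun hcon => h0 (hn _ hcon)
      have hxS : Xs i ω ∈ S := by
        by_contra hcon
        apply h0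
        rw [hkdef, sideKernel, hS.indicator_div hb, indicator_of_notMem hcon, zero_mul]
      have h3 := hC _ hxs hxS (hω i)
      have h4 : |Xs i ω| = |Xs i ω / b n| * b n := by
        rw [abs_div, abs_of_pos hb, div_mul_cancel₀ _ hb.ne']
      rw [h4] at h3
      rw [hsq, Real.norm_eq_abs, abs_mul, abs_mul ((n * b n)⁻¹), abs_of_nonneg (Real.sqrt_nonneg _),
        abs_of_nonneg (by positivity : (0 : ℝ) ≤ (n * b n)⁻¹), abs_mul, abs_mul, abs_pow,
        abs_mul, abs_pow, pow_add]
      calc (n * b n)⁻¹ * Real.sqrt (n * b n) * (|Xs i ω / b n| ^ (j : ℕ) * |k (Xs i ω / b n)| *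
            |m (Xs i ω) - polyVec p (Xs i ω) ⬝ᵥ c|)
          ≤ (n * b n)⁻¹ * Real.sqrt (n * b n) * (|Xs i ω / b n| ^ (j : ℕ) * |k (Xs i ω / b n)| *
            (C * (|Xs i ω / b n| * b n) ^ (p + 1))) := by gcongr
        _ = _ := by ring
  have hG : IsUnit (f 0 • gammaMat p K S).det := by
    rw [Matrix.det_smul]
    exact ((isUnit_iff_ne_zero.2 D.density_pos.ne').pow _).mul hΓ
  obtain ⟨hb, hlin⟩ := solve_inProb hG hM (Eventually.of_forall heq) hT hr
  refine ⟨fun j => ?_, ?_, ?_⟩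
  · have h1 := (hb j).mul_tendsto_zero (D.sqrt_nb_inv_tendsto.comp tendsto_fst_inProb)
    refine h1.congr' ?_
    refine (tendsto_fst_inProb.eventually (eventually_ne_atTop 0)).mono fun x hx => ?_
    have h2 : (0 : ℝ) < x.1 := by exact_mod_cast Nat.pos_of_ne_zero hx
    have h3 := D.b_pos x.1
    have h4 : Real.sqrt (x.1 * b x.1) ≠ 0 := (Real.sqrt_pos.2 (by positivity)).ne'
    simp only [Function.comp, hΔdef]
    field_simp
  · have h1 := hb 0
    simpa [hΔdef] using h1
  · have h1 := hlin 0
    refine h1.congr fun x => ?_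
    have h2 : (f 0 • gammaMat p K S)⁻¹ = (f 0)⁻¹ • (gammaMat p K S)⁻¹ := by
      have h3 := Matrix.inv_smul' (A := gammaMat p K S) (Units.mk0 (f 0) D.density_pos.ne') hΓ
      simpa [Units.smul_def] using h3
    congr 1
    · simp [hΔdef]
    · rw [h2, Matrix.smul_mulVec, Pi.smul_apply, smul_eq_mul, Matrix.mulVec, dotProduct, hTdef]
      simp only [Finset.mul_sum]
      rw [Finset.sum_comm]
      refine Finset.sum_congr rfl fun i _ => ?_
      rw [sideWeight_eq_sum, Finset.sum_mul, Finset.mul_sum, Finset.mul_sum]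
      exact Finset.sum_congr rfl fun j _ => by ring

end FitDesign

variable {Ω : Type*} [MeasurableSpace Ω] {P : Measure Ω}

/-! ### The asymptotic variance -/

/-- Nothing is known about `m` at the cutoff itself. Deleting `0` from the side is harmless, as it
is null for both `X` and Lebesgue measure. -/
lemma IsCondMeanOn.tendsto_integral_side [IsProbabilityMeasure P] {X Z : Ω → ℝ} {f m : ℝ → ℝ}
    {xl xu : ℝ} {h : ℕ → ℝ} (hm : IsCondMeanOn P X Z (Icc xl xu) m)
    (hX : HasLocalDensity P X f) (hxl : xl < 0) (hxu : 0 < xu) (h_pos : ∀ n, 0 < h n)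
    (h_lim : Tendsto h atTop (𝓝 0)) {g : ℝ → ℝ} (hg : IsLocal g) {S : Set ℝ} (hS : IsCone S)
    (hgS : ∀ u, u ∉ S → g u = 0) {l : ℝ} (hl : Tendsto m (𝓝[S \ {0}] 0) (𝓝 l)) :
    Tendsto (fun n => (h n)⁻¹ * ∫ ω, g (X ω / h n) * Z ω ∂P) atTop (𝓝 (l * (f 0 * ∫ u, g u))) := by
  have hmeas : MeasurableSet (S \ {0}) := hS.measurableSet.diff (measurableSet_singleton 0)
  have hval : ∀ u, u ≠ 0 → (S \ {0}).indicator g u = g u := by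
    intro u hu
    by_cases huS : u ∈ S
    · exact indicator_of_mem ((mem_sdiff _).2 ⟨huS, hu⟩) g
    · rw [indicator_of_notMem (fun hc => huS hc.1), hgS u huS]
  have hcone : ∀ x a : ℝ, 0 < a → x / a ∈ S \ {0} → x ∈ S \ {0} := by
    intro x a ha hxa
    refine (mem_sdiff _).2 ⟨(hS.div_mem_iff x a ha).1 hxa.1, fun hx0 => hxa.2 ?_⟩
    rw [mem_singleton_iff] at hx0
    simp [hx0]
  have h1 := hm.tendsto_integral_local hX hxl hxu h_pos h_lim (hg.indicator hmeas) hcone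
    (fun u hu => indicator_of_notMem hu g) hl
  have h2 : ∫ u, (S \ {0}).indicator g u = ∫ u, g u := by
    refine integral_congr_ae ?_
    filter_upwards [Measure.ae_ne volume (0 : ℝ)] with u hu using hval u hu
  rw [h2] at h1
  refine h1.congr fun n => ?_
  congr 1
  refine integral_congr_ae ?_
  filter_upwards [hX.ae_ne_zero] with ω hω
  rw [hval _ (div_ne_zero hω (h_pos n).ne')]

/-- The conditional second moments of `(E₁, E₂)` given `X` have limits at the cutoff on the
side `S`. -/
structure ResidualCov (P : Measure Ω) (X E₁ E₂ : Ω → ℝ) (xl xu : ℝ) (S : Set ℝ)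
    (s₁₁ s₁₂ s₂₂ : ℝ) : Prop where
  fst : ∃ σ, IsCondMeanOn P X (fun ω => E₁ ω ^ 2) (Icc xl xu) σ ∧
    Tendsto σ (𝓝[S \ {0}] 0) (𝓝 s₁₁)
  mixed : ∃ σ, IsCondMeanOn P X (fun ω => E₁ ω * E₂ ω) (Icc xl xu) σ ∧
    Tendsto σ (𝓝[S \ {0}] 0) (𝓝 s₁₂)
  snd : ∃ σ, IsCondMeanOn P X (fun ω => E₂ ω ^ 2) (Icc xl xu) σ ∧
    Tendsto σ (𝓝[S \ {0}] 0) (𝓝 s₂₂)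

namespace ResidualCov

variable [IsProbabilityMeasure P] {X E₁ E₂ : Ω → ℝ} {xl xu : ℝ} {S : Set ℝ} {s₁₁ s₁₂ s₂₂ : ℝ}
  {f : ℝ → ℝ} {h : ℕ → ℝ}

lemma tendsto_quad (hE : ResidualCov P X E₁ E₂ xl xu S s₁₁ s₁₂ s₂₂)
    (hX : HasLocalDensity P X f) (hxl : xl < 0) (hxu : 0 < xu) (h_pos : ∀ n, 0 < h n)
    (h_lim : Tendsto h atTop (𝓝 0)) (hS : IsCone S) {g₁ g₂ : ℝ → ℝ} (hg₁ : IsLocal g₁)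
    (hg₂ : IsLocal g₂) (h₁ : ∀ u, u ∉ S → g₁ u = 0) (h₂ : ∀ u, u ∉ S → g₂ u = 0) :
    (∀ᶠ n in atTop,
      Integrable (fun ω => (g₁ (X ω / h n) * E₁ ω + g₂ (X ω / h n) * E₂ ω) ^ 2) P) ∧
    Tendsto (fun n => (h n)⁻¹ * ∫ ω, (g₁ (X ω / h n) * E₁ ω + g₂ (X ω / h n) * E₂ ω) ^ 2 ∂P) atTop
      (𝓝 (f 0 * (s₁₁ * (∫ u, g₁ u ^ 2) + 2 * s₁₂ * (∫ u, g₁ u * g₂ u) + s₂₂ * ∫ u, g₂ u ^ 2))) := by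
  obtain ⟨σ₁, m₁, t₁⟩ := hE.fst
  obtain ⟨σ₂, m₂, t₂⟩ := hE.mixed
  obtain ⟨σ₃, m₃, t₃⟩ := hE.snd
  have l₁ := m₁.tendsto_integral_side hX hxl hxu h_pos h_lim hg₁.sq hS
    (fun u hu => by rw [h₁ u hu]; simp) t₁
  have l₂ := m₂.tendsto_integral_side hX hxl hxu h_pos h_lim (hg₁.mul hg₂) hS
    (fun u hu => by rw [h₁ u hu]; simp) t₂
  have l₃ := m₃.tendsto_integral_side hX hxl hxu h_pos h_lim hg₂.sq hS
    (fun u hu => by rw [h₂ u hu]; simp) t₃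
  have hint : ∀ {W : Ω → ℝ} {σ g : ℝ → ℝ}, IsCondMeanOn P X W (Icc xl xu) σ → IsLocal g →
      ∀ᶠ n in atTop, Integrable (fun ω => g (X ω / h n) * W ω) P := by
    intro W σ g hW hg
    obtain ⟨B, -, hB⟩ := hg.exists_pos_bdd
    filter_upwards [hg.eventually_supp h_pos h_lim (Icc_mem_nhds hxl hxu)] with n hn
    exact (hW.integral_mul hX.measurable measurableSet_Icc (φ := fun x => g (x / h n))
      (hg.measurable.comp (measurable_id.div_const _)) (fun x => hB _) hn).1
  have hpt : ∀ n ω, (g₁ (X ω / h n) * E₁ ω + g₂ (X ω / h n) * E₂ ω) ^ 2 =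
      g₁ (X ω / h n) ^ 2 * E₁ ω ^ 2 + 2 * (g₁ (X ω / h n) * g₂ (X ω / h n) * (E₁ ω * E₂ ω))
        + g₂ (X ω / h n) ^ 2 * E₂ ω ^ 2 := fun n ω => by ring
  have hi := ((hint m₁ hg₁.sq).and (hint m₂ (hg₁.mul hg₂))).and (hint m₃ hg₂.sq)
  simp_rw [hpt]
  refine ⟨?_, ?_⟩
  · filter_upwards [hi] with n hn
    exact (hn.1.1.add (hn.1.2.const_mul 2)).add hn.2
  · have hsum := (l₁.add (l₂.const_mul 2)).add l₃
    have hval : s₁₁ * (f 0 * ∫ u, g₁ u ^ 2) + 2 * (s₁₂ * (f 0 * ∫ u, g₁ u * g₂ u)) +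
        s₂₂ * (f 0 * ∫ u, g₂ u ^ 2) =
        f 0 * (s₁₁ * (∫ u, g₁ u ^ 2) + 2 * s₁₂ * (∫ u, g₁ u * g₂ u) + s₂₂ * ∫ u, g₂ u ^ 2) := by ring
    rw [hval] at hsum
    refine hsum.congr' ?_
    filter_upwards [hi] with n hn
    have i12 : Integrable (fun ω => g₁ (X ω / h n) ^ 2 * E₁ ω ^ 2
        + 2 * (g₁ (X ω / h n) * g₂ (X ω / h n) * (E₁ ω * E₂ ω))) P :=
      hn.1.1.add (hn.1.2.const_mul 2)
    rw [integral_add i12 hn.2, integral_add hn.1.1 (hn.1.2.const_mul 2), integral_const_mul]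
    ring

/-- After multiplication by `f 0 > 0` this is a limit of integrals of squares, along the auxiliary
bandwidth `1 / (n + 1)`. -/
lemma quad_nonneg (hE : ResidualCov P X E₁ E₂ xl xu S s₁₁ s₁₂ s₂₂)
    (hX : HasLocalDensity P X f) (hf : 0 < f 0) (hxl : xl < 0) (hxu : 0 < xu) (hS : IsCone S)
    {g₁ g₂ : ℝ → ℝ} (hg₁ : IsLocal g₁)
    (hg₂ : IsLocal g₂) (h₁ : ∀ u, u ∉ S → g₁ u = 0) (h₂ : ∀ u, u ∉ S → g₂ u = 0) :
    0 ≤ s₁₁ * (∫ u, g₁ u ^ 2) + 2 * s₁₂ * (∫ u, g₁ u * g₂ u) + s₂₂ * ∫ u, g₂ u ^ 2 := by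
  have h := (hE.tendsto_quad hX hxl hxu (h := fun n : ℕ => 1 / ((n : ℝ) + 1))
    (fun n => by positivity) tendsto_one_div_add_atTop_nhds_zero_nat hS hg₁ hg₂ h₁ h₂).2
  have h2 := ge_of_tendsto' h fun n => mul_nonneg (by positivity)
    (integral_nonneg fun ω => sq_nonneg _)
  exact nonneg_of_mul_nonneg_right h2 hf

/-- Taking both test functions proportional to one `g` isolates the limiting covariance matrix,
which is therefore positive semidefinite. -/
lemma form_nonneg (hE : ResidualCov P X E₁ E₂ xl xu S s₁₁ s₁₂ s₂₂)
    (hX : HasLocalDensity P X f) (hf : 0 < f 0) (hxl : xl < 0) (hxu : 0 < xu) (hS : IsCone S)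
    {g : ℝ → ℝ} (hg : IsLocal g) (hgS : ∀ u, u ∉ S → g u = 0) (hpos : 0 < ∫ u, g u ^ 2)
    (a b : ℝ) : 0 ≤ s₁₁ * a ^ 2 + 2 * s₁₂ * (a * b) + s₂₂ * b ^ 2 := by
  have h := hE.quad_nonneg hX hf hxl hxu hS (hg.const_mul a) (hg.const_mul b)
    (fun u hu => by rw [hgS u hu, mul_zero]) (fun u hu => by rw [hgS u hu, mul_zero])
  have e1 : ∀ x y : ℝ, ∫ u, x * g u * (y * g u) = x * y * ∫ u, g u ^ 2 := by
    intro x y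
    rw [← integral_const_mul]
    congr 1
    ext u
    ring
  simp_rw [pow_two (_ * g _), e1] at h
  have h2 : (s₁₁ * (a * a * ∫ u, g u ^ 2) + 2 * s₁₂ * (a * b * ∫ u, g u ^ 2) +
      s₂₂ * (b * b * ∫ u, g u ^ 2)) =
      (∫ u, g u ^ 2) * (s₁₁ * a ^ 2 + 2 * s₁₂ * (a * b) + s₂₂ * b ^ 2) := by ring
  rw [h2] at h
  exact nonneg_of_mul_nonneg_right h hpos

end ResidualCov

/-! ### Strict positivity of the one-sided variances. -/

/-- The trace of a nonzero positive semidefinite matrix against a positive definite one is positive.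
The discriminant gives `b² ≤ a d`; for `d > 0`, `(2 b B)² ≤ 4 a d B² < 4 a d A C ≤ (a A + d C)²`. -/
lemma quad_form_pos {a b d A B C : ℝ} (ha : 0 < a) (h : ∀ t : ℝ, 0 ≤ a + 2 * t * b + t ^ 2 * d)
    (hA : 0 ≤ A) (hC : 0 ≤ C) (hlt : B ^ 2 < A * C) : 0 < a * A + 2 * b * B + d * C := by
  have hAC : 0 < A * C := (sq_nonneg B).trans_lt hlt
  have hA' : 0 < A := lt_of_le_of_ne hA fun hc => by rw [← hc] at hAC; simp at hAC
  have hC' : 0 < C := lt_of_le_of_ne hC fun hc => by rw [← hc] at hAC; simp at hAC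
  have hd := discrim_le_zero (a := d) (b := 2 * b) (c := a) fun t => by
    have := h t
    nlinarith
  rw [discrim] at hd
  have hbd : b ^ 2 ≤ a * d := by nlinarith
  have hd0 : 0 ≤ d := nonneg_of_mul_nonneg_right ((sq_nonneg b).trans hbd) ha
  rcases hd0.eq_or_lt with hd0 | hd0
  · have hb : b = 0 := by
      rw [← hd0] at hbd
      exact pow_eq_zero_iff (two_ne_zero) |>.1 (le_antisymm (by linarith) (sq_nonneg b))
    rw [← hd0, hb]
    have := mul_pos ha hA'
    linarith
  · have h1 : (2 * b * B) ^ 2 < (a * A + d * C) ^ 2 := by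
      have h2 : b ^ 2 * B ^ 2 ≤ a * d * B ^ 2 := mul_le_mul_of_nonneg_right hbd (sq_nonneg B)
      have h3 : a * d * B ^ 2 < a * d * (A * C) := mul_lt_mul_of_pos_left hlt (mul_pos ha hd0)
      nlinarith [sq_nonneg (a * A - d * C)]
    have h2 : 0 < a * A + d * C := add_pos (mul_pos ha hA') (mul_pos hd0 hC')
    have h3 := abs_lt_of_sq_lt_sq h1 h2.le
    linarith [(abs_lt.1 h3).1]

lemma integral_comp_div_pos (g : ℝ → ℝ) {c : ℝ} (hc : 0 < c) :
    ∫ u, g (u / c) = c * ∫ u, g u := by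
  rw [Measure.integral_comp_div, abs_of_pos hc, smul_eq_mul]

lemma integral_sq_pos_of_integral_ne_zero {g : ℝ → ℝ} (hg : IsLocal g) (h : ∫ u, g u ≠ 0) :
    0 < ∫ u, g u ^ 2 := by
  refine lt_of_le_of_ne (integral_nonneg fun u => sq_nonneg _) fun hc => h ?_
  have h3 := (integral_eq_zero_iff_of_nonneg (fun u => sq_nonneg (g u)) hg.sq.integrable).1 hc.symm
  rw [integral_congr_ae (g := fun _ => (0 : ℝ)) ?_, integral_zero]
  filter_upwards [h3] with u hu
  simpa using hu

/-- Two distinct dilations of a local function of nonzero integral are not proportional. -/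
lemma sq_integral_dilation_lt {w : ℝ → ℝ} (hw : IsLocal w) (hone : ∫ u, w u = 1) {c₁ c₂ : ℝ}
    (h₁ : 0 < c₁) (h₂ : 0 < c₂) (hne : c₁ ≠ c₂) :
    (∫ u, c₁⁻¹ * w (u / c₁) * (c₂⁻¹ * w (u / c₂))) ^ 2 <
      (∫ u, (c₁⁻¹ * w (u / c₁)) ^ 2) * ∫ u, (c₂⁻¹ * w (u / c₂)) ^ 2 := by
  have k₁ := (hw.comp_div h₁).const_mul c₁⁻¹
  have k₂ := (hw.comp_div h₂).const_mul c₂⁻¹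
  set g₁ : ℝ → ℝ := fun u => c₁⁻¹ * w (u / c₁) with hg₁
  set g₂ : ℝ → ℝ := fun u => c₂⁻¹ * w (u / c₂) with hg₂
  have one : ∀ {c : ℝ}, 0 < c → ∫ u, c⁻¹ * w (u / c) = 1 := by
    intro c hc
    rw [integral_const_mul, integral_comp_div_pos _ hc, hone, mul_one, inv_mul_cancel₀ hc.ne']
  have hC := integral_sq_pos_of_integral_ne_zero k₂ (by rw [one h₂]; exact one_ne_zero)
  -- The dilates all have integral one, but their absolute second moments scale as `c²`. Equality in
  -- Cauchy–Schwarz would make the two dilates proportional, equal by comparing integrals, and then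
  -- `c₁ = c₂`.
  have second : ∀ {c : ℝ}, 0 < c →
      ∫ u, u ^ 2 * |c⁻¹ * w (u / c)| = c ^ 2 * ∫ u, u ^ 2 * |w u| := by
    intro c hc
    have h3 := integral_comp_div_pos (fun u => u ^ 2 * |w u|) hc
    have h4 : ∀ u, u ^ 2 * |c⁻¹ * w (u / c)| = c * ((u / c) ^ 2 * |w (u / c)|) := by
      intro u
      rw [abs_mul, abs_inv, abs_of_pos hc]
      field_simp
    simp_rw [h4]
    rw [integral_const_mul, h3]
    ring
  have hm : 0 < ∫ u, u ^ 2 * |w u| := by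
    refine lt_of_le_of_ne (integral_nonneg fun u => by positivity) fun hc => ?_
    have h3 := (integral_eq_zero_iff_of_nonneg (fun u => by positivity)
      (hw.abs.pow_mul 2).integrable).1 hc.symm
    have h4 : ∫ u, w u = 0 := by
      rw [integral_congr_ae (g := fun _ => (0 : ℝ)) ?_, integral_zero]
      filter_upwards [h3, Measure.ae_ne volume (0 : ℝ)] with u hu hu0
      simpa [hu0] using hu
    rw [hone] at h4
    exact one_ne_zero h4
  by_contra hcon
  rw [not_lt] at hcon
  set A := ∫ u, g₁ u ^ 2
  set B := ∫ u, g₁ u * g₂ u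
  set C := ∫ u, g₂ u ^ 2
  -- The squared `L²` distance from `g₁` to its projection on `g₂` is `(A C - B²) / C`.
  have hz : ∫ u, (g₁ u - B / C * g₂ u) ^ 2 = 0 := by
    have h3 : ∀ u, (g₁ u - B / C * g₂ u) ^ 2 =
        g₁ u ^ 2 - 2 * (B / C) * (g₁ u * g₂ u) + (B / C) ^ 2 * g₂ u ^ 2 := fun u => by ring
    refine le_antisymm ?_ (integral_nonneg fun u => sq_nonneg _)
    have i1 : Integrable fun u => g₁ u ^ 2 - 2 * (B / C) * (g₁ u * g₂ u) :=
      k₁.sq.integrable.sub ((k₁.mul k₂).integrable.const_mul _)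
    simp_rw [h3]
    rw [integral_add i1 (k₂.sq.integrable.const_mul _),
      integral_sub k₁.sq.integrable ((k₁.mul k₂).integrable.const_mul _), integral_const_mul,
      integral_const_mul]
    have h4 : A - 2 * (B / C) * B + (B / C) ^ 2 * C = (A * C - B ^ 2) / C := by
      field_simp
      ring
    rw [h4]
    exact div_nonpos_of_nonpos_of_nonneg (by linarith) hC.le
  have hae : ∀ᵐ u, g₁ u = B / C * g₂ u := by
    have h3 := (integral_eq_zero_iff_of_nonneg (fun u => sq_nonneg _)
      (k₁.sub (k₂.const_mul (B / C))).sq.integrable).1 hz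
    filter_upwards [h3] with u hu
    simpa [sub_eq_zero] using hu
  have hBC : B / C = 1 := by
    have h3 := integral_congr_ae hae
    have h4 : ∫ u, B / C * g₂ u = B / C * ∫ u, g₂ u := integral_const_mul _ _
    rw [h4, one h₁, one h₂] at h3
    linarith
  have h5 : ∫ u, u ^ 2 * |g₁ u| = ∫ u, u ^ 2 * |g₂ u| := by
    refine integral_congr_ae ?_
    filter_upwards [hae] with u hu
    rw [hu, hBC, one_mul]
  rw [second h₁, second h₂] at h5
  have h6 : c₁ ^ 2 = c₂ ^ 2 := mul_right_cancel₀ hm.ne' h5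
  exact hne ((pow_left_inj₀ h₁.le h₂.le two_ne_zero).1 h6)

/-- The moments of the one-sided kernel form the zeroth column of `Γ`, so the integral is the corner
entry of `Γ⁻¹ Γ`. The fit reproduces constants. -/
lemma integral_sideWeight {K : ℝ → ℝ} (hK : IsLocal K) (p : ℕ) {S : Set ℝ} (hS : MeasurableSet S)
    (hΓ : IsUnit (gammaMat p K S).det) : ∫ u, sideWeight p K S u = 1 := by
  simp_rw [sideWeight_eq_sum]
  rw [integral_finsetSum _ fun j _ => (((hK.sideKernel hS).pow_mul _).const_mul _).integrable]
  simp_rw [integral_const_mul]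
  have h1 : ∀ j : Fin (p + 1), ∫ u, u ^ (j : ℕ) * sideKernel K S u = gammaMat p K S j 0 := by
    intro j
    rw [gammaMat_apply p K hS]
    simp
  simp_rw [h1]
  have h2 := congrFun (congrFun (Matrix.nonsing_inv_mul _ hΓ) 0) 0
  rw [Matrix.mul_apply, Matrix.one_apply_eq] at h2
  exact h2

/-- The contribution of the side `S` to the asymptotic variance of `Y - τ D`. -/
def sideVar (w : ℝ → ℝ) (c₁ c₂ τ s₁₁ s₁₂ s₂₂ : ℝ) : ℝ :=
  s₁₁ * (∫ u, (c₁⁻¹ * w (u / c₁)) ^ 2)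
    - 2 * τ * s₁₂ * (∫ u, c₁⁻¹ * w (u / c₁) * (c₂⁻¹ * w (u / c₂)))
    + τ ^ 2 * s₂₂ * ∫ u, (c₂⁻¹ * w (u / c₂)) ^ 2

namespace ResidualCov

variable [IsProbabilityMeasure P] {X E₁ E₂ : Ω → ℝ} {xl xu : ℝ} {S : Set ℝ} {s₁₁ s₁₂ s₂₂ : ℝ}
  {f : ℝ → ℝ}

lemma sideVar_pos_of_ne (hE : ResidualCov P X E₁ E₂ xl xu S s₁₁ s₁₂ s₂₂)
    (hX : HasLocalDensity P X f) (hf : 0 < f 0) (hxl : xl < 0) (hxu : 0 < xu) (hS : IsCone S)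
    {w : ℝ → ℝ} (hw : IsLocal w) (hwS : ∀ u, u ∉ S → w u = 0) (hone : ∫ u, w u = 1)
    {c₁ c₂ : ℝ} (h₁ : 0 < c₁) (h₂ : 0 < c₂) (hne : c₁ ≠ c₂) (hs : 0 < s₁₁) (τ : ℝ) :
    0 < sideVar w c₁ c₂ τ s₁₁ s₁₂ s₂₂ := by
  have hpos := integral_sq_pos_of_integral_ne_zero hw (by rw [hone]; exact one_ne_zero)
  have h := quad_form_pos (a := s₁₁) (b := -τ * s₁₂) (d := τ ^ 2 * s₂₂) hs
    (fun t => by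
      have := hE.form_nonneg hX hf hxl hxu hS hw hwS hpos 1 (-t * τ)
      linarith)
    (integral_nonneg fun u => sq_nonneg (c₁⁻¹ * w (u / c₁)))
    (integral_nonneg fun u => sq_nonneg (c₂⁻¹ * w (u / c₂)))
    (sq_integral_dilation_lt hw hone h₁ h₂ hne)
  rw [sideVar]
  linarith

end ResidualCov

/-- With a common bandwidth the three kernel integrals coincide and factor out. -/
lemma sideVar_pos_of_eq {w : ℝ → ℝ} (hw : IsLocal w) (hone : ∫ u, w u = 1)
    {c τ s₁₁ s₁₂ s₂₂ : ℝ} (hc : 0 < c) (hs : 0 < s₁₁ - 2 * τ * s₁₂ + τ ^ 2 * s₂₂) :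
    0 < sideVar w c c τ s₁₁ s₁₂ s₂₂ := by
  have hpos := integral_sq_pos_of_integral_ne_zero ((hw.comp_div hc).const_mul c⁻¹) (by
    rw [integral_const_mul, integral_comp_div_pos _ hc, hone, mul_one, inv_mul_cancel₀ hc.ne']
    exact one_ne_zero)
  have h1 : sideVar w c c τ s₁₁ s₁₂ s₂₂ =
      (s₁₁ - 2 * τ * s₁₂ + τ ^ 2 * s₂₂) * ∫ u, (c⁻¹ * w (u / c)) ^ 2 := by
    rw [sideVar]
    simp_rw [← pow_two]
    ring
  rw [h1]
  exact mul_pos hs hpos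

variable {Ω : Type*} [MeasurableSpace Ω] {P : Measure Ω}

/-! ### Consequences of the assumptions -/

lemma AssumptionK.isLocal {p : ℕ} {K : ℝ → ℝ} (hK : AssumptionK p K) : IsLocal K := by
  obtain ⟨M, hM⟩ := hK.bounded
  refine ⟨?_, ⟨M, fun u => by rw [abs_of_nonneg (hK.nonneg u)]; exact hM u⟩, ⟨1, fun u hu =>
    hK.support u fun hc => hu.not_ge (abs_le.2 hc)⟩⟩
  have h1 : K = (Icc (-1 : ℝ) 1).indicator K := by
    ext u
    by_cases hu : u ∈ Icc (-1 : ℝ) 1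
    · rw [indicator_of_mem hu]
    · rw [indicator_of_notMem hu, hK.support u hu]
  classical
  rw [h1, ← piecewise_eq_indicator]
  exact hK.cont.measurable_piecewise continuousOn_const measurableSet_Icc

namespace AssumptionS

variable {Y D X : Ω → ℝ} {Ys Ds Xs : ℕ → Ω → ℝ} {f : ℝ → ℝ} {xl xu : ℝ}

lemma hasLocalDensity (hS : AssumptionS P Y D X Ys Ds Xs f xl xu) : HasLocalDensity P X f :=
  ⟨hS.measurable_X, hS.measurable_f, hS.f_nonneg, hS.density,
    hS.f_contDiff.continuousOn.continuousAt (Icc_mem_nhds hS.xl_neg hS.xu_pos)⟩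

lemma sample (hS : AssumptionS P Y D X Ys Ds Xs f xl xu) :
    IsIIDSample P (fun i ω => (Ys i ω, Ds i ω, Xs i ω)) (P.map fun ω => (Y ω, D ω, X ω)) where
  measurable i := (hS.measurable_Ys i).prodMk ((hS.measurable_Ds i).prodMk (hS.measurable_Xs i))
  indep := hS.indep
  law i := (hS.copies i).map_eq

lemma measurable_triple (hS : AssumptionS P Y D X Ys Ds Xs f xl xu) :
    Measurable fun ω => (Y ω, D ω, X ω) :=
  hS.measurable_Y.prodMk (hS.measurable_D.prodMk hS.measurable_X)

lemma sample_fst (hS : AssumptionS P Y D X Ys Ds Xs f xl xu) :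
    IsIIDSample P (fun i ω => (Ys i ω, Xs i ω)) (P.map fun ω => (Y ω, X ω)) := by
  have hg : Measurable fun v : ℝ × ℝ × ℝ => (v.1, v.2.2) := by fun_prop
  have h := hS.sample.map hg
  rwa [Measure.map_map hg hS.measurable_triple] at h

lemma sample_snd (hS : AssumptionS P Y D X Ys Ds Xs f xl xu) :
    IsIIDSample P (fun i ω => (Ds i ω, Xs i ω)) (P.map fun ω => (D ω, X ω)) := by
  have hg : Measurable fun v : ℝ × ℝ × ℝ => (v.2.1, v.2.2) := by fun_prop
  have h := hS.sample.map hg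
  rwa [Measure.map_map hg hS.measurable_triple] at h

end AssumptionS

/-- The restriction of a regression function to `[xl, xu] ∖ {0}`, extended by zero. -/
def punctured (xl xu : ℝ) (μ : ℝ → ℝ) : ℝ → ℝ := (Icc xl xu \ {0}).indicator μ

lemma punctured_of_mem {xl xu x : ℝ} (μ : ℝ → ℝ) (hx : x ∈ Icc xl xu) (h0 : x ≠ 0) :
    punctured xl xu μ x = μ x := indicator_of_mem ((mem_sdiff _).2 ⟨hx, h0⟩) μ

lemma HasLocalDensity.ae_punctured_eq {X : Ω → ℝ} {f : ℝ → ℝ} (hX : HasLocalDensity P X f)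
    (xl xu : ℝ) (μ : ℝ → ℝ) :
    ∀ᵐ ω ∂P, X ω ∈ Icc xl xu → punctured xl xu μ (X ω) = μ (X ω) := by
  filter_upwards [hX.ae_ne_zero] with ω hω hI using punctured_of_mem μ hI hω

/-- The regression function is regular only on the two half-open intervals and arbitrary elsewhere.
Setting it to zero elsewhere yields a bounded measurable version, which over `[xl, xu]` differs from
it only on the null event `X = 0`. -/
lemma response_punctured {X Z : Ω → ℝ} {f μ q : ℝ → ℝ} {xl xu ε M : ℝ} (hX : HasLocalDensity P X f)
    (hxl : xl < 0) (hxu : 0 < xu)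
    (hZ : Measurable Z) (hm : IsCondMeanOn P X Z (Icc xl xu) μ)
    (hL : LipschitzDerivs μ (Ico xl 0)) (hR : LipschitzDerivs μ (Ioc 0 xu)) (hε : 0 < ε)
    (hq : IsCondMeanOn P X (fun ω => |Z ω| ^ (2 + ε)) (Icc xl xu) q)
    (hM : ∀ x ∈ Icc xl xu \ {0}, q x ≤ M) :
    Response P X Z xl xu ε (punctured xl xu μ) where
  measurable_response := hZ
  measurable_mean := by
    have h1 : punctured xl xu μ =
        fun x => (Ico xl 0).indicator μ x + (Ioc 0 xu).indicator μ x := by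
      ext x
      rcases lt_trichotomy x 0 with hx | hx | hx
      · have h2 : x ∉ Ioc 0 xu := fun hc => hc.1.not_gt hx
        by_cases h3 : xl ≤ x
        · rw [punctured_of_mem μ ⟨h3, by linarith [hxu]⟩ hx.ne, indicator_of_notMem h2,
            indicator_of_mem (mem_Ico.2 ⟨h3, hx⟩), add_zero]
        · rw [punctured, indicator_of_notMem (fun hc => h3 hc.1.1), indicator_of_notMem h2,
            indicator_of_notMem (fun hc => h3 hc.1), add_zero]
      · simp [punctured, hx]
      · have h2 : x ∉ Ico xl 0 := fun hc => hc.2.not_gt hx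
        by_cases h3 : x ≤ xu
        · rw [punctured_of_mem μ ⟨by linarith [hxl], h3⟩ hx.ne', indicator_of_notMem h2,
            indicator_of_mem (mem_Ioc.2 ⟨hx, h3⟩), zero_add]
        · rw [punctured, indicator_of_notMem (fun hc => h3 hc.1.2), indicator_of_notMem h2,
            indicator_of_notMem (fun hc => h3 hc.2), zero_add]
    rw [h1]
    exact (hL.measurable_indicator measurableSet_Ico).add
      (hR.measurable_indicator measurableSet_Ioc)
  bdd_mean := by
    obtain ⟨B₁, h₁⟩ := hL.exists_abs_le (r := |xl|) fun x hx => abs_le_abs_of_nonpos hx.2.le hx.1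
    obtain ⟨B₂, h₂⟩ := hR.exists_abs_le (r := |xu|) fun x hx => abs_le_abs_of_nonneg hx.1.le hx.2
    refine ⟨max (max B₁ B₂) 0, fun x => ?_⟩
    by_cases hx : x ∈ Icc xl xu \ {0}
    · rw [punctured, indicator_of_mem hx]
      rcases lt_or_gt_of_ne hx.2 with h0 | h0
      · exact (h₁ x ⟨hx.1.1, h0⟩).trans ((le_max_left _ _).trans (le_max_left _ _))
      · exact (h₂ x ⟨h0, hx.1.2⟩).trans ((le_max_right _ _).trans (le_max_left _ _))
    · rw [punctured, indicator_of_notMem hx, abs_zero]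
      exact le_max_right _ _
  condMean := by
    refine ⟨hm.1, ?_⟩
    filter_upwards [hm.2, hX.ae_punctured_eq xl xu μ] with ω h1 h2 hI
    rw [h1 hI, h2 hI]
  exponent_pos := hε
  moment := ⟨q, M, hq, hM⟩

lemma hasPolyExpansion_punctured {μ : ℝ → ℝ} {xl xu a : ℝ} {S T : Set ℝ} (hxl : xl < 0)
    (hxu : 0 < xu) (hT : HasExpansion μ T a) {s : Set ℝ} (hs : s ∈ 𝓝 (0 : ℝ))
    (hST : ∀ x ∈ s, x ∈ S → x ≠ 0 → x ∈ T) :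
    ∃ c : Fin (2 + 1) → ℝ, c 0 = a ∧ HasPolyExpansion (punctured xl xu μ) S 2 c := by
  obtain ⟨b, d, C, hC⟩ := hT
  refine ⟨![a, b, d], rfl, s ∩ Icc xl xu, inter_mem hs (Icc_mem_nhds hxl hxu), C, ?_⟩
  intro x hx hxS hx0
  rw [punctured_of_mem μ hx.2 hx0]
  have h := hC x (hST x hx.1 hxS hx0)
  have h1 : polyVec 2 x ⬝ᵥ ![a, b, d] = a + b * x + d * x ^ 2 := by
    simp [dotProduct, Fin.sum_univ_three, polyVec]
    ring
  rwa [h1]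

lemma LipschitzDerivs.polyExpansion_right {μ : ℝ → ℝ} {xl xu : ℝ} (hxl : xl < 0) (hxu : 0 < xu)
    (hμ : LipschitzDerivs μ (Ioc 0 xu)) :
    ∃ c : Fin (2 + 1) → ℝ, c 0 = limR μ ∧ HasPolyExpansion (punctured xl xu μ) (Ici 0) 2 c :=
  hasPolyExpansion_punctured hxl hxu (hμ.expansion_right hxu).2 (Iio_mem_nhds hxu)
    fun _ hx hS h0 => ⟨lt_of_le_of_ne hS (Ne.symm h0), hx⟩

lemma LipschitzDerivs.polyExpansion_left {μ : ℝ → ℝ} {xl xu : ℝ} (hxl : xl < 0) (hxu : 0 < xu)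
    (hμ : LipschitzDerivs μ (Ico xl 0)) :
    ∃ c : Fin (2 + 1) → ℝ, c 0 = limL μ ∧ HasPolyExpansion (punctured xl xu μ) (Iic 0) 2 c :=
  hasPolyExpansion_punctured hxl hxu (hμ.expansion_left hxl).2 (Ioi_mem_nhds hxl)
    fun _ hx hS h0 => ⟨hx, lt_of_le_of_ne hS h0⟩

lemma tendsto_nat_mul_bandwidth {h : ℕ → ℝ} (h_pos : ∀ n, 0 < h n)
    (h_lim : Tendsto h atTop (𝓝 0))
    (h2 : Tendsto (fun n : ℕ => (n : ℝ) * h n ^ 2) atTop atTop) :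
    Tendsto (fun n : ℕ => (n : ℝ) * h n) atTop atTop := by
  refine tendsto_atTop_mono' _ ?_ h2
  filter_upwards [h_lim.eventually_lt_const one_pos] with n hn
  refine mul_le_mul_of_nonneg_left ?_ n.cast_nonneg
  nlinarith [h_pos n]

/-- The scaled cubic bias is `√(c⁷ n h⁷)`; this is the origin of the exponent `7`. -/
lemma tendsto_sqrt_mul_bandwidth_pow {h : ℕ → ℝ} {c : ℝ} (hc : 0 < c) (h_pos : ∀ n, 0 < h n)
    (h7 : Tendsto (fun n : ℕ => (n : ℝ) * h n ^ 7) atTop (𝓝 0)) :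
    Tendsto (fun n : ℕ => Real.sqrt (n * (c * h n)) * (c * h n) ^ (2 + 1)) atTop (𝓝 0) := by
  have h1 := (Real.continuous_sqrt.tendsto _).comp (h7.const_mul (c ^ 7))
  rw [mul_zero, Real.sqrt_zero] at h1
  refine h1.congr fun n => ?_
  have h2 : 0 ≤ (c * h n) ^ 3 := by have := h_pos n; positivity
  rw [Function.comp_apply, ← Real.sqrt_sq h2, ← Real.sqrt_mul (by have := h_pos n; positivity)]
  congr 1
  ring

section Design

variable {Y D X : Ω → ℝ} {Ys Ds Xs : ℕ → Ω → ℝ} {f K : ℝ → ℝ} {xl xu : ℝ} {p : ℕ}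
  {μ₁ μ₂ σ₁₁ σ₁₂ σ₂₂ : ℝ → ℝ} {h : ℕ → ℝ} {c₁ c₂ : ℝ}

lemma AssumptionFMRD.exists_fitDesign (hS : AssumptionS P Y D X Ys Ds Xs f xl xu)
    (hK : IsLocal K) (hF : AssumptionFMRD P Y D X xl xu μ₁ μ₂ σ₁₁ σ₂₂ h c₁ c₂) :
    ∃ ε, FitDesign P X Y Xs Ys f (punctured xl xu μ₁) K xl xu ε (fun n => c₁ * h n) 2 ∧
      FitDesign P X D Xs Ds f (punctured xl xu μ₂) K xl xu ε (fun n => c₂ * h n) 2 := by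
  obtain ⟨ε, hε, qY, qD, hY, hD, M, hM⟩ := hF.moments
  have hnh := tendsto_nat_mul_bandwidth hF.h_pos hF.h_tendsto hF.nh2_tendsto
  have hb : ∀ c : ℝ, Tendsto (fun n => c * h n) atTop (𝓝 0) := fun c => by
    simpa using hF.h_tendsto.const_mul c
  have hnb : ∀ c : ℝ, 0 < c → Tendsto (fun n : ℕ => n * (c * h n)) atTop atTop := fun c hc =>
    (hnh.const_mul_atTop hc).congr fun n => by ring
  refine ⟨ε, ?_, ?_⟩
  · exact ⟨hS.hasLocalDensity, hS.f_zero_pos,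
      response_punctured hS.hasLocalDensity hS.xl_neg hS.xu_pos hS.measurable_Y hF.condMean_Y hF.smooth_μ₁_left
        hF.smooth_μ₁_right hε hY fun x hx => (hM x hx).1,
      hS.sample_fst, hS.xl_neg, hS.xu_pos, hK, fun n => mul_pos hF.c₁_pos (hF.h_pos n), hb c₁,
      hnb c₁ hF.c₁_pos, tendsto_sqrt_mul_bandwidth_pow hF.c₁_pos hF.h_pos hF.nh7_tendsto⟩
  · exact ⟨hS.hasLocalDensity, hS.f_zero_pos,
      response_punctured hS.hasLocalDensity hS.xl_neg hS.xu_pos hS.measurable_D hF.condMean_D hF.smooth_μ₂_left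
        hF.smooth_μ₂_right hε hD fun x hx => (hM x hx).2,
      hS.sample_snd, hS.xl_neg, hS.xu_pos, hK, fun n => mul_pos hF.c₂_pos (hF.h_pos n), hb c₂,
      hnb c₂ hF.c₂_pos, tendsto_sqrt_mul_bandwidth_pow hF.c₂_pos hF.h_pos hF.nh7_tendsto⟩

lemma AssumptionFMRD.residualCov (hS : AssumptionS P Y D X Ys Ds Xs f xl xu)
    (hF : AssumptionFMRD P Y D X xl xu μ₁ μ₂ σ₁₁ σ₂₂ h c₁ c₂)
    (hC : CondCovLimits P Y D X xl xu μ₁ μ₂ σ₁₂) {S : Set ℝ} {s₁₁ s₁₂ s₂₂ : ℝ}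
    (t₁ : Tendsto σ₁₁ (𝓝[S \ {0}] 0) (𝓝 s₁₁)) (t₂ : Tendsto σ₁₂ (𝓝[S \ {0}] 0) (𝓝 s₁₂))
    (t₃ : Tendsto σ₂₂ (𝓝[S \ {0}] 0) (𝓝 s₂₂)) :
    ResidualCov P X (fun ω => Y ω - punctured xl xu μ₁ (X ω))
      (fun ω => D ω - punctured xl xu μ₂ (X ω)) xl xu S s₁₁ s₁₂ s₂₂ := by
  have e₁ := hS.hasLocalDensity.ae_punctured_eq xl xu μ₁
  have e₂ := hS.hasLocalDensity.ae_punctured_eq xl xu μ₂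
  refine ⟨⟨σ₁₁, hF.condVar_Y.congr hS.measurable_X measurableSet_Icc ?_, t₁⟩,
    ⟨σ₁₂, hC.condCov.congr hS.measurable_X measurableSet_Icc ?_, t₂⟩,
    ⟨σ₂₂, hF.condVar_D.congr hS.measurable_X measurableSet_Icc ?_, t₃⟩⟩
  · filter_upwards [e₁] with ω h1 hI
    rw [h1 hI]
  · filter_upwards [e₁, e₂] with ω h1 h2 hI
    rw [h1 hI, h2 hI]
  · filter_upwards [e₂] with ω h2 hI
    rw [h2 hI]

end Design

lemma tendsto_resVar {τ : ℝ} {σ₁₁ σ₁₂ σ₂₂ : ℝ → ℝ} {l : Filter ℝ} {s₁₁ s₁₂ s₂₂ : ℝ}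
    (t₁ : Tendsto σ₁₁ l (𝓝 s₁₁)) (t₂ : Tendsto σ₁₂ l (𝓝 s₁₂)) (t₃ : Tendsto σ₂₂ l (𝓝 s₂₂)) :
    Tendsto (resVar τ σ₁₁ σ₁₂ σ₂₂) l (𝓝 (s₁₁ - 2 * τ * s₁₂ + τ ^ 2 * s₂₂)) :=
  (t₁.sub (t₂.const_mul _)).add (t₃.const_mul _)

variable {Ω : Type*} [MeasurableSpace Ω] {P : Measure Ω}

/-! ### Jump estimates and the limit law of the estimator -/

/-- The dilation `u ↦ c⁻¹ w(u / c)`. -/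
def dilate (w : ℝ → ℝ) (c u : ℝ) : ℝ := c⁻¹ * w (u / c)

lemma IsLocal.dilate {w : ℝ → ℝ} (hw : IsLocal w) {c : ℝ} (hc : 0 < c) :
    IsLocal (dilate w c) := (hw.comp_div hc).const_mul c⁻¹

/-- The equivalent kernel of the jump estimate at the cutoff. -/
def jumpWeight (p : ℕ) (K : ℝ → ℝ) (u : ℝ) : ℝ :=
  sideWeight p K (Ici 0) u - sideWeight p K (Iic 0) u

lemma IsLocal.jumpWeight {K : ℝ → ℝ} (hK : IsLocal K) (p : ℕ) : IsLocal (jumpWeight p K) :=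
  (hK.sideWeight p measurableSet_Ici).sub (hK.sideWeight p measurableSet_Iic)

lemma sideWeight_of_notMem (p : ℕ) (K : ℝ → ℝ) {S : Set ℝ} {u : ℝ} (hu : u ∉ S) :
    sideWeight p K S u = 0 := by
  simp [sideWeight, sideKernel, hu]

lemma dilate_sideWeight_of_notMem (p : ℕ) (K : ℝ → ℝ) {S : Set ℝ} (hS : IsCone S) {c u : ℝ}
    (hc : 0 < c) (hu : u ∉ S) : dilate (sideWeight p K S) c u = 0 := by
  rw [dilate, sideWeight_of_notMem p K (mt (hS.div_mem_iff u c hc).1 hu), mul_zero]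

lemma dilate_jumpWeight (p : ℕ) (K : ℝ → ℝ) (c u : ℝ) : dilate (jumpWeight p K) c u =
    dilate (sideWeight p K (Ici 0)) c u - dilate (sideWeight p K (Iic 0)) c u := by
  rw [dilate, dilate, dilate, jumpWeight]
  ring

namespace FitDesign

variable {X Z : Ω → ℝ} {Xs Zs : ℕ → Ω → ℝ} {f m K : ℝ → ℝ} {xl xu ε : ℝ} {p : ℕ}

/-- Normalising by `√(n h)` instead of `√(n c h)` moves the bandwidth constant into the kernel,
which becomes its dilate by `c`. Sums for different `c` can then be added term by term. -/
lemma jump_linear [IsProbabilityMeasure P] {h : ℕ → ℝ} {c : ℝ} (hc : 0 < c)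
    (D : FitDesign P X Z Xs Zs f m K xl xu ε (fun n => c * h n) p)
    (hΓr : IsUnit (gammaMat p K (Ici 0)).det) (hΓl : IsUnit (gammaMat p K (Iic 0)).det)
    {cr cl : Fin (p + 1) → ℝ} (hr : HasPolyExpansion m (Ici 0) p cr)
    (hl : HasPolyExpansion m (Iic 0) p cl) {αp αm : ℕ → Ω → Fin (p + 1) → ℝ}
    (hp : IsLocalPolyFit p K (Ici 0) (fun n => c * h n) Zs Xs αp)
    (hm : IsLocalPolyFit p K (Iic 0) (fun n => c * h n) Zs Xs αm) :
    Tendsto (fun x : ℕ × Ω => αp x.1 x.2 0 - αm x.1 x.2 0) (inProb P) (𝓝 (cr 0 - cl 0)) ∧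
    BddInProb P (fun x : ℕ × Ω => Real.sqrt (x.1 * h x.1) *
      ((αp x.1 x.2 0 - αm x.1 x.2 0) - (cr 0 - cl 0))) ∧
    Tendsto (fun x : ℕ × Ω => Real.sqrt (x.1 * h x.1) *
        ((αp x.1 x.2 0 - αm x.1 x.2 0) - (cr 0 - cl 0)) -
      (f 0)⁻¹ * ∑ i ∈ Finset.range x.1, (Real.sqrt (x.1 * h x.1))⁻¹ *
        (dilate (jumpWeight p K) c (Xs i x.2 / h x.1) * (Zs i x.2 - m (Xs i x.2))))
      (inProb P) (𝓝 0) := by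
  obtain ⟨r1, r2, r3⟩ := D.asymptotically_linear isCone_Ici hΓr hr hp
  obtain ⟨l1, l2, l3⟩ := D.asymptotically_linear isCone_Iic hΓl hl hm
  have hsc : Real.sqrt c ≠ 0 := (Real.sqrt_pos.2 hc).ne'
  have hsq : ∀ n : ℕ, Real.sqrt (n * (c * h n)) = Real.sqrt c * Real.sqrt (n * h n) := by
    intro n
    rw [← Real.sqrt_mul hc.le]
    congr 1
    ring
  refine ⟨?_, ?_, ?_⟩
  · have h1 := ((r1 0).sub (l1 0)).add_const (cr 0 - cl 0)
    rw [sub_zero, zero_add] at h1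
    refine h1.congr fun x => ?_
    simp only [Fin.val_zero, pow_zero]
    ring
  · refine (r2.add l2).mono (Real.sqrt c)⁻¹ (Eventually.of_forall fun x => ?_)
    have h1 : Real.sqrt (x.1 * h x.1) * ((αp x.1 x.2 0 - αm x.1 x.2 0) - (cr 0 - cl 0)) =
        (Real.sqrt c)⁻¹ * (Real.sqrt (x.1 * (c * h x.1)) * (αp x.1 x.2 0 - cr 0) -
          Real.sqrt (x.1 * (c * h x.1)) * (αm x.1 x.2 0 - cl 0)) := by
      rw [hsq]
      field_simp
      ring
    rw [h1, abs_mul, abs_of_nonneg (inv_nonneg.2 (Real.sqrt_nonneg c))]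
    exact mul_le_mul_of_nonneg_left ((abs_sub _ _).trans (le_abs_self _))
      (inv_nonneg.2 (Real.sqrt_nonneg c))
  · have h1 := (r3.sub l3).const_mul (Real.sqrt c)⁻¹
    rw [sub_zero, mul_zero] at h1
    refine h1.congr fun x => ?_
    have hsum : ∀ S : Set ℝ, ∑ i ∈ Finset.range x.1, (Real.sqrt (x.1 * (c * h x.1)))⁻¹ *
          ((f 0)⁻¹ * (sideWeight p K S (Xs i x.2 / (c * h x.1)) * (Zs i x.2 - m (Xs i x.2)))) =
        Real.sqrt c * ((f 0)⁻¹ * ∑ i ∈ Finset.range x.1, (Real.sqrt (x.1 * h x.1))⁻¹ *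
          (dilate (sideWeight p K S) c (Xs i x.2 / h x.1) * (Zs i x.2 - m (Xs i x.2)))) := by
      intro S
      rw [Finset.mul_sum, Finset.mul_sum]
      refine Finset.sum_congr rfl fun i _ => ?_
      rw [hsq, dilate, div_div, mul_comm (h x.1) c, mul_inv]
      have h2 : (Real.sqrt c)⁻¹ = Real.sqrt c * c⁻¹ := by
        rw [inv_eq_iff_eq_inv, mul_inv, inv_inv, eq_inv_mul_iff_mul_eq₀ hsc, Real.mul_self_sqrt hc.le]
      rw [h2]
      ring
    rw [hsum, hsum]
    simp_rw [dilate_jumpWeight, sub_mul (dilate _ _ _), mul_sub (Real.sqrt _)⁻¹]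
    rw [Finset.sum_sub_distrib, hsq]
    set S₁ := ∑ i ∈ Finset.range x.1, (Real.sqrt (x.1 * h x.1))⁻¹ *
      (dilate (sideWeight p K (Ici 0)) c (Xs i x.2 / h x.1) * (Zs i x.2 - m (Xs i x.2)))
    set S₂ := ∑ i ∈ Finset.range x.1, (Real.sqrt (x.1 * h x.1))⁻¹ *
      (dilate (sideWeight p K (Iic 0)) c (Xs i x.2 / h x.1) * (Zs i x.2 - m (Xs i x.2)))
    field_simp
    ring

end FitDesign

/-- The joint design of the two fits. -/
structure FuzzyDesign (P : Measure Ω) (Y D X : Ω → ℝ) (Ys Ds Xs : ℕ → Ω → ℝ)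
    (f m₁ m₂ K : ℝ → ℝ) (xl xu ε : ℝ) (h : ℕ → ℝ) (c₁ c₂ : ℝ) (p : ℕ) : Prop where
  fst : FitDesign P X Y Xs Ys f m₁ K xl xu ε (fun n => c₁ * h n) p
  snd : FitDesign P X D Xs Ds f m₂ K xl xu ε (fun n => c₂ * h n) p
  sample : IsIIDSample P (fun i ω => (Ys i ω, Ds i ω, Xs i ω)) (P.map fun ω => (Y ω, D ω, X ω))
  h_pos : ∀ n, 0 < h n
  h_lim : Tendsto h atTop (𝓝 0)
  nh_lim : Tendsto (fun n : ℕ => n * h n) atTop atTop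
  c₁_pos : 0 < c₁
  c₂_pos : 0 < c₂

/-- The summands of the linear approximation to `κ₁ μ̂₁ + κ₂ μ̂₂`, where `μ̂ₖ` are the jump
estimates. -/
def score (w : ℝ → ℝ) (c₁ c₂ : ℝ) (m₁ m₂ : ℝ → ℝ) (κ₁ κ₂ a : ℝ) (v : ℝ × ℝ × ℝ) : ℝ :=
  κ₁ * dilate w c₁ (v.2.2 / a) * (v.1 - m₁ v.2.2) +
    κ₂ * dilate w c₂ (v.2.2 / a) * (v.2.1 - m₂ v.2.2)

/-- The contribution of one side to the variance of the score. -/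
def sideForm (w : ℝ → ℝ) (c₁ c₂ κ₁ κ₂ s₁₁ s₁₂ s₂₂ : ℝ) : ℝ :=
  s₁₁ * (∫ u, (κ₁ * dilate w c₁ u) ^ 2)
    + 2 * s₁₂ * (∫ u, κ₁ * dilate w c₁ u * (κ₂ * dilate w c₂ u))
    + s₂₂ * ∫ u, (κ₂ * dilate w c₂ u) ^ 2

lemma sideForm_eq_sideVar (w : ℝ → ℝ) (c₁ c₂ κ τ s₁₁ s₁₂ s₂₂ : ℝ) :
    sideForm w c₁ c₂ κ (-τ * κ) s₁₁ s₁₂ s₂₂ = κ ^ 2 * sideVar w c₁ c₂ τ s₁₁ s₁₂ s₂₂ := by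
  have h : ∀ a b : ℝ, ∀ g k : ℝ → ℝ, ∫ u, a * g u * (b * k u) = a * b * ∫ u, g u * k u := by
    intro a b g k
    rw [← integral_const_mul]
    congr 1
    ext u
    ring
  rw [sideForm, sideVar]
  simp_rw [pow_two (_ * _)]
  rw [h κ κ (dilate w c₁) (dilate w c₁), h κ (-τ * κ) (dilate w c₁) (dilate w c₂),
    h (-τ * κ) (-τ * κ) (dilate w c₂) (dilate w c₂)]
  simp only [dilate]
  ring

namespace FuzzyDesign

variable {Y D X : Ω → ℝ} {Ys Ds Xs : ℕ → Ω → ℝ}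
  {f m₁ m₂ K : ℝ → ℝ} {xl xu ε : ℝ} {h : ℕ → ℝ} {c₁ c₂ : ℝ} {p : ℕ}
  {r₁₁ r₁₂ r₂₂ l₁₁ l₁₂ l₂₂ : ℝ}

lemma measurable_triple (hD : FuzzyDesign P Y D X Ys Ds Xs f m₁ m₂ K xl xu ε h c₁ c₂ p) :
    Measurable fun ω => (Y ω, D ω, X ω) :=
  hD.fst.response.measurable_response.prodMk
    (hD.snd.response.measurable_response.prodMk hD.fst.density.measurable)

lemma measurable_score (hD : FuzzyDesign P Y D X Ys Ds Xs f m₁ m₂ K xl xu ε h c₁ c₂ p)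
    (κ₁ κ₂ a : ℝ) : Measurable (score (jumpWeight p K) c₁ c₂ m₁ m₂ κ₁ κ₂ a) := by
  have hJ := hD.fst.kernel.jumpWeight p
  have h1 := (hJ.dilate hD.c₁_pos).measurable
  have h2 := (hJ.dilate hD.c₂_pos).measurable
  have h3 := hD.fst.response.measurable_mean
  have h4 := hD.snd.response.measurable_mean
  unfold score
  fun_prop

lemma moment_score [IsProbabilityMeasure P]
    (hD : FuzzyDesign P Y D X Ys Ds Xs f m₁ m₂ K xl xu ε h c₁ c₂ p)
    (κ₁ κ₂ : ℝ) :
    ∃ C, ∀ᶠ n in atTop, Integrable (fun ω => |score (jumpWeight p K) c₁ c₂ m₁ m₂ κ₁ κ₂ (h n)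
        (Y ω, D ω, X ω)| ^ (2 + ε)) P ∧
      (h n)⁻¹ * ∫ ω, |score (jumpWeight p K) c₁ c₂ m₁ m₂ κ₁ κ₂ (h n)
        (Y ω, D ω, X ω)| ^ (2 + ε) ∂P ≤ C := by
  have hJ := hD.fst.kernel.jumpWeight p
  obtain ⟨C₁, h₁⟩ := hD.fst.response.moment_local_resid_le hD.fst.density hD.fst.xl_neg
    hD.fst.xu_pos hD.h_pos hD.h_lim ((hJ.dilate hD.c₁_pos).const_mul κ₁)
  obtain ⟨C₂, h₂⟩ := hD.snd.response.moment_local_resid_le hD.fst.density hD.fst.xl_neg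
    hD.fst.xu_pos hD.h_pos hD.h_lim ((hJ.dilate hD.c₂_pos).const_mul κ₂)
  have hε := hD.fst.response.exponent_pos
  refine ⟨2 ^ (2 + ε) * (C₁ + C₂), ?_⟩
  filter_upwards [h₁, h₂] with n ⟨i₁, b₁⟩ ⟨i₂, b₂⟩
  have hdom := (i₁.add i₂).const_mul (2 ^ (2 + ε))
  have hpt : ∀ ω, |score (jumpWeight p K) c₁ c₂ m₁ m₂ κ₁ κ₂ (h n) (Y ω, D ω, X ω)| ^ (2 + ε) ≤
      2 ^ (2 + ε) * (|κ₁ * dilate (jumpWeight p K) c₁ (X ω / h n) * (Y ω - m₁ (X ω))| ^ (2 + ε) +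
        |κ₂ * dilate (jumpWeight p K) c₂ (X ω / h n) * (D ω - m₂ (X ω))| ^ (2 + ε)) :=
    fun ω => abs_add_rpow_le _ _ (by linarith)
  have hint : Integrable (fun ω => |score (jumpWeight p K) c₁ c₂ m₁ m₂ κ₁ κ₂ (h n)
      (Y ω, D ω, X ω)| ^ (2 + ε)) P := by
    refine hdom.mono' ?_ (Eventually.of_forall fun ω => ?_)
    · have h1 := (hD.measurable_score κ₁ κ₂ (h n)).comp hD.measurable_triple
      exact (h1.abs.pow_const _).aestronglyMeasurable
    · rw [Real.norm_eq_abs, abs_of_nonneg (Real.rpow_nonneg (abs_nonneg _) _)]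
      exact hpt ω
  refine ⟨hint, ?_⟩
  have h3 := integral_mono hint hdom hpt
  simp only [Pi.add_apply] at h3
  rw [integral_const_mul, integral_add i₁ i₂] at h3
  calc _ ≤ (h n)⁻¹ * _ := mul_le_mul_of_nonneg_left h3 (inv_nonneg.2 (hD.h_pos n).le)
    _ = 2 ^ (2 + ε) * ((h n)⁻¹ * _ + (h n)⁻¹ * _) := by rw [← mul_add]; ring
    _ ≤ _ := mul_le_mul_of_nonneg_left (add_le_add b₁ b₂) (by positivity)

lemma integral_score [IsProbabilityMeasure P]
    (hD : FuzzyDesign P Y D X Ys Ds Xs f m₁ m₂ K xl xu ε h c₁ c₂ p)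
    (κ₁ κ₂ : ℝ) : ∀ᶠ n in atTop,
      ∫ ω, score (jumpWeight p K) c₁ c₂ m₁ m₂ κ₁ κ₂ (h n) (Y ω, D ω, X ω) ∂P = 0 := by
  have hJ := hD.fst.kernel.jumpWeight p
  filter_upwards [hD.fst.response.integral_resid_eq_zero hD.fst.density hD.fst.xl_neg
    hD.fst.xu_pos hD.h_pos hD.h_lim ((hJ.dilate hD.c₁_pos).const_mul κ₁),
    hD.snd.response.integral_resid_eq_zero hD.fst.density hD.fst.xl_neg
    hD.fst.xu_pos hD.h_pos hD.h_lim ((hJ.dilate hD.c₂_pos).const_mul κ₂)] with n ⟨i₁, e₁⟩ ⟨i₂, e₂⟩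
  have h1 := integral_add i₁ i₂
  rw [e₁, e₂, add_zero] at h1
  exact h1

/-- For `X ≠ 0` only one of the two side kernels is nonzero, so the squared score has no cross term
between sides and the variance is a sum of two one-sided forms. -/
lemma tendsto_integral_sq_score [IsProbabilityMeasure P]
    (hD : FuzzyDesign P Y D X Ys Ds Xs f m₁ m₂ K xl xu ε h c₁ c₂ p)
    (hR : ResidualCov P X (fun ω => Y ω - m₁ (X ω)) (fun ω => D ω - m₂ (X ω)) xl xu (Ici 0)
      r₁₁ r₁₂ r₂₂)
    (hL : ResidualCov P X (fun ω => Y ω - m₁ (X ω)) (fun ω => D ω - m₂ (X ω)) xl xu (Iic 0)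
      l₁₁ l₁₂ l₂₂) (κ₁ κ₂ : ℝ) :
    Tendsto (fun n => (h n)⁻¹ * ∫ ω, score (jumpWeight p K) c₁ c₂ m₁ m₂ κ₁ κ₂ (h n)
      (Y ω, D ω, X ω) ^ 2 ∂P) atTop
      (𝓝 (f 0 * (sideForm (sideWeight p K (Ici 0)) c₁ c₂ κ₁ κ₂ r₁₁ r₁₂ r₂₂ +
        sideForm (sideWeight p K (Iic 0)) c₁ c₂ κ₁ κ₂ l₁₁ l₁₂ l₂₂))) := by
  have hwr := hD.fst.kernel.sideWeight p (S := Ici 0) measurableSet_Ici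
  have hwl := hD.fst.kernel.sideWeight p (S := Iic 0) measurableSet_Iic
  have hz : ∀ {S : Set ℝ} {c : ℝ}, IsCone S → 0 < c → ∀ κ u, u ∉ S →
      κ * dilate (sideWeight p K S) c u = 0 := fun hS hc κ u hu => by
    rw [dilate_sideWeight_of_notMem p K hS hc hu, mul_zero]
  obtain ⟨iR, tR⟩ := hR.tendsto_quad hD.fst.density hD.fst.xl_neg hD.fst.xu_pos hD.h_pos hD.h_lim
    isCone_Ici ((hwr.dilate hD.c₁_pos).const_mul κ₁) ((hwr.dilate hD.c₂_pos).const_mul κ₂)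
    (hz isCone_Ici hD.c₁_pos κ₁) (hz isCone_Ici hD.c₂_pos κ₂)
  obtain ⟨iL, tL⟩ := hL.tendsto_quad hD.fst.density hD.fst.xl_neg hD.fst.xu_pos hD.h_pos hD.h_lim
    isCone_Iic ((hwl.dilate hD.c₁_pos).const_mul κ₁) ((hwl.dilate hD.c₂_pos).const_mul κ₂)
    (hz isCone_Iic hD.c₁_pos κ₁) (hz isCone_Iic hD.c₂_pos κ₂)
  have hsum := tR.add tL
  rw [← mul_add] at hsum
  refine hsum.congr' ?_
  filter_upwards [iR, iL] with n hR' hL'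
  rw [← mul_add, ← integral_add hR' hL']
  congr 1
  refine integral_congr_ae ?_
  filter_upwards [hD.fst.density.ae_ne_zero] with ω hω
  simp only [score, dilate_jumpWeight]
  rcases lt_or_gt_of_ne hω with h0 | h0
  · have hn : X ω / h n ∉ Ici (0 : ℝ) := fun hc =>
      (div_neg_of_neg_of_pos h0 (hD.h_pos n)).not_ge hc
    rw [dilate_sideWeight_of_notMem p K isCone_Ici hD.c₁_pos hn,
      dilate_sideWeight_of_notMem p K isCone_Ici hD.c₂_pos hn]
    ring
  · have hn : X ω / h n ∉ Iic (0 : ℝ) := fun hc => (div_pos h0 (hD.h_pos n)).not_ge hc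
    rw [dilate_sideWeight_of_notMem p K isCone_Iic hD.c₁_pos hn,
      dilate_sideWeight_of_notMem p K isCone_Iic hD.c₂_pos hn]
    ring

/-- The limit law of the ratio of the two jump estimates. -/
lemma tendstoInDistribution_ratio [IsProbabilityMeasure P]
    (hD : FuzzyDesign P Y D X Ys Ds Xs f m₁ m₂ K xl xu ε h c₁ c₂ p)
    (hR : ResidualCov P X (fun ω => Y ω - m₁ (X ω)) (fun ω => D ω - m₂ (X ω)) xl xu (Ici 0)
      r₁₁ r₁₂ r₂₂)
    (hL : ResidualCov P X (fun ω => Y ω - m₁ (X ω)) (fun ω => D ω - m₂ (X ω)) xl xu (Iic 0)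
      l₁₁ l₁₂ l₂₂)
    (hΓr : IsUnit (gammaMat p K (Ici 0)).det) (hΓl : IsUnit (gammaMat p K (Iic 0)).det)
    {cr₁ cl₁ cr₂ cl₂ : Fin (p + 1) → ℝ} (hr₁ : HasPolyExpansion m₁ (Ici 0) p cr₁)
    (hl₁ : HasPolyExpansion m₁ (Iic 0) p cl₁) (hr₂ : HasPolyExpansion m₂ (Ici 0) p cr₂)
    (hl₂ : HasPolyExpansion m₂ (Iic 0) p cl₂) (hne : cr₂ 0 - cl₂ 0 ≠ 0)
    {α₁p α₁m α₂p α₂m : ℕ → Ω → Fin (p + 1) → ℝ}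
    (h₁p : IsLocalPolyFit p K (Ici 0) (fun n => c₁ * h n) Ys Xs α₁p)
    (h₁m : IsLocalPolyFit p K (Iic 0) (fun n => c₁ * h n) Ys Xs α₁m)
    (h₂p : IsLocalPolyFit p K (Ici 0) (fun n => c₂ * h n) Ds Xs α₂p)
    (h₂m : IsLocalPolyFit p K (Iic 0) (fun n => c₂ * h n) Ds Xs α₂m) {τ κ : ℝ}
    (hτ : τ = (cr₁ 0 - cl₁ 0) / (cr₂ 0 - cl₂ 0)) (hκ : κ = (f 0 * (cr₂ 0 - cl₂ 0))⁻¹)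
    {s : ℝ≥0} (hs : s = f 0 * (sideForm (sideWeight p K (Ici 0)) c₁ c₂ κ (-τ * κ) r₁₁ r₁₂ r₂₂ +
        sideForm (sideWeight p K (Iic 0)) c₁ c₂ κ (-τ * κ) l₁₁ l₁₂ l₂₂)) :
    TendstoInDistribution (fun (n : ℕ) ω => Real.sqrt (n * h n) *
        (tauHat p (α₁p n ω) (α₁m n ω) (α₂p n ω) (α₂m n ω) - τ))
      atTop (id : ℝ → ℝ) (fun _ => P) (gaussianReal 0 s) := by
  obtain ⟨C, hC⟩ := hD.moment_score κ (-τ * κ)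
  have hvar := hD.tendsto_integral_sq_score hR hL κ (-τ * κ)
  rw [← hs] at hvar
  have hclt := hD.sample.tendstoInDistribution_sum_scaled hD.measurable_triple hD.h_pos hD.nh_lim
    (fun n => hD.measurable_score κ (-τ * κ) (h n)) hD.fst.response.exponent_pos hC hvar
    (hD.integral_score κ (-τ * κ))
  refine tendstoInDistribution_of_tendstoInMeasure_sub _ _ hclt ?_ fun n => ?_
  · obtain ⟨-, b₁, t₁⟩ := hD.fst.jump_linear hD.c₁_pos hΓr hΓl hr₁ hl₁ h₁p h₁m
    obtain ⟨a₂, b₂, t₂⟩ := hD.snd.jump_linear hD.c₂_pos hΓr hΓl hr₂ hl₂ h₂p h₂m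
    set J₁ : ℝ := cr₁ 0 - cl₁ 0 with hJ₁
    set J₂ : ℝ := cr₂ 0 - cl₂ 0 with hJ₂
    refine tendstoInMeasure_iff_inProb.2 ?_
    have hE : Tendsto (fun x : ℕ × Ω => (α₂p x.1 x.2 0 - α₂m x.1 x.2 0)⁻¹ - J₂⁻¹) (inProb P)
        (𝓝 0) := by
      simpa using (a₂.inv₀ hne).sub_const J₂⁻¹
    have e1 := b₁.mul_tendsto_zero hE
    have e2 := b₂.mul_tendsto_zero hE
    -- As `J₁ = τ J₂`, the scaled error is `Ĵ₂⁻¹ (L₁ - τ L₂)` with `L_k = √(n h) (Ĵ_k - J_k)`. The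
    -- first part linearises `L_k` under the fixed factor `J₂⁻¹`; the second replaces `J₂⁻¹` by
    -- `Ĵ₂⁻¹` at a negligible cost.
    have e3 := ((t₁.sub (t₂.const_mul τ)).const_mul J₂⁻¹).add (e1.sub (e2.const_mul τ))
    simp only [mul_zero, sub_zero, add_zero] at e3
    refine e3.congr' ?_
    filter_upwards [a₂.eventually_ne hne] with x hx
    have hf : f 0 ≠ 0 := hD.fst.density_pos.ne'
    have hsum : ∑ i ∈ Finset.range x.1, (Real.sqrt (x.1 * h x.1))⁻¹ *
        score (jumpWeight p K) c₁ c₂ m₁ m₂ κ (-τ * κ) (h x.1) (Ys i x.2, Ds i x.2, Xs i x.2) =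
        κ * (∑ i ∈ Finset.range x.1, (Real.sqrt (x.1 * h x.1))⁻¹ *
          (dilate (jumpWeight p K) c₁ (Xs i x.2 / h x.1) * (Ys i x.2 - m₁ (Xs i x.2))) -
          τ * ∑ i ∈ Finset.range x.1, (Real.sqrt (x.1 * h x.1))⁻¹ *
          (dilate (jumpWeight p K) c₂ (Xs i x.2 / h x.1) * (Ds i x.2 - m₂ (Xs i x.2)))) := by
      rw [Finset.mul_sum, ← Finset.sum_sub_distrib, Finset.mul_sum]
      refine Finset.sum_congr rfl fun i _ => ?_
      rw [score]
      ring
    simp only [Pi.sub_apply]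
    rw [hsum, tauHat, hκ, mul_inv]
    have hτ' : J₁ = τ * J₂ := by rw [hτ]; field_simp
    rw [hτ']
    set S₁ := ∑ i ∈ Finset.range x.1, (Real.sqrt (x.1 * h x.1))⁻¹ *
      (dilate (jumpWeight p K) c₁ (Xs i x.2 / h x.1) * (Ys i x.2 - m₁ (Xs i x.2)))
    set S₂ := ∑ i ∈ Finset.range x.1, (Real.sqrt (x.1 * h x.1))⁻¹ *
      (dilate (jumpWeight p K) c₂ (Xs i x.2 / h x.1) * (Ds i x.2 - m₂ (Xs i x.2)))
    field_simp
    ring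
  · have k₁ := measurable_pi_iff.1 (h₁p n).1 0
    have k₂ := measurable_pi_iff.1 (h₁m n).1 0
    have k₃ := measurable_pi_iff.1 (h₂p n).1 0
    have k₄ := measurable_pi_iff.1 (h₂m n).1 0
    exact ((((k₁.sub k₂).div (k₃.sub k₄)).sub_const τ).const_mul _).aemeasurable

end FuzzyDesign

variable {Ω : Type*} [MeasurableSpace Ω] {P : Measure Ω}

/-! ### The multiplier bootstrap -/

/-- Cauchy–Schwarz kills the cross term. This is how each approximation error is removed from the
conditional variance. -/
lemma tendsto_sum_sq_add {ι : Type*} {l : Filter ι} {s : ι → Finset ℕ} {a b : ι → ℕ → ℝ} {v : ℝ}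
    (ha : Tendsto (fun x => ∑ i ∈ s x, a x i ^ 2) l (𝓝 v))
    (hb : Tendsto (fun x => ∑ i ∈ s x, b x i ^ 2) l (𝓝 0)) :
    Tendsto (fun x => ∑ i ∈ s x, (a x i + b x i) ^ 2) l (𝓝 v) := by
  have h1 : Tendsto (fun x => (∑ i ∈ s x, a x i * b x i) ^ 2) l (𝓝 0) := by
    have h2 := ha.mul hb
    rw [mul_zero] at h2
    exact squeeze_zero (fun x => sq_nonneg _)
      (fun x => Finset.sum_mul_sq_le_sq_mul_sq (s x) (a x) (b x)) h2
  have h3 : Tendsto (fun x => ∑ i ∈ s x, a x i * b x i) l (𝓝 0) := by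
    rw [tendsto_zero_iff_abs_tendsto_zero]
    have h4 := (Real.continuous_sqrt.tendsto _).comp h1
    rw [Real.sqrt_zero] at h4
    exact h4.congr fun x => Real.sqrt_sq_eq_abs _
  have h5 := (ha.add (h3.const_mul 2)).add hb
  rw [mul_zero, add_zero, add_zero] at h5
  refine h5.congr fun x => ?_
  rw [Finset.mul_sum, ← Finset.sum_add_distrib, ← Finset.sum_add_distrib]
  exact Finset.sum_congr rfl fun i _ => by ring

lemma tendsto_sum_sq_mul {ι : Type*} {l : Filter ι} {s : ι → Finset ℕ} {a : ι → ℕ → ℝ}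
    {t : ι → ℝ} {v t₀ : ℝ} (ha : Tendsto (fun x => ∑ i ∈ s x, a x i ^ 2) l (𝓝 v))
    (ht : Tendsto t l (𝓝 t₀)) :
    Tendsto (fun x => ∑ i ∈ s x, (t x * a x i) ^ 2) l (𝓝 (t₀ ^ 2 * v)) := by
  refine ((ht.pow 2).mul ha).congr fun x => ?_
  rw [Finset.mul_sum]
  exact Finset.sum_congr rfl fun i _ => by ring

lemma muTilde_of_pos (p : ℕ) (h : ℝ) (αp αm : Fin (p + 1) → ℝ) {x : ℝ} (hx : 0 < x) :
    muTilde p h αp αm x = polyVec p (x / h) ⬝ᵥ αp := by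
  simp [muTilde, hx.le, hx]

lemma muTilde_of_neg (p : ℕ) (h : ℝ) (αp αm : Fin (p + 1) → ℝ) {x : ℝ} (hx : x < 0) :
    muTilde p h αp αm x = polyVec p (x / h) ⬝ᵥ αm := by
  simp [muTilde, hx.le, hx]

namespace FitDesign

variable {X Z : Ω → ℝ} {Xs Zs : ℕ → Ω → ℝ} {f m K : ℝ → ℝ} {xl xu ε : ℝ} {p : ℕ}

/-- Uniform consistency of a one-sided fit on shrinking neighbourhoods of the cutoff. -/
lemma exists_fit_error [IsProbabilityMeasure P] {b : ℕ → ℝ}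
    (D : FitDesign P X Z Xs Zs f m K xl xu ε b p) {S : Set ℝ} (hS : IsCone S)
    (hΓ : IsUnit (gammaMat p K S).det) {c : Fin (p + 1) → ℝ} (hc : HasPolyExpansion m S p c)
    {α : ℕ → Ω → Fin (p + 1) → ℝ} (hα : IsLocalPolyFit p K S b Zs Xs α) (R : ℝ) :
    ∃ e : ℕ × Ω → ℝ, Tendsto e (inProb P) (𝓝 0) ∧ ∀ᶠ x in inProb P, ∀ y ∈ S, y ≠ 0 →
      |y / b x.1| ≤ R → |polyVec p (y / b x.1) ⬝ᵥ α x.1 x.2 - m y| ≤ e x := by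
  obtain ⟨s, hs, C, hC⟩ := hc
  have hb := D.b_lim.comp (tendsto_fst_inProb (P := P))
  -- The first term bounds the coefficient error on `|u| ≤ R`, the second the Taylor remainder at
  -- `|y| ≤ R b`.
  refine ⟨fun x => ∑ j : Fin (p + 1), R ^ (j : ℕ) * |α x.1 x.2 j - c j * b x.1 ^ (j : ℕ)| +
    |C| * (R * b x.1) ^ (p + 1), ?_, ?_⟩
  · have h1 : Tendsto (fun x : ℕ × Ω => ∑ j : Fin (p + 1),
        R ^ (j : ℕ) * |α x.1 x.2 j - c j * b x.1 ^ (j : ℕ)|) (inProb P)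
        (𝓝 (∑ j : Fin (p + 1), R ^ (j : ℕ) * |(0 : ℝ)|)) :=
      tendsto_finsetSum _ fun j _ =>
        (((D.asymptotically_linear hS hΓ ⟨s, hs, C, hC⟩ hα).1 j).abs).const_mul _
    have h2 := h1.add (((hb.const_mul R).pow (p + 1)).const_mul |C|)
    simpa using h2
  · obtain ⟨r, hr, hrs⟩ := Metric.mem_nhds_iff.1 hs
    have h1 := hb.const_mul R
    rw [mul_zero] at h1
    filter_upwards [h1.eventually_lt_const hr] with x hx y hyS hy0 hyR
    have hbx := D.b_pos x.1
    have hy1 : |y| ≤ R * b x.1 := by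
      rwa [abs_div, abs_of_pos hbx, div_le_iff₀ hbx] at hyR
    have hys : y ∈ s := hrs (by
      rw [Metric.mem_ball, Real.dist_eq, sub_zero]
      exact hy1.trans_lt hx)
    have h2 := hC y hys hyS hy0
    have h3 : polyVec p (y / b x.1) ⬝ᵥ α x.1 x.2 - m y =
        ∑ j : Fin (p + 1), polyVec p (y / b x.1) j * (α x.1 x.2 j - c j * b x.1 ^ (j : ℕ)) -
          (m y - polyVec p y ⬝ᵥ c) := by
      rw [← polyVec_div_dotProduct p y hbx.ne' c]
      simp_rw [mul_sub]
      rw [Finset.sum_sub_distrib]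
      simp only [dotProduct]
      ring
    rw [h3]
    refine (abs_sub _ _).trans (add_le_add ?_ ?_)
    · refine (Finset.abs_sum_le_sum_abs _ _).trans (Finset.sum_le_sum fun j _ => ?_)
      rw [abs_mul, polyVec, abs_pow]
      gcongr
    · refine h2.trans ?_
      gcongr
      exact le_abs_self C

/-- The residuals of the fit and the residuals of the regression function are close in the local
empirical `L²` norm. -/
lemma tendsto_sum_sq_fit_error [IsProbabilityMeasure P] {h : ℕ → ℝ} {c : ℝ} (hc : 0 < c)
    (D : FitDesign P X Z Xs Zs f m K xl xu ε (fun n => c * h n) p) (h_pos : ∀ n, 0 < h n)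
    (h_lim : Tendsto h atTop (𝓝 0)) (hnh : Tendsto (fun n : ℕ => n * h n) atTop atTop)
    (hΓr : IsUnit (gammaMat p K (Ici 0)).det) (hΓl : IsUnit (gammaMat p K (Iic 0)).det)
    {cr cl : Fin (p + 1) → ℝ} (hr : HasPolyExpansion m (Ici 0) p cr)
    (hl : HasPolyExpansion m (Iic 0) p cl) {αp αm : ℕ → Ω → Fin (p + 1) → ℝ}
    (hp : IsLocalPolyFit p K (Ici 0) (fun n => c * h n) Zs Xs αp)
    (hm : IsLocalPolyFit p K (Iic 0) (fun n => c * h n) Zs Xs αm) {g : ℝ → ℝ} (hg : IsLocal g) :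
    Tendsto (fun x : ℕ × Ω => ∑ i ∈ Finset.range x.1, ((Real.sqrt (x.1 * h x.1))⁻¹ *
      (g (Xs i x.2 / h x.1) * (muTilde p (c * h x.1) (αp x.1 x.2) (αm x.1 x.2) (Xs i x.2) -
        m (Xs i x.2)))) ^ 2) (inProb P) (𝓝 0) := by
  obtain ⟨R, -, hR⟩ := hg.exists_pos_supp
  obtain ⟨er, tr, br⟩ := D.exists_fit_error isCone_Ici hΓr hr hp (R / c)
  obtain ⟨el, tl, bl⟩ := D.exists_fit_error isCone_Iic hΓl hl hm (R / c)
  have hN := D.sample_X.tendsto_sum_local D.density h_pos h_lim hnh hg.sq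
  -- The uniform squared errors of the two sides factor out of the sum, leaving a convergent kernel
  -- average.
  have hlim := ((tr.pow 2).add (tl.pow 2)).mul hN
  rw [zero_pow two_ne_zero, add_zero, zero_mul] at hlim
  refine squeeze_zero' (Eventually.of_forall fun x => Finset.sum_nonneg fun i _ => sq_nonneg _)
    ?_ hlim
  -- At `0` both indicators in `muTilde` equal one and the fits would be added; almost surely no
  -- observation lies there.
  have h0 : ∀ᶠ x in inProb P, ∀ i, Xs i x.2 ≠ 0 :=
    eventually_inProb_of_ae (p := fun x => ∀ i, Xs i x.2 ≠ 0) (Eventually.of_forall fun _ => D.ae_ne_zero)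
  filter_upwards [br, bl, h0] with x hbr hbl hx0
  rw [Finset.mul_sum]
  refine Finset.sum_le_sum fun i _ => ?_
  have hhx := h_pos x.1
  have hnn : (0 : ℝ) ≤ x.1 * h x.1 := mul_nonneg x.1.cast_nonneg hhx.le
  rw [mul_pow, mul_pow, inv_pow, Real.sq_sqrt hnn]
  by_cases hy : R < |Xs i x.2 / h x.1|
  · rw [hR _ hy]
    simp
  · have hyR : |Xs i x.2 / (c * h x.1)| ≤ R / c := by
      rw [mul_comm c, ← div_div, abs_div, abs_of_pos hc]
      gcongr
      exact not_lt.1 hy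
    have herr : (muTilde p (c * h x.1) (αp x.1 x.2) (αm x.1 x.2) (Xs i x.2) - m (Xs i x.2)) ^ 2 ≤
        er x ^ 2 + el x ^ 2 := by
      rcases lt_or_gt_of_ne (hx0 i) with hs | hs
      · rw [muTilde_of_neg p _ _ _ hs]
        have h1 := sq_le_sq' ((abs_le.1 (hbl _ hs.le hs.ne hyR)).1) (abs_le.1 (hbl _ hs.le hs.ne hyR)).2
        exact h1.trans (le_add_of_nonneg_left (sq_nonneg _))
      · rw [muTilde_of_pos p _ _ _ hs]
        have h1 := sq_le_sq' ((abs_le.1 (hbr _ hs.le hs.ne' hyR)).1) (abs_le.1 (hbr _ hs.le hs.ne' hyR)).2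
        exact h1.trans (le_add_of_nonneg_right (sq_nonneg _))
    calc (x.1 * h x.1)⁻¹ * (g (Xs i x.2 / h x.1) ^ 2 * _ ^ 2)
        ≤ (x.1 * h x.1)⁻¹ * (g (Xs i x.2 / h x.1) ^ 2 * (er x ^ 2 + el x ^ 2)) := by gcongr
      _ = _ := by ring

end FitDesign

/-- The multiplier statistic as a weighted sum of the multipliers. -/
lemma empDiff_eq_sum (p : ℕ) (K : ℝ → ℝ) (n : ℕ) {c h : ℝ} (hc : 0 < c) (hh : 0 < h)
    (fhat : ℝ) (αp αm : Fin (p + 1) → ℝ) (z x ξ : ℕ → ℝ) :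
    empDiff p K n c h fhat αp αm z x ξ = ∑ i ∈ Finset.range n,
      fhat⁻¹ * ((Real.sqrt (n * h))⁻¹ * (dilate (jumpWeight p K) c (x i / h) *
        (z i - muTilde p (c * h) αp αm (x i)))) * ξ i := by
  have hsq : Real.sqrt (n * (c * h)) = Real.sqrt c * Real.sqrt (n * h) := by
    rw [← Real.sqrt_mul hc.le]
    congr 1
    ring
  have hinv : c⁻¹ = (Real.sqrt c)⁻¹ * (Real.sqrt c)⁻¹ := by
    rw [← mul_inv, Real.mul_self_sqrt hc.le]
  rw [empDiff, emp, emp, ← Finset.sum_sub_distrib, Finset.sum_div]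
  refine Finset.sum_congr rfl fun i _ => ?_
  have hw : ∀ S : Set ℝ, IsCone S → ((gammaMat p K S)⁻¹ *ᵥ polyVec p (x i / (c * h))) 0 *
      (z i - muTilde p (c * h) αp αm (x i)) * K (x i / (c * h)) * S.indicator 1 (x i) =
      sideWeight p K S (x i / h / c) * (z i - muTilde p (c * h) αp αm (x i)) := by
    intro S hS
    rw [div_div, mul_comm h c, sideWeight, sideKernel, hS.indicator_div (mul_pos hc hh)]
    ring
  rw [hw _ isCone_Ici, hw _ isCone_Iic, dilate, jumpWeight, hsq, hinv]
  simp only [div_eq_mul_inv, mul_inv]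
  ring

/-- Division by zero being zero, the identity holds even when the estimated first stage vanishes, so
the bootstrap ratio is linear in the multipliers for every sample. -/
lemma bootRatio_eq (p : ℕ) (α₁p α₁m α₂p α₂m : Fin (p + 1) → ℝ) (X₁ X₂ : ℝ) :
    bootRatio p α₁p α₁m α₂p α₂m X₁ X₂ =
      (α₂p 0 - α₂m 0)⁻¹ * X₁ - tauHat p α₁p α₁m α₂p α₂m * (α₂p 0 - α₂m 0)⁻¹ * X₂ := by
  rw [bootRatio, tauHat]
  by_cases h : α₂p 0 - α₂m 0 = 0
  · simp [h]
  · field_simp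

namespace FuzzyDesign

variable {Y D X : Ω → ℝ} {Ys Ds Xs : ℕ → Ω → ℝ}
  {f m₁ m₂ K : ℝ → ℝ} {xl xu ε : ℝ} {h : ℕ → ℝ} {c₁ c₂ : ℝ} {p : ℕ}
  {r₁₁ r₁₂ r₂₂ l₁₁ l₁₂ l₂₂ : ℝ}

lemma tendsto_sum_sq_score [IsProbabilityMeasure P]
    (hD : FuzzyDesign P Y D X Ys Ds Xs f m₁ m₂ K xl xu ε h c₁ c₂ p)
    (hR : ResidualCov P X (fun ω => Y ω - m₁ (X ω)) (fun ω => D ω - m₂ (X ω)) xl xu (Ici 0)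
      r₁₁ r₁₂ r₂₂)
    (hL : ResidualCov P X (fun ω => Y ω - m₁ (X ω)) (fun ω => D ω - m₂ (X ω)) xl xu (Iic 0)
      l₁₁ l₁₂ l₂₂) (κ₁ κ₂ : ℝ) :
    Tendsto (fun x : ℕ × Ω => ∑ i ∈ Finset.range x.1, ((Real.sqrt (x.1 * h x.1))⁻¹ *
      score (jumpWeight p K) c₁ c₂ m₁ m₂ κ₁ κ₂ (h x.1) (Ys i x.2, Ds i x.2, Xs i x.2)) ^ 2)
      (inProb P)
      (𝓝 (f 0 * (sideForm (sideWeight p K (Ici 0)) c₁ c₂ κ₁ κ₂ r₁₁ r₁₂ r₂₂ +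
        sideForm (sideWeight p K (Iic 0)) c₁ c₂ κ₁ κ₂ l₁₁ l₁₂ l₂₂))) := by
  obtain ⟨C, hC⟩ := hD.moment_score κ₁ κ₂
  exact hD.sample.tendsto_sum_sq_scaled
    (R := fun n => score (jumpWeight p K) c₁ c₂ m₁ m₂ κ₁ κ₂ (h n)) hD.measurable_triple hD.h_pos
    hD.nh_lim (fun n => hD.measurable_score κ₁ κ₂ (h n)) hD.fst.response.exponent_pos hC
    (hD.tendsto_integral_sq_score hR hL κ₁ κ₂)

/-- Conditional limit law of the multiplier bootstrap ratio. -/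
lemma condWeakConvInProb_bootRatio [IsProbabilityMeasure P] {Ω' : Type*} [MeasurableSpace Ω']
    {P' : Measure Ω'} [IsProbabilityMeasure P'] {ξ : ℕ → Ω' → ℝ} (hM : AssumptionM P' ξ)
    (hD : FuzzyDesign P Y D X Ys Ds Xs f m₁ m₂ K xl xu ε h c₁ c₂ p)
    (hR : ResidualCov P X (fun ω => Y ω - m₁ (X ω)) (fun ω => D ω - m₂ (X ω)) xl xu (Ici 0)
      r₁₁ r₁₂ r₂₂)
    (hL : ResidualCov P X (fun ω => Y ω - m₁ (X ω)) (fun ω => D ω - m₂ (X ω)) xl xu (Iic 0)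
      l₁₁ l₁₂ l₂₂)
    (hΓr : IsUnit (gammaMat p K (Ici 0)).det) (hΓl : IsUnit (gammaMat p K (Iic 0)).det)
    {cr₁ cl₁ cr₂ cl₂ : Fin (p + 1) → ℝ} (hr₁ : HasPolyExpansion m₁ (Ici 0) p cr₁)
    (hl₁ : HasPolyExpansion m₁ (Iic 0) p cl₁) (hr₂ : HasPolyExpansion m₂ (Ici 0) p cr₂)
    (hl₂ : HasPolyExpansion m₂ (Iic 0) p cl₂) (hne : cr₂ 0 - cl₂ 0 ≠ 0)
    {α₁p α₁m α₂p α₂m : ℕ → Ω → Fin (p + 1) → ℝ}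
    (h₁p : IsLocalPolyFit p K (Ici 0) (fun n => c₁ * h n) Ys Xs α₁p)
    (h₁m : IsLocalPolyFit p K (Iic 0) (fun n => c₁ * h n) Ys Xs α₁m)
    (h₂p : IsLocalPolyFit p K (Ici 0) (fun n => c₂ * h n) Ds Xs α₂p)
    (h₂m : IsLocalPolyFit p K (Iic 0) (fun n => c₂ * h n) Ds Xs α₂m) {τ κ : ℝ}
    (hτ : τ = (cr₁ 0 - cl₁ 0) / (cr₂ 0 - cl₂ 0)) (hκ : κ = (f 0 * (cr₂ 0 - cl₂ 0))⁻¹)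
    {σ : ℝ≥0}
    (hσ : (σ : ℝ) ^ 2 = f 0 * (sideForm (sideWeight p K (Ici 0)) c₁ c₂ κ (-τ * κ) r₁₁ r₁₂ r₂₂ +
        sideForm (sideWeight p K (Iic 0)) c₁ c₂ κ (-τ * κ) l₁₁ l₁₂ l₂₂))
    {fhat : ℕ → Ω → ℝ} (hf : TendstoInMeasure P fhat atTop (fun _ => f 0)) :
    CondWeakConvInProb P P'
      (fun n ω ω' => bootRatio p (α₁p n ω) (α₁m n ω) (α₂p n ω) (α₂m n ω)
        (empDiff p K n c₁ (h n) (fhat n ω) (α₁p n ω) (α₁m n ω)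
          (fun i => Ys i ω) (fun i => Xs i ω) (fun i => ξ i ω'))
        (empDiff p K n c₂ (h n) (fhat n ω) (α₂p n ω) (α₂m n ω)
          (fun i => Ds i ω) (fun i => Xs i ω) (fun i => ξ i ω')))
      (gaussianReal 0 (σ ^ 2)) := by
  have hJ := hD.fst.kernel.jumpWeight p
  -- The data-dependent weights `q` and `t` are the plug-in versions of `κ` and `-τ κ`.
  set q : ℕ → Ω → ℝ := fun n ω => (fhat n ω * (α₂p n ω 0 - α₂m n ω 0))⁻¹ with hq
  set t : ℕ → Ω → ℝ := fun n ω => -tauHat p (α₁p n ω) (α₁m n ω) (α₂p n ω) (α₂m n ω) * q n ω with ht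
  obtain ⟨a₁, -, -⟩ := hD.fst.jump_linear hD.c₁_pos hΓr hΓl hr₁ hl₁ h₁p h₁m
  obtain ⟨a₂, -, -⟩ := hD.snd.jump_linear hD.c₂_pos hΓr hΓl hr₂ hl₂ h₂p h₂m
  have hf0 : f 0 ≠ 0 := hD.fst.density_pos.ne'
  have hqlim : Tendsto (fun x : ℕ × Ω => q x.1 x.2) (inProb P) (𝓝 κ) := by
    rw [hκ]
    exact ((tendstoInMeasure_iff_inProb.1 hf).mul a₂).inv₀ (mul_ne_zero hf0 hne)
  have htlim : Tendsto (fun x : ℕ × Ω => t x.1 x.2) (inProb P) (𝓝 (-τ * κ)) := by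
    rw [hτ]
    exact ((a₁.div a₂ hne).neg).mul hqlim
  refine condWeakConvInProb_gaussian hM (A := fun n ω i =>
    q n ω * ((Real.sqrt (n * h n))⁻¹ * (dilate (jumpWeight p K) c₁ (Xs i ω / h n) *
      (Ys i ω - muTilde p (c₁ * h n) (α₁p n ω) (α₁m n ω) (Xs i ω)))) +
    t n ω * ((Real.sqrt (n * h n))⁻¹ * (dilate (jumpWeight p K) c₂ (Xs i ω / h n) *
      (Ds i ω - muTilde p (c₂ * h n) (α₂p n ω) (α₂m n ω) (Xs i ω))))) (fun n ω ω' => ?_) ?_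
  · rw [bootRatio_eq, empDiff_eq_sum p K n hD.c₁_pos (hD.h_pos n), empDiff_eq_sum p K n hD.c₂_pos (hD.h_pos n),
     
      Finset.mul_sum, Finset.mul_sum, ← Finset.sum_sub_distrib]
    refine Finset.sum_congr rfl fun i _ => ?_
    simp only [hq, ht, mul_inv]
    ring
  · rw [hσ]
    -- `s0` is the sum with limiting weights and true residuals; `s1` and `s2` correct the two
    -- weights, `s3` and `s4` replace the regression functions by the fits.
    have s0 := hD.tendsto_sum_sq_score hR hL κ (-τ * κ)
    have s1 := tendsto_sum_sq_mul (hD.tendsto_sum_sq_score hR hL 1 0) (hqlim.sub_const κ)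
    have s2 := tendsto_sum_sq_mul (hD.tendsto_sum_sq_score hR hL 0 1) (htlim.sub_const (-τ * κ))
    have s3 := tendsto_sum_sq_mul (hD.fst.tendsto_sum_sq_fit_error hD.c₁_pos hD.h_pos hD.h_lim
      hD.nh_lim hΓr hΓl hr₁ hl₁ h₁p h₁m (hJ.dilate hD.c₁_pos)) hqlim.neg
    have s4 := tendsto_sum_sq_mul (hD.snd.tendsto_sum_sq_fit_error hD.c₂_pos hD.h_pos hD.h_lim
      hD.nh_lim hΓr hΓl hr₂ hl₂ h₂p h₂m (hJ.dilate hD.c₂_pos)) htlim.neg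
    rw [sub_self, zero_pow two_ne_zero, zero_mul] at s1 s2
    rw [mul_zero] at s3 s4
    refine (tendsto_sum_sq_add (tendsto_sum_sq_add (tendsto_sum_sq_add
      (tendsto_sum_sq_add s0 s1) s2) s3) s4).congr fun x => ?_
    refine Finset.sum_congr rfl fun i _ => ?_
    simp only [score]
    ring

end FuzzyDesign

variable {Ω : Type*} [MeasurableSpace Ω] {P : Measure Ω}

/-! ### Positivity of the variance and the density estimator -/

lemma ResidualCov.sideVar_nonneg [IsProbabilityMeasure P] {X E₁ E₂ : Ω → ℝ} {xl xu : ℝ}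
    {S : Set ℝ} {s₁₁ s₁₂ s₂₂ : ℝ} {f : ℝ → ℝ} (hE : ResidualCov P X E₁ E₂ xl xu S s₁₁ s₁₂ s₂₂)
    (hX : HasLocalDensity P X f) (hf : 0 < f 0) (hxl : xl < 0) (hxu : 0 < xu) (hS : IsCone S)
    {K : ℝ → ℝ} (hK : IsLocal K) (p : ℕ) {c₁ c₂ : ℝ} (h₁ : 0 < c₁) (h₂ : 0 < c₂) (τ : ℝ) :
    0 ≤ sideVar (sideWeight p K S) c₁ c₂ τ s₁₁ s₁₂ s₂₂ := by
  have hw := hK.sideWeight p hS.measurableSet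
  have hz : ∀ {c : ℝ}, 0 < c → ∀ κ u, u ∉ S → κ * dilate (sideWeight p K S) c u = 0 :=
    fun hc κ u hu => by rw [dilate_sideWeight_of_notMem p K hS hc hu, mul_zero]
  have h := hE.quad_nonneg hX hf hxl hxu hS ((hw.dilate h₁).const_mul 1)
    ((hw.dilate h₂).const_mul (-τ * 1)) (hz h₁ 1) (hz h₂ (-τ * 1))
  have h2 := sideForm_eq_sideVar (sideWeight p K S) c₁ c₂ 1 τ s₁₁ s₁₂ s₂₂
  rw [one_pow, one_mul] at h2
  rw [← h2]
  exact h

/-- Positivity of the asymptotic variance. -/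
lemma sideVar_add_pos [IsProbabilityMeasure P] {X E₁ E₂ : Ω → ℝ} {xl xu : ℝ}
    {r₁₁ r₁₂ r₂₂ l₁₁ l₁₂ l₂₂ : ℝ} {f : ℝ → ℝ}
    (hR : ResidualCov P X E₁ E₂ xl xu (Ici 0) r₁₁ r₁₂ r₂₂)
    (hL : ResidualCov P X E₁ E₂ xl xu (Iic 0) l₁₁ l₁₂ l₂₂)
    (hX : HasLocalDensity P X f) (hf : 0 < f 0) (hxl : xl < 0) (hxu : 0 < xu)
    {K : ℝ → ℝ} (hK : IsLocal K) {p : ℕ} (hΓr : IsUnit (gammaMat p K (Ici 0)).det)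
    (hΓl : IsUnit (gammaMat p K (Iic 0)).det) {c₁ c₂ : ℝ} (h₁ : 0 < c₁) (h₂ : 0 < c₂) {τ : ℝ}
    (hr : 0 < r₁₁)
    (hnd : c₁ = c₂ → 0 < r₁₁ - 2 * τ * r₁₂ + τ ^ 2 * r₂₂ ∨ 0 < l₁₁ - 2 * τ * l₁₂ + τ ^ 2 * l₂₂) :
    0 < sideVar (sideWeight p K (Ici 0)) c₁ c₂ τ r₁₁ r₁₂ r₂₂ +
      sideVar (sideWeight p K (Iic 0)) c₁ c₂ τ l₁₁ l₁₂ l₂₂ := by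
  have nr := hR.sideVar_nonneg hX hf hxl hxu isCone_Ici hK p h₁ h₂ τ
  have nl := hL.sideVar_nonneg hX hf hxl hxu isCone_Iic hK p h₁ h₂ τ
  have wr := hK.sideWeight p (measurableSet_Ici (a := (0 : ℝ)))
  have wl := hK.sideWeight p (measurableSet_Iic (a := (0 : ℝ)))
  have or := integral_sideWeight hK p measurableSet_Ici hΓr
  have ol := integral_sideWeight hK p measurableSet_Iic hΓl
  -- Only equal bandwidths can let the residuals of `Y` and `τ D` cancel; otherwise the right side
  -- alone is strictly positive.
  by_cases hc : c₁ = c₂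
  · subst hc
    rcases hnd rfl with h | h
    · exact add_pos_of_pos_of_nonneg (sideVar_pos_of_eq wr or h₁ h) nl
    · exact add_pos_of_nonneg_of_pos nr (sideVar_pos_of_eq wl ol h₁ h)
  · exact add_pos_of_pos_of_nonneg (hR.sideVar_pos_of_ne hX hf hxl hxu isCone_Ici wr
      (fun u hu => sideWeight_of_notMem p K hu) or h₁ h₂ hc hr τ) nl

/-- Consistency of the kernel density estimator. -/
lemma AssumptionS.tendsto_kde [IsProbabilityMeasure P] {Y D X : Ω → ℝ} {Ys Ds Xs : ℕ → Ω → ℝ}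
    {f K : ℝ → ℝ} {xl xu : ℝ} (hS : AssumptionS P Y D X Ys Ds Xs f xl xu) (hK : IsLocal K)
    {b : ℕ → ℝ} (hb : ∀ n, 0 < b n) (hb0 : Tendsto b atTop (𝓝 0))
    (hnb : Tendsto (fun n : ℕ => (n : ℝ) * b n) atTop atTop) (hone : ∫ u, K u = 1) :
    TendstoInMeasure P (fun n ω => kde K n (b n) (fun i => Xs i ω)) atTop (fun _ => f 0) := by
  have hs : IsIIDSample P Xs (P.map X) := by
    have h := hS.sample.map (g := fun v => v.2.2) (by fun_prop)
    rwa [Measure.map_map (by fun_prop) hS.measurable_triple] at h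
  have h := hs.tendsto_sum_local hS.hasLocalDensity hb hb0 hnb hK
  rw [hone, mul_one] at h
  refine tendstoInMeasure_iff_inProb.2 (h.congr fun x => ?_)
  rw [kde, ← Finset.mul_sum, div_eq_inv_mul]

end FuzzyRDD

end

/-! ### Assembly of the theorem. -/

theorem mainTheorem5
    {Ω Ω' : Type*} [MeasurableSpace Ω] [MeasurableSpace Ω']
    (P : Measure Ω) [IsProbabilityMeasure P] (P' : Measure Ω') [IsProbabilityMeasure P']
    (Y D X : Ω → ℝ) (Ys Ds Xs : ℕ → Ω → ℝ) (f : ℝ → ℝ) (xl xu : ℝ)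
    (K : ℝ → ℝ) (ξ : ℕ → Ω' → ℝ)
    (μ₁ μ₂ σ₁₁ σ₁₂ σ₂₂ : ℝ → ℝ) (h : ℕ → ℝ) (c₁ c₂ : ℝ)
    (hS : FuzzyRDD.AssumptionS P Y D X Ys Ds Xs f xl xu)
    (hK : FuzzyRDD.AssumptionK 2 K)
    (hM : FuzzyRDD.AssumptionM P' ξ)
    (hFMRD : FuzzyRDD.AssumptionFMRD P Y D X xl xu μ₁ μ₂ σ₁₁ σ₂₂ h c₁ c₂)
    (hcov : FuzzyRDD.CondCovLimits P Y D X xl xu μ₁ μ₂ σ₁₂)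
    (hnondeg : c₁ = c₂ →
      0 < FuzzyRDD.limR (FuzzyRDD.resVar (FuzzyRDD.tauFMRD μ₁ μ₂) σ₁₁ σ₁₂ σ₂₂) ∨
      0 < FuzzyRDD.limL (FuzzyRDD.resVar (FuzzyRDD.tauFMRD μ₁ μ₂) σ₁₁ σ₁₂ σ₂₂))
    (α₁p α₁m α₂p α₂m : ℕ → Ω → Fin (2 + 1) → ℝ)
    (h₁p : FuzzyRDD.IsLocalPolyFit 2 K (Ici 0) (fun n => c₁ * h n) Ys Xs α₁p)
    (h₁m : FuzzyRDD.IsLocalPolyFit 2 K (Iic 0) (fun n => c₁ * h n) Ys Xs α₁m)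
    (h₂p : FuzzyRDD.IsLocalPolyFit 2 K (Ici 0) (fun n => c₂ * h n) Ds Xs α₂p)
    (h₂m : FuzzyRDD.IsLocalPolyFit 2 K (Iic 0) (fun n => c₂ * h n) Ds Xs α₂m) :
    (∃ σ : ℝ≥0, 0 < σ ∧
      TendstoInDistribution
        (fun (n : ℕ) ω => Real.sqrt (n * h n) *
          (FuzzyRDD.tauHat 2 (α₁p n ω) (α₁m n ω) (α₂p n ω) (α₂m n ω)
            - FuzzyRDD.tauFMRD μ₁ μ₂))
        atTop (id : ℝ → ℝ) (fun _ => P) (gaussianReal 0 (σ ^ 2)) ∧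
      ∀ fhat : ℕ → Ω → ℝ, (∀ n, Measurable (fhat n)) →
        TendstoInMeasure P fhat atTop (fun _ => f 0) →
        FuzzyRDD.CondWeakConvInProb P P'
          (fun n ω ω' =>
            FuzzyRDD.bootRatio 2 (α₁p n ω) (α₁m n ω) (α₂p n ω) (α₂m n ω)
              (FuzzyRDD.empDiff 2 K n c₁ (h n) (fhat n ω) (α₁p n ω) (α₁m n ω)
                (fun i => Ys i ω) (fun i => Xs i ω) (fun i => ξ i ω'))
              (FuzzyRDD.empDiff 2 K n c₂ (h n) (fhat n ω) (α₂p n ω) (α₂m n ω)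
                (fun i => Ds i ω) (fun i => Xs i ω) (fun i => ξ i ω')))
          (gaussianReal 0 (σ ^ 2))) ∧
    (∀ b : ℕ → ℝ, (∀ n, 0 < b n) → Tendsto b atTop (𝓝 0) →
      Tendsto (fun n : ℕ => (n : ℝ) * b n) atTop atTop → ∫ u, K u = 1 →
      TendstoInMeasure P (fun n ω => FuzzyRDD.kde K n (b n) (fun i => Xs i ω)) atTop
        (fun _ => f 0)) := by
  have hKl := hK.isLocal
  refine ⟨?_, fun b hb hb0 hnb hone => hS.tendsto_kde hKl hb hb0 hnb hone⟩
  obtain ⟨ε, D₁, D₂⟩ := hFMRD.exists_fitDesign hS hKl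
  have hD : FuzzyRDD.FuzzyDesign P Y D X Ys Ds Xs f (FuzzyRDD.punctured xl xu μ₁)
      (FuzzyRDD.punctured xl xu μ₂) K xl xu ε h c₁ c₂ 2 :=
    ⟨D₁, D₂, hS.sample, hFMRD.h_pos, hFMRD.h_tendsto, FuzzyRDD.tendsto_nat_mul_bandwidth
      hFMRD.h_pos hFMRD.h_tendsto hFMRD.nh2_tendsto, hFMRD.c₁_pos, hFMRD.c₂_pos⟩
  have hΓr : IsUnit (FuzzyRDD.gammaMat 2 K (Ici 0)).det := hK.posDef_right.det_pos.ne'.isUnit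
  have hΓl : IsUnit (FuzzyRDD.gammaMat 2 K (Iic 0)).det := hK.posDef_left.det_pos.ne'.isUnit
  obtain ⟨cr₁, er₁, hr₁⟩ := hFMRD.smooth_μ₁_right.polyExpansion_right hS.xl_neg hS.xu_pos
  obtain ⟨cl₁, el₁, hl₁⟩ := hFMRD.smooth_μ₁_left.polyExpansion_left hS.xl_neg hS.xu_pos
  obtain ⟨cr₂, er₂, hr₂⟩ := hFMRD.smooth_μ₂_right.polyExpansion_right hS.xl_neg hS.xu_pos
  obtain ⟨cl₂, el₂, hl₂⟩ := hFMRD.smooth_μ₂_left.polyExpansion_left hS.xl_neg hS.xu_pos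
  have hne : cr₂ 0 - cl₂ 0 ≠ 0 := by
    rw [er₂, el₂]
    exact sub_ne_zero.2 hFMRD.firstStage
  obtain ⟨r₁₂, tr₁₂⟩ := hcov.right
  obtain ⟨l₁₂, tl₁₂⟩ := hcov.left
  have tr₁₁ := hFMRD.smooth_σ₁₁.tendsto_limR hS.xl_neg hS.xu_pos
  have tl₁₁ := hFMRD.smooth_σ₁₁.tendsto_limL hS.xl_neg hS.xu_pos
  have tr₂₂ := hFMRD.smooth_σ₂₂.tendsto_limR hS.xl_neg hS.xu_pos
  have tl₂₂ := hFMRD.smooth_σ₂₂.tendsto_limL hS.xl_neg hS.xu_pos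
  have eR : 𝓝[>] (0 : ℝ) = 𝓝[Ici 0 \ {0}] 0 := by rw [Ici_sdiff_left]
  have eL : 𝓝[<] (0 : ℝ) = 𝓝[Iic 0 \ {0}] 0 := by rw [Iic_sdiff_right]
  have hR := hFMRD.residualCov hS hcov (S := Ici 0) (eR ▸ tr₁₁) (eR ▸ tr₁₂) (eR ▸ tr₂₂)
  have hL := hFMRD.residualCov hS hcov (S := Iic 0) (eL ▸ tl₁₁) (eL ▸ tl₁₂) (eL ▸ tl₂₂)
  set τ := FuzzyRDD.tauFMRD μ₁ μ₂ with hτ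
  have hpos := FuzzyRDD.sideVar_add_pos hR hL hS.hasLocalDensity hS.f_zero_pos hS.xl_neg hS.xu_pos
    hKl hΓr hΓl hFMRD.c₁_pos hFMRD.c₂_pos (τ := τ) hFMRD.σ₁₁_right_pos fun hc => by
      have h1 := hnondeg hc
      rwa [FuzzyRDD.limR, FuzzyRDD.limL,
        (FuzzyRDD.tendsto_resVar tr₁₁ tr₁₂ tr₂₂).limUnder_eq,
        (FuzzyRDD.tendsto_resVar tl₁₁ tl₁₂ tl₂₂).limUnder_eq] at h1
  have hτ' : τ = (cr₁ 0 - cl₁ 0) / (cr₂ 0 - cl₂ 0) := by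
    rw [er₁, el₁, er₂, el₂, hτ, FuzzyRDD.tauFMRD]
  -- The factor `f 0` comes from the limit of the design matrices, the jump from the denominator of
  -- the ratio.
  set κ := (f 0 * (cr₂ 0 - cl₂ 0))⁻¹ with hκ
  have hκ0 : κ ≠ 0 := inv_ne_zero (mul_ne_zero hS.f_zero_pos.ne' hne)
  set v := f 0 * (FuzzyRDD.sideForm (FuzzyRDD.sideWeight 2 K (Ici 0)) c₁ c₂ κ (-τ * κ)
      (FuzzyRDD.limR σ₁₁) r₁₂ (FuzzyRDD.limR σ₂₂) +
    FuzzyRDD.sideForm (FuzzyRDD.sideWeight 2 K (Iic 0)) c₁ c₂ κ (-τ * κ)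
      (FuzzyRDD.limL σ₁₁) l₁₂ (FuzzyRDD.limL σ₂₂)) with hv
  have hv0 : 0 < v := by
    rw [hv, FuzzyRDD.sideForm_eq_sideVar, FuzzyRDD.sideForm_eq_sideVar, ← mul_add]
    exact mul_pos hS.f_zero_pos (mul_pos (by positivity) hpos)
  -- The truncation in `toNNReal` is inactive since `v > 0`. The same `v` is the limit in both
  -- conclusions, and it does not depend on `fhat`.
  have hσ : ((NNReal.sqrt v.toNNReal : ℝ≥0) : ℝ) ^ 2 = v := by
    rw [← NNReal.coe_pow, NNReal.sq_sqrt, Real.coe_toNNReal _ hv0.le]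
  refine ⟨NNReal.sqrt v.toNNReal, NNReal.sqrt_pos.2 (Real.toNNReal_pos.2 hv0), ?_,
    fun fhat _ hfhat => ?_⟩
  · exact hD.tendstoInDistribution_ratio hR hL hΓr hΓl hr₁ hl₁ hr₂ hl₂ hne h₁p h₁m h₂p h₂m hτ' hκ
      (by rw [NNReal.coe_pow, hσ])
  · exact hD.condWeakConvInProb_bootRatio hM hR hL hΓr hΓl hr₁ hl₁ hr₂ hl₂ hne h₁p h₁m h₂p h₂m hτ'
      hκ hσ hfhat
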